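/- Let $\Bbbk$ be an algebraically closed field, let $n\ge 0$, and let $Q$ be a quiver of Dynkin type $\mathbb A_{n+2}$ with vertices labelled $1,\dots,n+2$ in linear order. Let $\mathrm{rep}\,Q$ be the category of finite dimensional representations of $Q$ over $\Bbbk$ and $\mathrm{ind}\,Q$ its full subcategory of indecomposable representations. For $1\le a\le b\le n+2$ let $M(a,b)$ be the representation with $\Bbbk$ at the vertices $\ell$ with $a\le \ell\le b$, $0$ at all other vertices, and identity maps wherever possible. Let $P(Q)$ be a convex $(n+3)$-gon with vertices $0,1,\dots,n+2$ placed from left to right, with $0$ and $n+2$ on a horizontal line $L$, and, for $1\le\ell\le n+1$, the vertex $\ell$ above $L$ if $\ell\to\ell+1$ in $Q$ and below $L$ if $\ell\leftarrow\ell+1$ in $Q$. Let $R$ send each vertex of $P(Q)$ to its clockwise neighbour on the boundary. Let $\Gamma_{P(Q)}$ be the quiver whose vertices are the line segments $\gamma(i,j)$, $0\le i<j\le n+2$, with one arrow $\gamma(i,j)\to\gamma(i',j')$ if $\gamma(i',j')$ is a pivot of $\gamma(i,j)$, that is, if $(i',j')=(R^{-1}(i),j)$ or $(i',j')=(i,R^{-1}(j))$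 (and $i'<j'$). Put $R(\gamma(i,j))=\gamma(R(i),R(j))$ if $R(i)<R(j)$, and let $R(\gamma(i,j))$ be undefined (written $0$) otherwise. Let $\mathcal C_{P(Q)}$ be the mesh category of $(\Gamma_{P(Q)},R)$: the $\Bbbk$-linear path category of $\Gamma_{P(Q)}$ modulo the ideal generated by the mesh relations $\sum_{y\to x}(Rx\to y\to x)$, one for each line segment $x$ with $R(x)$ defined. For each pivot $\gamma(i,j)\to\gamma(i',j')$, the map $M(i+1,j)\to M(i'+1,j')$ that is the identity of $\Bbbk$ on the common support and $0$ elsewhere is a morphism of representations: an inclusion (adding a hook) or a projection (removing a cohook). Consider the $\Bbbk$-linear functors $F\colon\mathcal C_{P(Q)}\to\mathrm{ind}\,Q$ with $F(\gamma(i,j))=M(i+1,j)$ that send each pivot to a nonzero scalar multiple of this morphism, that is, those given by any choice of nonzero scalars for which the mesh relations hold. Then such functors $F$ exist, the scalars can even be chosen in $\{1,-1\}$, and every such $F$ is an equivalence of categories. Moreover, for every such $F$: 1. $(\Gamma_{P(Q)},R)$ and $(\Gamma_{\mathrm{rep}\,Q},\tau)$ are translation quivers, and $\gamma\mapsto[F(\gamma)]$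 is the map on vertices of an isomorphism between them. Here $\Gamma_{\mathrm{rep}\,Q}$ is the Auslander--Reiten quiver, whose vertices are the isomorphism classes of indecomposable representations, with $\dim_\Bbbk \mathrm{rad}(M,N)/\mathrm{rad}^2(M,N)$ arrows from $[M]$ to $[N]$, and $\tau$ is the Auslander--Reiten translation, defined at the nonprojective indecomposables, with $\tau M$ the left end term of an almost split sequence $0\to\tau M\to E\to M\to 0$. On arrows, for all line segments $\gamma,\delta$, the classes of the morphisms $F(p)$, for $p\colon\gamma\to\delta$ a pivot, form a basis of $\mathrm{rad}(F\gamma,F\delta)/\mathrm{rad}^2(F\gamma,F\delta)$. 2. $F$ induces bijections from the set of line segments of $P(Q)$ to the set of isomorphism classes of indecomposable representations, and from the set of pivots to the set of isomorphism classes (in the category of morphisms of $\mathrm{rep}\,Q$) of irreducible morphisms between indecomposable representations. 3. $F\circ R=\tau\circ F$: for a line segment $\gamma$, $R(\gamma)=0$ if and only if $F(\gamma)$ is projective, and $R(\gamma)=\delta$ if and only if $F(\delta)\cong\tau F(\gamma)$. 4. The additive closure $\mathrm{add}\,\mathcal C_{P(Q)}$ (formal finite direct sums of line segments, with matrices of morphisms)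 is an abelian category, and the additive extension $\mathrm{add}\,\mathcal C_{P(Q)}\to\mathrm{rep}\,Q$ of $F$ is an equivalence and an exact functor. -/

import Mathlib

open CategoryTheory CategoryTheory.Limits

universe u v w v' w'

noncomputable section

/-! ## Translation quivers and mesh categories

A translation quiver is a quiver `V` together with a partially defined map `τ`;
`τ x = none` means that `τ` is not defined at `x`. -/

namespace TransQuiver

/-- The axioms of a translation quiver: there are no loops, `τ` is injective on its domain, and for
`x` in the domain the number of arrows `y ⟶ x` is the number of arrows `τ x ⟶ y`. -/
structure IsTranslationQuiver {V : Type u} [Quiver.{v} V] (τ : V → Option V) : Prop where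
  no_loops : ∀ x : V, IsEmpty (x ⟶ x)
  injective : ∀ x y z : V, τ x = some z → τ y = some z → x = y
  card_arrows : ∀ x z : V, τ x = some z → ∀ y : V, Nat.card (y ⟶ x) = Nat.card (z ⟶ y)

/-- Isomorphisms of translation quivers. -/
structure Iso {V : Type u} [Quiver.{v} V] {W : Type w} [Quiver.{v'} W]
    (τ : V → Option V) (σ : W → Option W) where
  vertex : V ≃ W
  arrow : ∀ x y : V, (x ⟶ y) ≃ (vertex x ⟶ vertex y)
  translation : ∀ x : V, (τ x).map vertex = σ (vertex x)

section PathCategory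

variable (k : Type u) [Field k] {V : Type w} [Quiver.{v} V]

/-- The path category of `V` over `k`: morphisms are formal `k`-linear combinations of paths. -/
abbrev PathCategory (V : Type w) [Quiver.{v} V] := Free k (Paths V)

/-- The vertex `x`, as an object of the path category. -/
def pathObj (x : V) : PathCategory k V := Free.of k ((Paths.of V).obj x)

/-- The vertex underlying an object of the path category. -/
def pathVertex (X : PathCategory k V) : V := X

/-- A path, as a morphism of the path category. -/
def ofPath {X Y : PathCategory k V} (p : Quiver.Path (pathVertex k X) (pathVertex k Y)) : X ⟶ Y :=
  (Free.embedding k (Paths V)).map p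

/-- An arrow, as a morphism of the path category. -/
def pathArrow {x y : V} (α : x ⟶ y) : pathObj k x ⟶ pathObj k y :=
  ofPath k (X := pathObj k x) (Y := pathObj k y) α.toPath

theorem ofPath_comp {X Y Z : PathCategory k V} (p : Quiver.Path (pathVertex k X) (pathVertex k Y))
    (q : Quiver.Path (pathVertex k Y) (pathVertex k Z)) :
    ofPath k p ≫ ofPath k q = ofPath k (p.comp q) :=
  ((Free.embedding k (Paths V)).map_comp p q).symm

theorem pathCategory_induction {X Y : PathCategory k V} {P : (X ⟶ Y) → Prop} (f : X ⟶ Y)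
    (h0 : P 0) (hadd : ∀ f g, P f → P g → P (f + g))
    (hsmul : ∀ (r : k) (p : Quiver.Path (pathVertex k X) (pathVertex k Y)),
      P (r • ofPath k p)) : P f := by
  refine Finsupp.induction_linear (motive := P) f h0 hadd fun p r => ?_
  have h := hsmul r p
  have e : r • ofPath k p = (Finsupp.single p r : X ⟶ Y) := by
    refine (Finsupp.smul_single r p (1 : k)).trans ?_
    rw [smul_eq_mul, mul_one]
  rwa [e] at h

variable {D : Type w'} [Category.{v'} D] [Preadditive D] [Linear k D]

/-- The `k`-linear map on combinations of paths that is given by its values on the arrows. -/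
def pathLiftMap (φ : V ⥤q D) (X Y : PathCategory k V) :
    (X ⟶ Y) →ₗ[k] (φ.obj (pathVertex k X) ⟶ φ.obj (pathVertex k Y)) :=
  Finsupp.linearCombination k
    (fun p : Quiver.Path (pathVertex k X) (pathVertex k Y) => (Paths.lift φ).map p)

theorem pathLiftMap_ofPath (φ : V ⥤q D) {X Y : PathCategory k V}
    (p : Quiver.Path (pathVertex k X) (pathVertex k Y)) :
    pathLiftMap k φ X Y (ofPath k p) = (Paths.lift φ).map p := by
  have := Finsupp.linearCombination_single k (v := fun
    p : Quiver.Path (pathVertex k X) (pathVertex k Y) => (Paths.lift φ).map p) 1 p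
  rw [one_smul] at this
  exact this

theorem pathLiftMap_comp (φ : V ⥤q D) {X Y Z : PathCategory k V} (f : X ⟶ Y) (g : Y ⟶ Z) :
    pathLiftMap k φ X Z (f ≫ g) = pathLiftMap k φ X Y f ≫ pathLiftMap k φ Y Z g := by
  refine pathCategory_induction k (P := fun f => pathLiftMap k φ X Z (f ≫ g) =
    pathLiftMap k φ X Y f ≫ pathLiftMap k φ Y Z g) f ?_ (fun f f' h h' => ?_) fun r p => ?_
  · rw [zero_comp, map_zero, map_zero, zero_comp]
  · rw [Preadditive.add_comp, map_add, map_add, h, h', Preadditive.add_comp]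
  refine pathCategory_induction k (P := fun g => pathLiftMap k φ X Z (_ ≫ g) =
    pathLiftMap k φ X Y _ ≫ pathLiftMap k φ Y Z g) g ?_ (fun f f' h h' => ?_) fun s q => ?_
  · rw [comp_zero, map_zero, map_zero, comp_zero]
  · rw [Preadditive.comp_add, map_add, map_add, h, h', Preadditive.comp_add]
  rw [Linear.smul_comp, Linear.comp_smul, map_smul, map_smul, map_smul, map_smul,
    Linear.smul_comp, Linear.comp_smul, ofPath_comp, pathLiftMap_ofPath, pathLiftMap_ofPath,
    pathLiftMap_ofPath]
  exact congrArg (fun t => r • s • t) ((Paths.lift φ).map_comp p q)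

/-- The `k`-linear functor on the path category that is given by its values on the arrows. -/
def pathLift (φ : V ⥤q D) : PathCategory k V ⥤ D where
  obj X := φ.obj (pathVertex k X)
  map {X Y} f := pathLiftMap k φ X Y f
  map_id X := (pathLiftMap_ofPath k φ (X := X) Quiver.Path.nil).trans
    ((Paths.lift φ).map_id X)
  map_comp f g := pathLiftMap_comp k φ f g

theorem pathLift_pathArrow (φ : V ⥤q D) {x y : V} (α : x ⟶ y) :
    (pathLift k φ).map (pathArrow k α) = φ.map α :=
  (pathLiftMap_ofPath k φ _).trans (Paths.lift_toPath φ α)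

instance pathLift_additive (φ : V ⥤q D) : (pathLift k φ).Additive where
  map_add {X Y} f g := (pathLiftMap k φ X Y).map_add f g

instance pathLift_linear (φ : V ⥤q D) : (pathLift k φ).Linear k where
  map_smul {X Y} f r := (pathLiftMap k φ X Y).map_smul r f

end PathCategory

section Mesh

variable (k : Type u) [Field k] {V : Type w} [Quiver.{v} V] [Fintype V]
  [∀ x y : V, Fintype (x ⟶ y)] (τ : V → Option V)

/-- The mesh relation at `x` with `z = τ x`. There being no multiple arrows, each arrow
`α : y ⟶ x` has exactly one partner `β = σ(α) : z ⟶ y`, so this is the sum of all `σ(α) α`. -/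
def meshRelator (z x : V) : pathObj k z ⟶ pathObj k x :=
  ∑ y : V, ∑ β : z ⟶ y, ∑ α : y ⟶ x, pathArrow k β ≫ pathArrow k α

/-- The mesh ideal: the two-sided ideal generated by the mesh relations. -/
def meshIdeal (X Y : PathCategory k V) : Submodule k (X ⟶ Y) :=
  Submodule.span k {f | ∃ (x z : V) (_ : τ x = some z) (p : X ⟶ pathObj k z)
    (q : pathObj k x ⟶ Y), f = p ≫ meshRelator k z x ≫ q}

/-- Congruence modulo the mesh ideal. -/
def meshRel : HomRel (PathCategory k V) := fun X Y f g => f - g ∈ meshIdeal k τ X Y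

theorem meshIdeal_comp_left {X Y Z : PathCategory k V} (f : X ⟶ Y) {g : Y ⟶ Z}
    (hg : g ∈ meshIdeal k τ Y Z) : f ≫ g ∈ meshIdeal k τ X Z := by
  have : meshIdeal k τ Y Z ≤ (meshIdeal k τ X Z).comap (Linear.leftComp k Z f) := by
    refine Submodule.span_le.2 ?_
    rintro _ ⟨x, z, h, p, q, rfl⟩
    exact Submodule.subset_span ⟨x, z, h, f ≫ p, q, by simp⟩
  exact this hg

theorem meshIdeal_comp_right {X Y Z : PathCategory k V} {f : X ⟶ Y} (g : Y ⟶ Z)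
    (hf : f ∈ meshIdeal k τ X Y) : f ≫ g ∈ meshIdeal k τ X Z := by
  have : meshIdeal k τ X Y ≤ (meshIdeal k τ X Z).comap (Linear.rightComp k X g) := by
    refine Submodule.span_le.2 ?_
    rintro _ ⟨x, z, h, p, q, rfl⟩
    exact Submodule.subset_span ⟨x, z, h, p, q ≫ g, by simp⟩
  exact this hf

instance meshRel_congruence : Congruence (meshRel k τ) where
  equivalence :=
    { refl := fun f => by simp [meshRel]
      symm := fun {f g} h => by
        have := (meshIdeal k τ _ _).neg_mem h
        simpa [meshRel] using this
      trans := fun {f g h} h₁ h₂ => by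
        have := (meshIdeal k τ _ _).add_mem h₁ h₂
        simpa [meshRel] using this }
  comp_left := fun f _ _ h => by
    have := meshIdeal_comp_left k τ f h
    simpa [meshRel, Preadditive.comp_sub] using this
  comp_right := fun g h => by
    have := meshIdeal_comp_right k τ g h
    simpa [meshRel, Preadditive.sub_comp] using this

/-- The mesh category: the path category modulo the mesh ideal. -/
abbrev MeshCategory := CategoryTheory.Quotient (meshRel k τ)

theorem meshRel_add ⦃X Y : PathCategory k V⦄ (f₁ f₂ g₁ g₂ : X ⟶ Y)
    (hf : meshRel k τ f₁ f₂) (hg : meshRel k τ g₁ g₂) :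
    meshRel k τ (f₁ + g₁) (f₂ + g₂) := by
  have := (meshIdeal k τ _ _).add_mem hf hg
  rwa [← add_sub_add_comm] at this

theorem meshRel_smul (a : k) ⦃X Y : PathCategory k V⦄ (f₁ f₂ : X ⟶ Y)
    (hf : meshRel k τ f₁ f₂) : meshRel k τ (a • f₁) (a • f₂) := by
  have := (meshIdeal k τ _ _).smul_mem a hf
  rwa [smul_sub] at this

instance meshPreadditive : Preadditive (MeshCategory k τ) :=
  CategoryTheory.Quotient.preadditive (meshRel k τ) (meshRel_add k τ)

instance meshFunctor_additive : (CategoryTheory.Quotient.functor (meshRel k τ)).Additive :=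
  CategoryTheory.Quotient.functor_additive (meshRel k τ) (meshRel_add k τ)

instance meshLinear : Linear k (MeshCategory k τ) :=
  CategoryTheory.Quotient.linear k (meshRel k τ) (meshRel_smul k τ)

instance meshFunctor_linear : (CategoryTheory.Quotient.functor (meshRel k τ)).Linear k :=
  CategoryTheory.Quotient.linear_functor k (meshRel k τ) (meshRel_smul k τ)

/-- The vertex `x`, as an object of the mesh category. -/
def meshObj (x : V) : MeshCategory k τ :=
  (CategoryTheory.Quotient.functor (meshRel k τ)).obj (pathObj k x)

/-- The morphism of the mesh category given by an arrow. -/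
def meshArrow {x y : V} (α : x ⟶ y) : meshObj k τ x ⟶ meshObj k τ y :=
  (CategoryTheory.Quotient.functor (meshRel k τ)).map (pathArrow k α)

variable {D : Type w'} [Category.{v'} D] [Preadditive D] [Linear k D]

theorem pathLift_meshRelator (φ : V ⥤q D) (z x : V) :
    (pathLift k φ).map (meshRelator k z x) =
      ∑ y : V, ∑ β : z ⟶ y, ∑ α : y ⟶ x, φ.map β ≫ φ.map α := by
  simp only [meshRelator, Functor.map_sum, Functor.map_comp, pathLift_pathArrow]
  rfl

/-- A family of values on arrows that satisfies the mesh relations gives a functor on the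
mesh category. -/
def meshLift (φ : V ⥤q D)
    (hφ : ∀ x z : V, τ x = some z →
      ∑ y : V, ∑ β : z ⟶ y, ∑ α : y ⟶ x, φ.map β ≫ φ.map α = 0) :
    MeshCategory k τ ⥤ D :=
  CategoryTheory.Quotient.lift (meshRel k τ) (pathLift k φ) (by
    intro X Y f g h
    have hle : meshIdeal k τ X Y ≤ LinearMap.ker ((pathLift k φ).mapLinearMap k) := by
      refine Submodule.span_le.2 ?_
      rintro _ ⟨x, z, hx, p, q, rfl⟩
      have h0 : (pathLift k φ).map (meshRelator k z x) = 0 :=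
        (pathLift_meshRelator k φ z x).trans (hφ x z hx)
      simp only [SetLike.mem_coe, LinearMap.mem_ker, Functor.coe_mapLinearMap, Functor.map_comp,
        h0, zero_comp, comp_zero]
    have := hle h
    rw [LinearMap.mem_ker, map_sub, sub_eq_zero] at this
    exact this)

theorem meshLift_map_functor (φ : V ⥤q D) (hφ) {X Y : PathCategory k V} (f : X ⟶ Y) :
    (meshLift k τ φ hφ).map ((CategoryTheory.Quotient.functor (meshRel k τ)).map f) =
      (pathLift k φ).map f := rfl

theorem meshLift_meshArrow (φ : V ⥤q D) (hφ) {x y : V} (α : x ⟶ y) :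
    (meshLift k τ φ hφ).map (meshArrow k τ α) = φ.map α :=
  pathLift_pathArrow k φ α

instance meshLift_additive (φ : V ⥤q D) (hφ) : (meshLift k τ φ hφ).Additive where
  map_add := by
    rintro ⟨X⟩ ⟨Y⟩ f g
    obtain ⟨f, rfl⟩ := (CategoryTheory.Quotient.functor (meshRel k τ)).map_surjective f
    obtain ⟨g, rfl⟩ := (CategoryTheory.Quotient.functor (meshRel k τ)).map_surjective g
    rw [← Functor.map_add, meshLift_map_functor, meshLift_map_functor, meshLift_map_functor,
      Functor.map_add]
    rfl

instance meshLift_linear (φ : V ⥤q D) (hφ) : (meshLift k τ φ hφ).Linear k where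
  map_smul := by
    rintro ⟨X⟩ ⟨Y⟩ f a
    obtain ⟨f, rfl⟩ := (CategoryTheory.Quotient.functor (meshRel k τ)).map_surjective f
    rw [← Functor.map_smul, meshLift_map_functor, meshLift_map_functor, Functor.map_smul]
    rfl

end Mesh

end TransQuiver

/-! ## The additive closure of a functor -/

/-- The extension of an additive functor `F : C ⥤ D` to the additive closure `Mat_ C` of `C`
(the category of formal finite direct sums of objects of `C`, with matrices as morphisms). -/
def additiveExtension {C : Type w} [Category.{v} C] [Preadditive C] {D : Type w'}
    [Category.{v'} D] [Preadditive D] [HasFiniteBiproducts D] (F : C ⥤ D) [F.Additive] :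
    Mat_ C ⥤ D where
  obj X := ⨁ fun i => F.obj (X.X i)
  map f := biproduct.matrix fun i j => F.map (f i j)
  map_id X := by
    ext i j
    by_cases h : j = i
    · subst h; simp
    · simp [Mat_.id_apply, h]
  map_comp f g := by
    ext i j
    simp [biproduct.lift_desc]

/-- A preadditive category is abelian. -/
def IsAbelianCategory (C : Type w) [Category.{v} C] [P : Preadditive C] : Prop :=
  ∃ A : Abelian C, A.toPreadditive = P

/-! ## Quivers of type `A_{n+2}` and the polygon -/

/-- A quiver of type `A_{n+2}` with vertices labelled `1, …, n+2` in linear order, given by the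
orientation of its `n+1` edges: if `right a` is true, then the `a`-th edge (counting from `0`) is
the arrow `a+1 → a+2`, otherwise it is the arrow `a+1 ← a+2`. -/
structure TypeA (n : ℕ) where
  right : Fin (n + 1) → Bool

namespace TypeA

variable {n : ℕ} (Q : TypeA n)

/-- The vertices of the quiver. -/
def Vertex (_ : TypeA n) : Type := Fin (n + 2)

/-- The label of a vertex, a number from `1` to `n+2`. -/
def label {Q : TypeA n} (l : Q.Vertex) : ℕ := Fin.val l + 1

/-- There is an arrow from `s` to `t`. -/
def IsArrow (s t : Q.Vertex) : Prop :=
  (∃ a : Fin (n + 1), Q.right a = true ∧ label s = a + 1 ∧ label t = a + 2) ∨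
  (∃ a : Fin (n + 1), Q.right a = false ∧ label s = a + 2 ∧ label t = a + 1)

instance : Quiver.{0} Q.Vertex where
  Hom s t := PLift (Q.IsArrow s t)

/-- The vertex `l` of the polygon is upper-barred: `l → l+1` is an arrow of `Q`. -/
def IsUpper (l : Fin (n + 3)) : Prop := ∃ a : Fin (n + 1), Q.right a = true ∧ (l : ℕ) = a + 1

/-- The vertex `l` of the polygon is lower-barred: `l ← l+1` is an arrow of `Q`. -/
def IsLower (l : Fin (n + 3)) : Prop := ∃ a : Fin (n + 1), Q.right a = false ∧ (l : ℕ) = a + 1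

/-- The vertices `0`, `n+2` and the upper-barred ones: the vertices on the upper part of
the boundary of the polygon, which runs through them from left to right in numerical order. -/
def OnUpper (l : Fin (n + 3)) : Prop := l = 0 ∨ l = Fin.last (n + 2) ∨ Q.IsUpper l

/-- The vertices on the lower part of the boundary of the polygon. -/
def OnLower (l : Fin (n + 3)) : Prop := l = 0 ∨ l = Fin.last (n + 2) ∨ Q.IsLower l

/-- `m` is the clockwise neighbour of `l` on the boundary of the polygon: either `m` comes
right after `l` on the upper part of the boundary (which is run through from left to right), or `m`
comes right before `l` on the lower part (which is run through from right to left). -/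
def ClockwiseNext (l m : Fin (n + 3)) : Prop :=
  (Q.OnUpper l ∧ Q.OnUpper m ∧ l < m ∧ ∀ r, Q.OnUpper r → ¬ (l < r ∧ r < m)) ∨
  (Q.OnLower l ∧ Q.OnLower m ∧ m < l ∧ ∀ r, Q.OnLower r → ¬ (m < r ∧ r < l))

theorem onUpper_or_onLower (l : Fin (n + 3)) : Q.OnUpper l ∨ Q.OnLower l := by
  by_cases h0 : l = 0
  · exact Or.inl (Or.inl h0)
  by_cases h1 : l = Fin.last (n + 2)
  · exact Or.inl (Or.inr (Or.inl h1))
  have h2 : (l : ℕ) ≠ 0 := fun h => h0 (Fin.ext h)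
  have h3 : (l : ℕ) ≠ n + 2 := fun h => h1 (Fin.ext h)
  have h4 := l.isLt
  rcases hb : Q.right ⟨l - 1, by omega⟩ with _ | _
  · exact Or.inr (Or.inr (Or.inr ⟨_, hb, by simp; omega⟩))
  · exact Or.inl (Or.inr (Or.inr ⟨_, hb, by simp; omega⟩))

theorem not_isUpper_and_isLower {l : Fin (n + 3)} (h : Q.IsUpper l) (h' : Q.IsLower l) :
    False := by
  obtain ⟨a, ha, hl⟩ := h
  obtain ⟨b, hb, hl'⟩ := h'
  have : a = b := Fin.ext (by omega)
  rw [this, hb] at ha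
  exact Bool.false_ne_true ha

theorem not_isUpper_zero : ¬ Q.IsUpper 0 := fun ⟨a, _, h⟩ => by simp at h
theorem not_isLower_zero : ¬ Q.IsLower 0 := fun ⟨a, _, h⟩ => by simp at h
theorem not_isUpper_last : ¬ Q.IsUpper (Fin.last (n + 2)) := fun ⟨a, _, h⟩ => by
  have := a.isLt; simp at h; omega
theorem not_isLower_last : ¬ Q.IsLower (Fin.last (n + 2)) := fun ⟨a, _, h⟩ => by
  have := a.isLt; simp at h; omega

theorem onUpper_and_onLower {l : Fin (n + 3)} (h : Q.OnUpper l) (h' : Q.OnLower l) :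
    l = 0 ∨ l = Fin.last (n + 2) := by
  rcases h with h | h | h
  · exact Or.inl h
  · exact Or.inr h
  · rcases h' with h' | h' | h'
    · exact Or.inl h'
    · exact Or.inr h'
    · exact (Q.not_isUpper_and_isLower h h').elim

theorem exists_next (S : Fin (n + 3) → Prop) (l t : Fin (n + 3)) (ht : S t) (hlt : l < t) :
    ∃ m, S m ∧ l < m ∧ ∀ r, S r → ¬ (l < r ∧ r < m) := by
  classical
  have hne : (Finset.univ.filter fun m => S m ∧ l < m).Nonempty := ⟨t, by simp [ht, hlt]⟩
  refine ⟨_, (by simpa using Finset.min'_mem _ hne :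
    S (Finset.min' _ hne) ∧ l < Finset.min' _ hne).1, (by simpa using Finset.min'_mem _ hne :
    S (Finset.min' _ hne) ∧ l < Finset.min' _ hne).2, fun r hr h => ?_⟩
  exact absurd h.2 (not_lt.2 (Finset.min'_le _ _ (by simp [hr, h.1])))

theorem exists_prev (S : Fin (n + 3) → Prop) (l t : Fin (n + 3)) (ht : S t) (hlt : t < l) :
    ∃ m, S m ∧ m < l ∧ ∀ r, S r → ¬ (m < r ∧ r < l) := by
  classical
  have hne : (Finset.univ.filter fun m => S m ∧ m < l).Nonempty := ⟨t, by simp [ht, hlt]⟩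
  refine ⟨_, (by simpa using Finset.max'_mem _ hne :
    S (Finset.max' _ hne) ∧ Finset.max' _ hne < l).1, (by simpa using Finset.max'_mem _ hne :
    S (Finset.max' _ hne) ∧ Finset.max' _ hne < l).2, fun r hr h => ?_⟩
  exact absurd h.1 (not_lt.2 (Finset.le_max' _ _ (by simp [hr, h.2])))

theorem exists_clockwiseNext (l : Fin (n + 3)) : ∃ m, Q.ClockwiseNext l m := by
  by_cases h : Q.OnUpper l ∧ l ≠ Fin.last (n + 2)
  · obtain ⟨m, h1, h2, h3⟩ := exists_next Q.OnUpper l (Fin.last (n + 2)) (Or.inr (Or.inl rfl))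
      (lt_of_le_of_ne (Fin.le_last l) h.2)
    exact ⟨m, Or.inl ⟨h.1, h1, h2, h3⟩⟩
  · have hl : Q.OnLower l := by
      rcases Q.onUpper_or_onLower l with h' | h'
      · exact Or.inr (Or.inl (by by_contra hne; exact h ⟨h', hne⟩))
      · exact h'
    have h0 : l ≠ 0 := by
      rintro rfl
      refine h ⟨Or.inl rfl, fun e => ?_⟩
      simpa using congrArg Fin.val e
    obtain ⟨m, h1, h2, h3⟩ := exists_prev Q.OnLower l 0 (Or.inl rfl)
      (lt_of_le_of_ne (Fin.zero_le l) h0.symm)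
    exact ⟨m, Or.inr ⟨hl, h1, h2, h3⟩⟩

theorem clockwiseNext_left_unique {l l' m : Fin (n + 3)} (h : Q.ClockwiseNext l m)
    (h' : Q.ClockwiseNext l' m) : l = l' := by
  rcases h with ⟨a1, a2, a3, a4⟩ | ⟨a1, a2, a3, a4⟩ <;>
    rcases h' with ⟨b1, b2, b3, b4⟩ | ⟨b1, b2, b3, b4⟩
  · rcases lt_trichotomy l l' with h | h | h
    · exact (a4 l' b1 ⟨h, b3⟩).elim
    · exact h
    · exact (b4 l a1 ⟨h, a3⟩).elim
  · rcases Q.onUpper_and_onLower a2 b2 with rfl | rfl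
    · exact absurd a3 (Fin.not_lt_zero l)
    · exact absurd b3 (not_lt.2 (Fin.le_last l'))
  · rcases Q.onUpper_and_onLower b2 a2 with rfl | rfl
    · exact absurd b3 (Fin.not_lt_zero l')
    · exact absurd a3 (not_lt.2 (Fin.le_last l))
  · rcases lt_trichotomy l l' with h | h | h
    · exact (b4 l a1 ⟨a3, h⟩).elim
    · exact h
    · exact (a4 l' b1 ⟨b3, h⟩).elim

/-- The rotation `R` of the vertices of the polygon, which sends each vertex to its clockwise
neighbour on the boundary; `(Q.R).symm` sends it to its counterclockwise neighbour. -/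
def R : Equiv.Perm (Fin (n + 3)) :=
  Equiv.ofBijective (fun l => (Q.exists_clockwiseNext l).choose)
    (Finite.injective_iff_bijective.1 fun l l' h => Q.clockwiseNext_left_unique
      (Q.exists_clockwiseNext l).choose_spec
      (by
        have := (Q.exists_clockwiseNext l').choose_spec
        exact h ▸ this))

theorem clockwiseNext_R (l : Fin (n + 3)) : Q.ClockwiseNext l (Q.R l) :=
  (Q.exists_clockwiseNext l).choose_spec

theorem clockwiseNext_R_symm (l : Fin (n + 3)) : Q.ClockwiseNext (Q.R.symm l) l := by
  have := Q.clockwiseNext_R (Q.R.symm l)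
  rwa [Equiv.apply_symm_apply] at this

theorem clockwiseNext_ne {l m : Fin (n + 3)} (h : Q.ClockwiseNext l m) : l ≠ m := by
  rcases h with h | h
  · exact ne_of_lt h.2.2.1
  · exact (ne_of_lt h.2.2.1).symm

theorem R_ne (l : Fin (n + 3)) : Q.R l ≠ l := (Q.clockwiseNext_ne (Q.clockwiseNext_R l)).symm

/-! ### Line segments, pivots and the rotation -/

/-- The line segments `γ(i, j)`, `0 ≤ i < j ≤ n+2`, of the polygon (boundary edges included). -/
def Segment (_ : TypeA n) : Type := {p : Fin (n + 3) × Fin (n + 3) // p.1 < p.2}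

instance : Fintype Q.Segment := inferInstanceAs (Fintype {p : Fin (n + 3) × Fin (n + 3) // p.1 < p.2})

instance : DecidableEq Q.Segment :=
  inferInstanceAs (DecidableEq {p : Fin (n + 3) × Fin (n + 3) // p.1 < p.2})

variable {Q} in
/-- The left end point `i` of `γ(i, j)`. -/
def Segment.i (γ : Q.Segment) : Fin (n + 3) := γ.1.1

variable {Q} in
/-- The right end point `j` of `γ(i, j)`. -/
def Segment.j (γ : Q.Segment) : Fin (n + 3) := γ.1.2

variable {Q} in
theorem Segment.i_lt_j (γ : Q.Segment) : γ.i < γ.j := γ.2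

variable {Q} in
theorem Segment.ext {γ δ : Q.Segment} (hi : γ.i = δ.i) (hj : γ.j = δ.j) : γ = δ :=
  Subtype.ext (Prod.ext hi hj)

/-- `δ` is a pivot of `γ`: one end point moves to its counterclockwise neighbour and the other one is
fixed. -/
def IsPivot (γ δ : Q.Segment) : Prop :=
  (δ.i = Q.R.symm γ.i ∧ δ.j = γ.j) ∨ (δ.i = γ.i ∧ δ.j = Q.R.symm γ.j)

/-- The quiver of line segments, with one arrow for each pivot. -/
instance : Quiver.{0} Q.Segment where
  Hom γ δ := PLift (Q.IsPivot γ δ)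

open Classical in
instance (γ δ : Q.Segment) : Fintype (γ ⟶ δ) := inferInstanceAs (Fintype (PLift (Q.IsPivot γ δ)))

/-- The translation of the quiver of line segments: `γ(i, j) ↦ γ(R i, R j)` if `R i < R j`,
and undefined otherwise. -/
def rotation (γ : Q.Segment) : Option Q.Segment :=
  if h : Q.R γ.i < Q.R γ.j then some ⟨(Q.R γ.i, Q.R γ.j), h⟩ else none

theorem rotation_eq_some {γ δ : Q.Segment} (h : Q.rotation γ = some δ) :
    δ.i = Q.R γ.i ∧ δ.j = Q.R γ.j := by
  unfold rotation at h
  split_ifs at h with h'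
  cases h
  exact ⟨rfl, rfl⟩

end TypeA

/-! ## Representations -/

/-- A natural transformation between functors on a path category, given by its components. -/
def pathNatTrans {V : Type w} [Quiver.{v} V] {C : Type w'} [Category.{v'} C] (φ ψ : V ⥤q C)
    (η : ∀ x, φ.obj x ⟶ ψ.obj x)
    (h : ∀ (x y : V) (α : x ⟶ y), φ.map α ≫ η y = η x ≫ ψ.map α) :
    Paths.lift φ ⟶ Paths.lift ψ where
  app x := η x
  naturality := by
    suffices key : ∀ (X Y : V) (p : Quiver.Path X Y),
        (Paths.lift φ).map p ≫ η Y = η X ≫ (Paths.lift ψ).map p from fun X Y p => key X Y p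
    intro X Y p
    induction p with
    | nil => exact (Category.id_comp _).trans (Category.comp_id _).symm
    | cons p α ih =>
      refine (Category.assoc _ _ _).trans ?_
      refine (congrArg (fun t => (Paths.lift φ).map p ≫ t) (h _ _ α)).trans ?_
      refine (Category.assoc _ _ _).symm.trans ?_
      exact (congrArg (fun t => t ≫ ψ.map α) ih).trans (Category.assoc _ _ _)

namespace TypeA

variable {n : ℕ} (Q : TypeA n) (k : Type u) [Field k]

/-- The category `rep Q` of finite dimensional representations of `Q` over `k`: functors from the
path category of `Q` to finite dimensional vector spaces. -/
abbrev Rep := Paths Q.Vertex ⥤ FGModuleCat.{u} k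

/-- The category `ind Q` of indecomposable finite dimensional representations: the full
subcategory of `rep Q` on the indecomposable objects. -/
abbrev Ind := ObjectProperty.FullSubcategory (fun M : Q.Rep k => Indecomposable M)

open Classical in
/-- The vector space `k` if `p` holds and `0` otherwise. -/
def line (p : Prop) : Submodule k k := if p then ⊤ else ⊥

open Classical in
/-- The identity of `k` if `p` and `q` hold, and `0` otherwise. -/
def lineMap (p q : Prop) : line k p →ₗ[k] line k q :=
  if h : q then (line k p).subtype.codRestrict (line k q) (fun _ => by simp [line, h]) else 0

theorem line_eq_zero {p : Prop} (hp : ¬ p) (x : line k p) : x = 0 := by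
  obtain ⟨x, hx⟩ := x
  simp only [line, if_neg hp, Submodule.mem_bot] at hx
  exact Subtype.ext hx

theorem lineMap_of {p q : Prop} (hq : q) (x : line k p) : (lineMap k p q x : k) = x := by
  simp only [lineMap, dif_pos hq]
  rfl

variable {Q} in
/-- The vertex `l` lies between the vertices `a` and `b`. -/
def Between (a b : ℕ) (l : Q.Vertex) : Prop := a ≤ label l ∧ label l ≤ b

/-- The values of `M(a, b)` at the vertices and the arrows. -/
def intervalPrefunctor (a b : ℕ) : Q.Vertex ⥤q FGModuleCat.{u} k where
  obj l := FGModuleCat.of k (line k (Between a b l))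
  map {s t} _ := FGModuleCat.ofHom (lineMap k (Between a b s) (Between a b t))

/-- The representation `M(a, b)` that is supported on the vertices between `a` and `b`. -/
def intervalRep (a b : ℕ) : Q.Rep k := Paths.lift (Q.intervalPrefunctor k a b)

/-- The condition for the identity of `k` on the common support to be a
morphism `M(a, b) ⟶ M(c, d)`. -/
def Compatible (a b c d : ℕ) : Prop :=
  ∀ s t : Q.Vertex, Q.IsArrow s t → Between a b s → Between c d t →
    (Between a b t ↔ Between c d s)

theorem lineMap_comp {p q r : Prop} (x : line k p) (h : r → p → q) :
    lineMap k q r (lineMap k p q x) = lineMap k p r x := by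
  apply Subtype.ext
  by_cases hr : r
  · by_cases hp : p
    · rw [lineMap_of k hr, lineMap_of k hr, lineMap_of k (h hr hp)]
    · rw [line_eq_zero k hp x]; simp
  · rw [line_eq_zero k hr (lineMap k q r _), line_eq_zero k hr (lineMap k p r _)]

theorem lineMap_comp_eq_zero {p q r : Prop} (x : line k p) (h : p → q → r → False) :
    lineMap k q r (lineMap k p q x) = 0 := by
  by_cases hp : p
  · by_cases hq : q
    · exact line_eq_zero k (h hp hq) _
    · rw [line_eq_zero k hq (lineMap k p q x), map_zero]
  · rw [line_eq_zero k hp x, map_zero, map_zero]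

/-- The canonical morphism `M(a, b) ⟶ M(c, d)`, which is the identity of `k` at each vertex of the
common support, and `0` at the other vertices. If `[a, b]` is contained in `[c, d]` it is the
inclusion of a subrepresentation; if `[c, d]` is contained in `[a, b]` it is the
projection onto a quotient. -/
def canonicalMap {a b c d : ℕ} (h : Q.Compatible a b c d) :
    Q.intervalRep k a b ⟶ Q.intervalRep k c d :=
  pathNatTrans (Q.intervalPrefunctor k a b) (Q.intervalPrefunctor k c d)
    (fun l => FGModuleCat.ofHom (lineMap k (Between a b l) (Between c d l)))
    (fun s t α => by
      have hc := h s t α.down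
      apply FGModuleCat.hom_ext
      apply LinearMap.ext
      intro x
      change lineMap k (Between a b t) (Between c d t) (lineMap k (Between a b s) (Between a b t) x)
        = lineMap k (Between c d s) (Between c d t) (lineMap k (Between a b s) (Between c d s) x)
      by_cases h1 : Between a b s
      · by_cases h2 : Between c d t
        · by_cases h3 : Between a b t
          · rw [lineMap_comp k x (fun _ _ => h3), lineMap_comp k x (fun _ _ => (hc h1 h2).1 h3)]
          · rw [lineMap_comp_eq_zero k x (fun _ h _ => h3 h),
              lineMap_comp_eq_zero k x (fun _ h _ => h3 ((hc h1 h2).2 h))]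
        · rw [lineMap_comp_eq_zero k x (fun _ _ h => h2 h),
              lineMap_comp_eq_zero k x (fun _ _ h => h2 h)]
      · rw [lineMap_comp_eq_zero k x (fun h _ _ => h1 h),
              lineMap_comp_eq_zero k x (fun h _ _ => h1 h)])

theorem canonicalMap_comp_apply {a b c d e f : ℕ} (h : Q.Compatible a b c d)
    (h' : Q.Compatible c d e f) (l : Q.Vertex) (x : line k (Between a b l)) :
    ((Q.canonicalMap k h ≫ Q.canonicalMap k h').app l).hom.hom x =
      lineMap k (Between c d l) (Between e f l) (lineMap k (Between a b l) (Between c d l) x) :=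
  rfl

/-- Two morphisms that agree at each vertex are equal. -/
theorem rep_hom_ext {M N : Q.Rep k} {f g : M ⟶ N}
    (h : ∀ (l : Q.Vertex) (x : M.obj l), (f.app l).hom.hom x = (g.app l).hom.hom x) : f = g := by
  apply NatTrans.ext
  funext l
  apply FGModuleCat.hom_ext
  exact LinearMap.ext (h l)

end TypeA

namespace TypeA

variable {n : ℕ} (Q : TypeA n) (k : Type u) [Field k]

/-- A pivot adds a hook to `M(i+1, j)` or removes a cohook from it, so that the
canonical map is a morphism. -/
theorem IsPivot.compatible {Q : TypeA n} {γ δ : Q.Segment} (h : Q.IsPivot γ δ) :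
    Q.Compatible (γ.i + 1) γ.j (δ.i + 1) δ.j := by
  have hγ := γ.i_lt_j
  have hδ := δ.i_lt_j
  have key : ∀ l : Fin (n + 3), 0 < (l : ℕ) → (l : ℕ) < n + 2 → ∀ s t : Q.Vertex, Q.IsArrow s t →
      (Q.OnUpper l → ¬ (label s = l + 1 ∧ label t = l)) ∧
      (Q.OnLower l → ¬ (label s = l ∧ label t = l + 1)) := by
    intro l h0 h1 s t hst
    have hn0 : l ≠ 0 := fun e => by simp [e] at h0
    have hn1 : l ≠ Fin.last (n + 2) := fun e => by simp [e] at h1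
    refine ⟨fun hl hs => ?_, fun hl hs => ?_⟩
    · rcases hl with hl | hl | ⟨a, ha, hl⟩
      · exact hn0 hl
      · exact hn1 hl
      · rcases hst with ⟨b, hb, hb1, hb2⟩ | ⟨b, hb, hb1, hb2⟩
        · omega
        · have : a = b := Fin.ext (by omega)
          rw [this, hb] at ha; exact Bool.false_ne_true ha
    · rcases hl with hl | hl | ⟨a, ha, hl⟩
      · exact hn0 hl
      · exact hn1 hl
      · rcases hst with ⟨b, hb, hb1, hb2⟩ | ⟨b, hb, hb1, hb2⟩
        · have : a = b := Fin.ext (by omega)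
          rw [this, hb] at ha; exact Bool.false_ne_true ha.symm
        · omega
  have adj : ∀ s t : Q.Vertex, Q.IsArrow s t → label t = label s + 1 ∨ label s = label t + 1 := by
    rintro s t (⟨a, _, h1, h2⟩ | ⟨a, _, h1, h2⟩)
    · left; omega
    · right; omega
  intro s t hst h1 h2
  have ha := adj s t hst
  have b1 := γ.j.isLt
  have b2 := δ.j.isLt
  unfold Between at *
  rw [Fin.lt_def] at hγ hδ
  rcases h with ⟨hi, hj⟩ | ⟨hi, hj⟩
  · have hc := Q.clockwiseNext_R_symm γ.i
    rw [← hi] at hc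
    rw [hj] at h2 ⊢
    rw [hj] at hδ
    rcases hc with ⟨_, hu, hlt, _⟩ | ⟨hl, _, hlt, _⟩
    · rw [Fin.lt_def] at hlt
      have := (key γ.i (by omega) (by omega) s t hst).1 hu
      omega
    · rw [Fin.lt_def] at hlt
      have := (key δ.i (by omega) (by omega) s t hst).2 hl
      omega
  · have hc := Q.clockwiseNext_R_symm γ.j
    rw [← hj] at hc
    rw [hi] at h2 ⊢
    rw [hi] at hδ
    rcases hc with ⟨hu, _, hlt, _⟩ | ⟨_, hl, hlt, _⟩
    · rw [Fin.lt_def] at hlt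
      have := (key δ.j (by omega) (by omega) s t hst).1 hu
      omega
    · rw [Fin.lt_def] at hlt
      have := (key γ.j (by omega) (by omega) s t hst).2 hl
      omega

/-- Every endomorphism of `M(a, b)` is a scalar. -/
theorem intervalRep_end {a b : ℕ} (ha : 1 ≤ a) (hab : a ≤ b) (hb : b ≤ n + 2)
    (f : Q.intervalRep k a b ⟶ Q.intervalRep k a b) : ∃ c : k, f = c • 𝟙 _ := by
  let vtx : ∀ m : ℕ, m < n + 2 → Q.Vertex := fun m hm => (⟨m, hm⟩ : Fin (n + 2))
  let F : ∀ l : Q.Vertex, line k (Between a b l) →ₗ[k] line k (Between a b l) :=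
    fun l => (f.app l).hom.hom
  have mem : ∀ l : Q.Vertex, Between a b l → (1 : k) ∈ line k (Between a b l) := by
    intro l hl; simp [line, hl]
  have nat : ∀ (s t : Q.Vertex), Q.IsArrow s t → ∀ x, F t (lineMap k _ _ x) =
      lineMap k (Between a b s) (Between a b t) (F s x) := by
    intro s t hst x
    have h := f.naturality ((Paths.of Q.Vertex).map (PLift.up hst : s ⟶ t))
    have h1 : (Q.intervalRep k a b).map ((Paths.of Q.Vertex).map (PLift.up hst : s ⟶ t)) =
      FGModuleCat.ofHom (lineMap k (Between a b s) (Between a b t)) := Paths.lift_toPath _ _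
    rw [h1] at h
    exact congrArg (fun g => g.hom.hom x) h
  have scal : ∀ l (hl : Between a b l) (x : line k (Between a b l)),
      F l x = (F l ⟨1, mem l hl⟩ : k) • x := by
    intro l hl x
    have hx : x = (x : k) • (⟨1, mem l hl⟩ : line k (Between a b l)) := Subtype.ext (by simp)
    conv_lhs => rw [hx]
    rw [map_smul]
    exact Subtype.ext (by simp [mul_comm])
  have step : ∀ s t, Q.IsArrow s t → ∀ (hs : Between a b s) (ht : Between a b t),
      (F s ⟨1, mem s hs⟩ : k) = F t ⟨1, mem t ht⟩ := by
    intro s t hst hs ht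
    have h := congrArg Subtype.val (nat s t hst ⟨1, mem s hs⟩)
    rw [lineMap_of k ht] at h
    rw [← h]
    congr 2
    exact Subtype.ext (lineMap_of k ht _)
  have h0 : Between a b (vtx (a - 1) (by omega)) := by
    constructor <;> simp [vtx, label] <;> omega
  have same : ∀ l l' (_ : l = l') (hl : Between a b l) (hl' : Between a b l'),
      (F l ⟨1, mem l hl⟩ : k) = F l' ⟨1, mem l' hl'⟩ := by
    rintro l _ rfl _ _; rfl
  have all : ∀ m (hm : m < n + 2) (hl : Between a b (vtx m hm)),
      (F (vtx m hm) ⟨1, mem _ hl⟩ : k) = F _ ⟨1, mem _ h0⟩ := by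
    intro m
    induction m with
    | zero =>
      intro hm hl
      have : a - 1 = 0 := by
        have := hl.1; simp [vtx, label] at this; omega
      exact same _ _ (Fin.ext this.symm) hl h0
    | succ m ih =>
      intro hm hl
      by_cases e : a - 1 = m + 1
      · exact same _ _ (Fin.ext e.symm) hl h0
      · have hl1 := hl.1
        have hl2 := hl.2
        simp only [vtx, label] at hl1 hl2
        have hl' : Between a b (vtx m (by omega)) := by
          constructor <;> simp only [vtx, label] <;> omega
        rw [← ih (by omega) hl']
        rcases hr : Q.right ⟨m, by omega⟩ with _ | _
        · exact step _ _ (Or.inr ⟨_, hr, rfl, rfl⟩) hl hl'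
        · exact (step _ _ (Or.inl ⟨_, hr, rfl, rfl⟩) hl' hl).symm
  refine ⟨(F _ ⟨1, mem _ h0⟩ : k), Q.rep_hom_ext k fun l x => ?_⟩
  change F l x = (F _ ⟨1, mem _ h0⟩ : k) • x
  by_cases hl : Between a b l
  · exact (scal l hl x).trans (congrArg (fun t : k => t • x) (all (Fin.val l) (Fin.isLt l) hl))
  · exact (line_eq_zero k hl _).trans (line_eq_zero k hl _).symm

/-- The representations `M(a, b)` are indecomposable. -/
theorem intervalRep_indecomposable {a b : ℕ} (ha : 1 ≤ a) (hab : a ≤ b) (hb : b ≤ n + 2) :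
    Indecomposable (Q.intervalRep k a b) := by
  have hne : ¬ IsZero (Q.intervalRep k a b) := by
    intro hz
    let l : Q.Vertex := (⟨a - 1, by omega⟩ : Fin (n + 2))
    have hl : Between a b l := by constructor <;> simp [l, label] <;> omega
    have h := hz.eq_of_src (𝟙 (Q.intervalRep k a b)) 0
    have h1 : (⟨1, by simp [line, hl]⟩ : line k (Between a b l)) = 0 :=
      congrArg (fun g => (NatTrans.app g l).hom.hom (⟨1, by simp [line, hl]⟩ :
        line k (Between a b l))) h
    exact one_ne_zero (congrArg Subtype.val h1)
  refine ⟨hne, fun Y Z e => ?_⟩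
  obtain ⟨c, hc⟩ := Q.intervalRep_end k ha hab hb (e.hom ≫ biprod.fst ≫ biprod.inl ≫ e.inv)
  have hp : (biprod.fst ≫ biprod.inl : Y ⊞ Z ⟶ Y ⊞ Z) = c • 𝟙 _ := by
    have := congrArg (fun g => e.inv ≫ g ≫ e.hom) hc
    simpa using this
  have h1 : (1 - c) • 𝟙 Y = 0 := by
    have := congrArg (fun g => biprod.inl ≫ g ≫ biprod.fst) hp
    simp at this
    rw [sub_smul, one_smul, sub_eq_zero]
    exact this
  have h2 : c • 𝟙 Z = 0 := by
    have := congrArg (fun g => biprod.inr ≫ g ≫ biprod.snd) hp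
    simpa using this.symm
  by_cases h : c = 0
  · left
    rw [h, sub_zero, one_smul] at h1
    exact (IsZero.iff_id_eq_zero Y).2 h1
  · right
    exact (IsZero.iff_id_eq_zero Z).2 ((smul_eq_zero.1 h2).resolve_left h)

/-- The representation `M(i+1, j)` that corresponds to the line segment `γ(i, j)`. -/
def segmentRep (γ : Q.Segment) : Q.Rep k := Q.intervalRep k (γ.i + 1) γ.j

theorem segmentRep_indecomposable (γ : Q.Segment) : Indecomposable (Q.segmentRep k γ) :=
  Q.intervalRep_indecomposable k (Nat.le_add_left _ _) γ.i_lt_j (Nat.lt_succ_iff.1 γ.j.isLt)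

/-- The morphism `M(i+1, j) ⟶ M(i'+1, j')` that corresponds to a pivot `γ(i, j) → γ(i', j')`,
up to a scalar: the inclusion if the pivot adds a hook, and the projection if it removes a cohook. -/
def pivotMap {γ δ : Q.Segment} (p : γ ⟶ δ) : Q.segmentRep k γ ⟶ Q.segmentRep k δ :=
  Q.canonicalMap k p.down.compatible

/-- The choice of a nonzero scalar for each pivot such that the mesh relations hold for the
scalar multiples of the inclusions and the projections. These commute in each mesh with two middle
terms, whereas the mesh relation is that the sum of the two compositions is zero. -/
structure PivotScalars where
  coeff : ∀ {γ δ : Q.Segment}, (γ ⟶ δ) → kˣ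
  mesh : ∀ {γ δ δ' ε : Q.Segment} (p : γ ⟶ δ) (q : δ ⟶ ε) (p' : γ ⟶ δ') (q' : δ' ⟶ ε),
    Q.rotation ε = some γ → δ ≠ δ' →
    (coeff p : k) * coeff q + (coeff p' : k) * coeff q' = 0

/-- The category of line segments of the polygon: the mesh category of
the translation quiver of line segments and pivots, with the rotation as translation. -/
abbrev SegmentCategory := TransQuiver.MeshCategory k Q.rotation

/-- The line segment `γ` as an object of the category of line segments. -/
abbrev seg (γ : Q.Segment) : Q.SegmentCategory k := TransQuiver.meshObj k Q.rotation γ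

/-- A pivot as a morphism of the category of line segments. -/
abbrev pivot {γ δ : Q.Segment} (p : γ ⟶ δ) : Q.seg k γ ⟶ Q.seg k δ :=
  TransQuiver.meshArrow k Q.rotation p

variable {Q k}

/-- The values of `F` at the line segments and the pivots. -/
def segmentPrefunctor (c : Q.PivotScalars k) : Q.Segment ⥤q Q.Ind k where
  obj γ := ⟨Q.segmentRep k γ, Q.segmentRep_indecomposable k γ⟩
  map p := ObjectProperty.homMk ((c.coeff p : k) • Q.pivotMap k p)

instance segmentHom_subsingleton (γ δ : Q.Segment) : Subsingleton (γ ⟶ δ) :=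
  inferInstanceAs (Subsingleton (PLift (Q.IsPivot γ δ)))

theorem segmentPrefunctor_comp (c : Q.PivotScalars k) {x y z : Q.Segment} (β : z ⟶ y) (α : y ⟶ x) :
    (segmentPrefunctor c).map β ≫ (segmentPrefunctor c).map α =
      ObjectProperty.homMk (((c.coeff β : k) * c.coeff α) • (Q.pivotMap k β ≫ Q.pivotMap k α)) := by
  apply ObjectProperty.hom_ext
  change ((c.coeff β : k) • Q.pivotMap k β) ≫ ((c.coeff α : k) • Q.pivotMap k α) = _
  rw [Linear.smul_comp, Linear.comp_smul, smul_smul]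
  rfl

theorem segmentPrefunctor_mesh (c : Q.PivotScalars k) (x z : Q.Segment)
    (h : Q.rotation x = some z) : ∑ y : Q.Segment, ∑ β : z ⟶ y, ∑ α : y ⟶ x,
      (segmentPrefunctor c).map β ≫ (segmentPrefunctor c).map α = 0 := by
  obtain ⟨hzi, hzj⟩ := Q.rotation_eq_some h
  have mid : ∀ y : Q.Segment, ∀ (_ : z ⟶ y) (_ : y ⟶ x),
      (y.i = x.i ∧ y.j = z.j) ∨ (y.i = z.i ∧ y.j = x.j) := by
    rintro y ⟨β⟩ ⟨α⟩
    rcases β with ⟨h1, h2⟩ | ⟨h1, h2⟩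
    · left; rw [h1, hzi, Equiv.symm_apply_apply]; exact ⟨rfl, h2⟩
    · right; rw [h2, hzj, Equiv.symm_apply_apply]; exact ⟨h1, rfl⟩
  by_cases hex : x.i < z.j ∧ z.i < x.j
  · let y₁ : Q.Segment := ⟨(x.i, z.j), hex.1⟩
    let y₂ : Q.Segment := ⟨(z.i, x.j), hex.2⟩
    have hi1 : y₁.i = x.i := rfl
    have hj1 : y₁.j = z.j := rfl
    have hi2 : y₂.i = z.i := rfl
    have hj2 : y₂.j = x.j := rfl
    have hne : y₁ ≠ y₂ := fun e => Q.R_ne x.i (by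
      rw [← hzi, ← hi2, ← e, hi1])
    let β₁ : z ⟶ y₁ := PLift.up (Or.inl ⟨by rw [hi1, hzi, Equiv.symm_apply_apply], hj1⟩)
    let α₁ : y₁ ⟶ x := PLift.up (Or.inr ⟨hi1.symm, by rw [hj1, hzj, Equiv.symm_apply_apply]⟩)
    let β₂ : z ⟶ y₂ := PLift.up (Or.inr ⟨hi2, by rw [hj2, hzj, Equiv.symm_apply_apply]⟩)
    let α₂ : y₂ ⟶ x := PLift.up (Or.inl ⟨by rw [hi2, hzi, Equiv.symm_apply_apply], hj2.symm⟩)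
    rw [Fintype.sum_eq_add y₁ y₂ hne]
    · rw [Fintype.sum_subsingleton _ β₁, Fintype.sum_subsingleton _ α₁,
        Fintype.sum_subsingleton _ β₂, Fintype.sum_subsingleton _ α₂,
        segmentPrefunctor_comp, segmentPrefunctor_comp]
      have hcomp : Q.pivotMap k β₁ ≫ Q.pivotMap k α₁ = Q.pivotMap k β₂ ≫ Q.pivotMap k α₂ := by
        refine Q.rep_hom_ext k fun l v => ?_
        refine (Q.canonicalMap_comp_apply k _ _ l v).trans
          (Eq.trans ?_ (Q.canonicalMap_comp_apply k _ _ l v).symm)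
        refine (lineMap_comp k _ ?_).trans (lineMap_comp k _ ?_).symm
        · rintro ⟨h1, h2⟩ ⟨h3, h4⟩
          exact ⟨by rw [hi1]; exact h1, by rw [hj1]; exact h4⟩
        · rintro ⟨h1, h2⟩ ⟨h3, h4⟩
          exact ⟨by rw [hi2]; exact h3, by rw [hj2]; exact h2⟩
      apply ObjectProperty.hom_ext
      change ((c.coeff β₁ : k) * c.coeff α₁) • (Q.pivotMap k β₁ ≫ Q.pivotMap k α₁) +
        ((c.coeff β₂ : k) * c.coeff α₂) • (Q.pivotMap k β₂ ≫ Q.pivotMap k α₂) = 0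
      rw [hcomp, ← add_smul, c.mesh β₁ α₁ β₂ α₂ h hne, zero_smul]
    · rintro y ⟨hy1, hy2⟩
      refine Finset.sum_eq_zero fun β _ => Finset.sum_eq_zero fun α _ => ?_
      rcases mid y β α with ⟨h1, h2⟩ | ⟨h1, h2⟩
      · exact (hy1 (Segment.ext h1 h2)).elim
      · exact (hy2 (Segment.ext h1 h2)).elim
  · refine Finset.sum_eq_zero fun y _ => Finset.sum_eq_zero fun β _ =>
      Finset.sum_eq_zero fun α _ => ?_
    have hcomp : Q.pivotMap k β ≫ Q.pivotMap k α = 0 := by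
      refine Q.rep_hom_ext k fun l v => ?_
      refine (Q.canonicalMap_comp_apply k _ _ l v).trans (lineMap_comp_eq_zero k _ ?_)
      rintro ⟨h1, h2⟩ - ⟨h3, h4⟩
      refine hex ⟨?_, ?_⟩ <;> rw [Fin.lt_def] <;> omega
    rw [segmentPrefunctor_comp, hcomp, smul_zero]
    rfl

/-- The functor `F` from the category of line segments to `ind Q` that sends `γ(i, j)` to
`M(i+1, j)` and each pivot to the corresponding morphism (with the scalars `c`). -/
def segmentFunctor (c : Q.PivotScalars k) : Q.SegmentCategory k ⥤ Q.Ind k :=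
  TransQuiver.meshLift k Q.rotation (segmentPrefunctor c) (segmentPrefunctor_mesh c)

instance (c : Q.PivotScalars k) : (segmentFunctor c).Additive := by
  unfold segmentFunctor; infer_instance

instance (c : Q.PivotScalars k) : (segmentFunctor c).Linear k := by
  unfold segmentFunctor; infer_instance

theorem segmentFunctor_obj (c : Q.PivotScalars k) (γ : Q.Segment) :
    ((segmentFunctor c).obj (Q.seg k γ)).obj = Q.segmentRep k γ := rfl

theorem segmentFunctor_map (c : Q.PivotScalars k) {γ δ : Q.Segment} (p : γ ⟶ δ) :
    ((segmentFunctor c).map (Q.pivot k p)).hom = (c.coeff p : k) • Q.pivotMap k p :=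
  congrArg InducedCategory.Hom.hom
    (TransQuiver.meshLift_meshArrow k Q.rotation (segmentPrefunctor c) _ p)

end TypeA

/-! ## Auslander–Reiten theory -/

namespace AuslanderReiten

section

variable {C : Type w} [Category.{v} C]

/-- Irreducible morphisms: neither sections nor retractions, and in each factorization
the first factor is a section or the second factor is a retraction. -/
structure IsIrreducible {X Y : C} (f : X ⟶ Y) : Prop where
  not_section : ¬ IsSplitMono f
  not_retraction : ¬ IsSplitEpi f
  factor : ∀ (Z : C) (g : X ⟶ Z) (h : Z ⟶ Y), g ≫ h = f → IsSplitMono g ∨ IsSplitEpi h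

variable [Preadditive C] (k : Type u) [Field k] [Linear k C]

/-- The radical `rad(X, Y)`. (The set on the right is a subspace, equal to its span.) -/
def radical (X Y : C) : Submodule k (X ⟶ Y) :=
  Submodule.span k {f | ∀ g : Y ⟶ X, IsIso (𝟙 X - f ≫ g)}

/-- The square of the radical. -/
def radicalSq (X Y : C) : Submodule k (X ⟶ Y) :=
  Submodule.span k {h | ∃ (Z : C) (f : X ⟶ Z) (g : Z ⟶ Y),
    f ∈ radical k X Z ∧ g ∈ radical k Z Y ∧ h = f ≫ g}

/-- The space `Irr(X, Y) = rad(X, Y) / rad²(X, Y)` of irreducible morphisms. -/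
abbrev Irr (X Y : C) := radical k X Y ⧸ (radicalSq k X Y).submoduleOf (radical k X Y)

end

section

variable {C : Type w} [Category.{v} C] [Abelian C]

/-- Almost split sequences (Auslander–Reiten sequences): short exact sequences with
indecomposable end terms whose first map is left almost split and whose second map is right
almost split. -/
structure IsAlmostSplit (S : ShortComplex C) : Prop where
  shortExact : S.ShortExact
  indecomposable_left : Indecomposable S.X₁
  indecomposable_right : Indecomposable S.X₃
  not_section : ¬ IsSplitMono S.f
  left : ∀ (U : C) (h : S.X₁ ⟶ U), ¬ IsSplitMono h → ∃ h' : S.X₂ ⟶ U, S.f ≫ h' = h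
  not_retraction : ¬ IsSplitEpi S.g
  right : ∀ (U : C) (h : U ⟶ S.X₃), ¬ IsSplitEpi h → ∃ h' : U ⟶ S.X₂, h' ≫ S.g = h

/-- `N` is isomorphic to the Auslander–Reiten translate `τ M`: there is an almost split sequence
`0 ⟶ N ⟶ E ⟶ M ⟶ 0`. -/
def IsTranslate (M N : C) : Prop :=
  ∃ S : ShortComplex C, IsAlmostSplit S ∧ Nonempty (S.X₃ ≅ M) ∧ Nonempty (S.X₁ ≅ N)

end

end AuslanderReiten

namespace TypeA

open AuslanderReiten

variable {n : ℕ} (Q : TypeA n) (k : Type u) [Field k]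

/-- The isomorphism classes of indecomposable representations. -/
def IndClass := _root_.Quotient (isIsomorphicSetoid (Q.Ind k))

variable {Q k} in
/-- The isomorphism class of an indecomposable representation. -/
def indClass (M : Q.Ind k) : Q.IndClass k := _root_.Quotient.mk (isIsomorphicSetoid (Q.Ind k)) M

variable {Q k} in
/-- A representation in the given isomorphism class. -/
def IndClass.rep (x : Q.IndClass k) : Q.Rep k := (_root_.Quotient.out x).obj

/-- The Auslander–Reiten quiver of `rep Q`: the vertices are the isomorphism classes of
indecomposable representations, and the number of arrows from `[M]` to `[N]` is
the dimension of `Irr(M, N)`. -/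
instance arQuiver : Quiver.{0} (Q.IndClass k) where
  Hom x y := Fin (Module.finrank k (Irr k x.rep y.rep))

open Classical in
/-- The Auslander–Reiten translation on isomorphism classes, which is defined at the
nonprojective indecomposable representations. -/
def arTranslation (x : Q.IndClass k) : Option (Q.IndClass k) :=
  if h : ¬ Projective x.rep ∧ ∃ y : Q.IndClass k, IsTranslate x.rep y.rep then some h.2.choose
  else none

instance : HasFiniteBiproducts (Q.Rep k) := Abelian.hasFiniteBiproducts

variable {Q k}

/-- The extension of `F` to the additive closure of the category of line segments, with
values in `rep Q`. -/
def segmentFunctorAdd (c : Q.PivotScalars k) : Mat_ (Q.SegmentCategory k) ⥤ Q.Rep k :=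
  additiveExtension (segmentFunctor c ⋙ ObjectProperty.ι _)

end TypeA

end

/-! The Hom-spaces of both categories can be computed, and they agree: each is at most
one-dimensional, and both are nonzero for the same pairs of line segments.

Cut the boundary circle just after `n+2`, respectively just after `0`, and read it counterclockwise.
This gives two linear orders, recorded by `posL` and `posR`. A left end point is never `n+2` and a
right end point is never `0`, so a pivot replaces one coordinate of `(posL i, posR j)` by its
successor: the line segments form a piece of a grid. Along `posL` the labels fall to `0` and then
rise; along `posR` they rise to `n+2` and then fall. Hence, if `HomLE γ δ` holds, every grid point
of the rectangle between `γ` and `δ` is a line segment (`HomLE.rectangle`).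

For representations, a morphism between interval modules acts by a single scalar on the common
support, because that support is connected. So the canonical map spans the Hom-space, and naturality
on the edges at the ends of the intervals shows that there is a nonzero morphism exactly when `HomLE
γ δ` holds (`eq_smul_segMap`, `segMap_ne_zero`, `homLE_of_ne_zero`). In the mesh category, mesh
relations inside the rectangle make all paths from `γ` to `δ` proportional, and mesh relations at
its border kill the paths to those `δ` for which `HomLE γ δ` fails (`meshPath_unique`). As `F` sends
a path to a nonzero multiple of a canonical map, it is fully faithful.

Essential surjectivity is Gabriel's theorem in type A. `exists_retract` splits an interval module
off any nonzero representation, by a maximality argument along the line combined with linear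
duality. Consequently the identity of any representation is a sum of morphisms through interval
modules (`exists_sum_id`), which reduces questions about arbitrary objects to the Hom-spaces above.

Auslander–Reiten theory follows. A pivot is a minimal step for `HomLE`, so the square of the radical
vanishes on it, while any radical morphism between interval modules not joined by a pivot factors
properly. Each mesh gives a short exact sequence of canonical maps, and this sequence is almost
split. If the rotation of `γ` is undefined, some vertex in the support of its module is missed by
all immediate predecessors, which makes the module projective. Finally, the additive extension of
`F` is again an equivalence, so it transports the abelian structure and is exact. -/

noncomputable section

namespace TypeA

/-! ### Combinatorics of the polygon: two linear orders, rectangles and meshes -/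

section Combinatorics

variable {n : ℕ} (Q : TypeA n)

open Classical in
/-- The position of a boundary point in counterclockwise order, starting after `n+2`: first the
upper points from right to left, then `0`, then the lower points from left to right, then `n+2`. -/
def posL (l : Fin (n + 3)) : ℕ := if Q.IsUpper l then n + 2 - l else n + 2 + l

open Classical in
/-- The position of a boundary point in counterclockwise order, starting after `0`: first the
lower points from left to right, then `n+2`, then the upper points from right to left, then `0`. -/
def posR (l : Fin (n + 3)) : ℕ := if Q.IsUpper l ∨ l = 0 then 2 * (n + 2) - l else l

theorem IsUpper.bounds {Q : TypeA n} {l : Fin (n + 3)} (h : Q.IsUpper l) :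
    0 < (l : ℕ) ∧ (l : ℕ) < n + 2 := by
  obtain ⟨a, -, h⟩ := h
  have := a.isLt
  omega

theorem posL_cases (l : Fin (n + 3)) :
    (Q.IsUpper l ∧ Q.posL l = n + 2 - l ∧ 0 < (l : ℕ) ∧ (l : ℕ) < n + 2) ∨
      (¬ Q.IsUpper l ∧ Q.posL l = n + 2 + l) := by
  unfold posL
  split_ifs with h
  · exact Or.inl ⟨h, rfl, h.bounds⟩
  · exact Or.inr ⟨h, rfl⟩

theorem posR_cases (l : Fin (n + 3)) :
    ((Q.IsUpper l ∨ (l : ℕ) = 0) ∧ Q.posR l = 2 * (n + 2) - l ∧ (l : ℕ) < n + 2) ∨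
      (¬ Q.IsUpper l ∧ (l : ℕ) ≠ 0 ∧ Q.posR l = l) := by
  unfold posR
  split_ifs with h
  · refine Or.inl ⟨h.imp_right fun h => by simp [h], rfl, ?_⟩
    rcases h with h | rfl
    · exact h.bounds.2
    · simp
  · push Not at h
    exact Or.inr ⟨h.1, fun e => h.2 (Fin.ext e), rfl⟩

theorem posL_injective : Function.Injective Q.posL := fun x y h => by
  have := x.isLt
  have := y.isLt
  rcases Q.posL_cases x with h1 | h1 <;> rcases Q.posL_cases y with h2 | h2 <;>
    exact Fin.ext (by omega)

theorem posR_injective : Function.Injective Q.posR := fun x y h => by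
  have := x.isLt
  have := y.isLt
  rcases Q.posR_cases x with h1 | h1 <;> rcases Q.posR_cases y with h2 | h2 <;>
    exact Fin.ext (by omega)

/-- Along `posL` the labels first decrease and then increase, so on any interval of this order the
largest label occurs at an end. -/
theorem le_or_le_of_posL {a x b : Fin (n + 3)} (h : Q.posL a ≤ Q.posL x)
    (h' : Q.posL x ≤ Q.posL b) : (x : ℕ) ≤ a ∨ (x : ℕ) ≤ b := by
  rcases Q.posL_cases x with h1 | h1 <;> rcases Q.posL_cases a with h2 | h2 <;>
    rcases Q.posL_cases b with h3 | h3 <;> omega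

/-- Along `posR` the labels first increase and then decrease, so the smallest label on an interval
occurs at an end. -/
theorem le_or_le_of_posR {a x b : Fin (n + 3)} (h : Q.posR a ≤ Q.posR x)
    (h' : Q.posR x ≤ Q.posR b) : (a : ℕ) ≤ x ∨ (b : ℕ) ≤ x := by
  have := x.isLt
  have := a.isLt
  have := b.isLt
  rcases Q.posR_cases x with h1 | h1 <;> rcases Q.posR_cases a with h2 | h2 <;>
    rcases Q.posR_cases b with h3 | h3 <;> omega

theorem OnUpper.nat_cases {Q : TypeA n} {l : Fin (n + 3)} (h : Q.OnUpper l) :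
    Q.IsUpper l ∨ ((l : ℕ) = 0 ∨ (l : ℕ) = n + 2) ∧ ¬ Q.IsUpper l := by
  rcases h with rfl | rfl | h
  · exact Or.inr ⟨Or.inl rfl, Q.not_isUpper_zero⟩
  · exact Or.inr ⟨Or.inr rfl, Q.not_isUpper_last⟩
  · exact Or.inl h

theorem OnLower.not_isUpper {Q : TypeA n} {l : Fin (n + 3)} (h : Q.OnLower l) :
    ¬ Q.IsUpper l := by
  rcases h with rfl | rfl | h
  · exact Q.not_isUpper_zero
  · exact Q.not_isUpper_last
  · exact fun h' => Q.not_isUpper_and_isLower h' h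

theorem onLower_of_not_isUpper {l : Fin (n + 3)} (h : ¬ Q.IsUpper l) : Q.OnLower l := by
  rcases Q.onUpper_or_onLower l with h1 | h1
  · rcases h1 with h1 | h1 | h1
    · exact Or.inl h1
    · exact Or.inr (Or.inl h1)
    · exact (h h1).elim
  · exact h1

theorem onUpper_of_eq_zero {l : Fin (n + 3)} (h : (l : ℕ) = 0) : Q.OnUpper l :=
  Or.inl (Fin.ext h)

/-- In the order given by `posL`, the counterclockwise neighbour is the successor. -/
theorem posL_of_clockwiseNext {m l : Fin (n + 3)} (h : Q.ClockwiseNext m l)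
    (hl : (l : ℕ) ≠ n + 2) :
    Q.posL l < Q.posL m ∧ ∀ x, Q.posL l < Q.posL x → Q.posL m ≤ Q.posL x := by
  have hl' := l.isLt
  rcases h with ⟨h1, h2, h3, h4⟩ | ⟨h1, h2, h3, h4⟩
  · rw [Fin.lt_def] at h3
    have a1 := h1.nat_cases
    have a2 := h2.nat_cases
    refine ⟨?_, fun x hx => ?_⟩
    · rcases Q.posL_cases l with b | b <;> rcases Q.posL_cases m with c | c <;> grind
    · by_contra hlt
      have hx' : Q.IsUpper x := by
        by_contra hxu
        rcases Q.posL_cases l with b | b <;> rcases Q.posL_cases m with c | c <;>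
          rcases Q.posL_cases x with d | d <;> grind
      refine h4 x (Or.inr (Or.inr hx')) ?_
      simp only [Fin.lt_def]
      rcases Q.posL_cases l with b | b <;> rcases Q.posL_cases m with c | c <;>
          rcases Q.posL_cases x with d | d <;> grind
  · rw [Fin.lt_def] at h3
    have a1 := h1.not_isUpper
    have a2 := h2.not_isUpper
    have b := (Q.posL_cases l).resolve_left fun h => a2 h.1
    have c := (Q.posL_cases m).resolve_left fun h => a1 h.1
    refine ⟨by omega, fun x hx => ?_⟩
    by_contra hlt
    have d := (Q.posL_cases x).resolve_left fun h => by omega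
    refine h4 x (Q.onLower_of_not_isUpper d.1) ?_
    simp only [Fin.lt_def]
    omega

/-- In the order given by `posR`, the counterclockwise neighbour is the successor. -/
theorem posR_of_clockwiseNext {m l : Fin (n + 3)} (h : Q.ClockwiseNext m l)
    (hl : (l : ℕ) ≠ 0) :
    Q.posR l < Q.posR m ∧ ∀ x, Q.posR l < Q.posR x → Q.posR m ≤ Q.posR x := by
  have hl' := l.isLt
  have hm' := m.isLt
  rcases h with ⟨h1, h2, h3, h4⟩ | ⟨h1, h2, h3, h4⟩
  · rw [Fin.lt_def] at h3
    have a1 := h1.nat_cases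
    have a2 := h2.nat_cases
    have c : Q.posR m = 2 * (n + 2) - m := by
      rcases Q.posR_cases m with c | c <;> grind
    have b : Q.posR l = 2 * (n + 2) - l := by
      rcases Q.posR_cases l with c | c <;> grind
    refine ⟨by omega, fun x hx => ?_⟩
    by_contra hlt
    have hxl := x.isLt
    have d := (Q.posR_cases x).resolve_right fun h => by omega
    refine h4 x (d.1.elim (fun h => Or.inr (Or.inr h)) Q.onUpper_of_eq_zero) ?_
    simp only [Fin.lt_def]
    omega
  · rw [Fin.lt_def] at h3
    have a1 := h1.not_isUpper
    have a2 := h2.not_isUpper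
    have b := (Q.posR_cases l).resolve_left fun h => by grind
    have c := (Q.posR_cases m).resolve_left fun h => by grind
    refine ⟨by omega, fun x hx => ?_⟩
    by_contra hlt
    have hxl := x.isLt
    have d := (Q.posR_cases x).resolve_left fun h => by omega
    refine h4 x (Q.onLower_of_not_isUpper d.1) ?_
    simp only [Fin.lt_def]
    omega

/-- The condition for the existence of a nonzero morphism `M_γ ⟶ M_δ`. -/
structure HomLE (γ δ : Q.Segment) : Prop where
  left : Q.posL γ.i ≤ Q.posL δ.i
  right : Q.posR γ.j ≤ Q.posR δ.j
  lt : γ.i < δ.j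
  lt' : δ.i < γ.j

variable {Q}

theorem HomLE.refl (γ : Q.Segment) : Q.HomLE γ γ := ⟨le_rfl, le_rfl, γ.i_lt_j, γ.i_lt_j⟩

theorem HomLE.antisymm {γ δ : Q.Segment} (h : Q.HomLE γ δ) (h' : Q.HomLE δ γ) : γ = δ :=
  Segment.ext (Q.posL_injective (le_antisymm h.left h'.left))
    (Q.posR_injective (le_antisymm h.right h'.right))

/-- All segments in the rectangle between `γ` and `δ` exist. -/
theorem HomLE.rectangle {γ δ : Q.Segment} (h : Q.HomLE γ δ) {x y : Fin (n + 3)}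
    (h1 : Q.posL γ.i ≤ Q.posL x) (h2 : Q.posL x ≤ Q.posL δ.i)
    (h3 : Q.posR γ.j ≤ Q.posR y) (h4 : Q.posR y ≤ Q.posR δ.j) :
    ∃ ε : Q.Segment, ε.i = x ∧ ε.j = y ∧ Q.HomLE γ ε ∧ Q.HomLE ε δ := by
  have a := Q.le_or_le_of_posL h1 h2
  have b := Q.le_or_le_of_posR h3 h4
  have c1 := h.lt
  have c2 := h.lt'
  have c3 := γ.i_lt_j
  have c4 := δ.i_lt_j
  rw [Fin.lt_def] at c1 c2 c3 c4
  -- The two orders give `x ≤ max γ.i δ.i` and `min γ.j δ.j ≤ y`, and `HomLE` says that the maximum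
  -- is smaller than the minimum.
  have hxy : x < y := by rw [Fin.lt_def]; omega
  refine ⟨⟨(x, y), hxy⟩, rfl, rfl, ⟨h1, h3, ?_, ?_⟩, ⟨h2, h4, ?_, ?_⟩⟩
  · change γ.i < y; rw [Fin.lt_def]; omega
  · change x < γ.j; rw [Fin.lt_def]; omega
  · change x < δ.j; rw [Fin.lt_def]; omega
  · change δ.i < y; rw [Fin.lt_def]; omega

theorem Segment.i_ne_last (γ : Q.Segment) : (γ.i : ℕ) ≠ n + 2 := by
  have := γ.i_lt_j
  have := γ.j.isLt
  rw [Fin.lt_def] at *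
  omega

theorem Segment.j_ne_zero (γ : Q.Segment) : (γ.j : ℕ) ≠ 0 := by
  have := γ.i_lt_j
  rw [Fin.lt_def] at *
  omega

/-- A left end point is never `n+2`, the last point of the order `posL`, so its counterclockwise
neighbour is its successor. -/
theorem posL_R_symm_i (γ : Q.Segment) : Q.posL γ.i < Q.posL (Q.R.symm γ.i) ∧
    ∀ x, Q.posL γ.i < Q.posL x → Q.posL (Q.R.symm γ.i) ≤ Q.posL x :=
  Q.posL_of_clockwiseNext (Q.clockwiseNext_R_symm _) γ.i_ne_last

theorem posR_R_symm_j (γ : Q.Segment) : Q.posR γ.j < Q.posR (Q.R.symm γ.j) ∧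
    ∀ x, Q.posR γ.j < Q.posR x → Q.posR (Q.R.symm γ.j) ≤ Q.posR x :=
  Q.posR_of_clockwiseNext (Q.clockwiseNext_R_symm _) γ.j_ne_zero

/-- If some point precedes `y` in the order `posL`, then `R y` is the direct predecessor of `y`. -/
theorem posL_R {x y : Fin (n + 3)} (h : Q.posL x < Q.posL y) :
    Q.posL x ≤ Q.posL (Q.R y) ∧ Q.posL (Q.R y) < Q.posL y := by
  have hc := Q.clockwiseNext_R y
  -- If `R y` were `n+2`, then `y` would be the first point of the order, but `x` precedes it.
  have hne : (Q.R y : ℕ) ≠ n + 2 := by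
    intro e
    have e' : Q.R y = Fin.last (n + 2) := Fin.ext e
    rw [e'] at hc
    have hxl := x.isLt
    have hyl := y.isLt
    rcases hc with ⟨h1, h2, h3, h4⟩ | ⟨h1, h2, h3, h4⟩
    · rcases Q.posL_cases x with a | a <;> rcases Q.posL_cases y with b | b
      · refine h4 x (Or.inr (Or.inr a.1)) ?_
        simp only [Fin.lt_def, Fin.val_last]; omega
      · have := h1.nat_cases
        rw [Fin.lt_def] at h3
        simp only [Fin.val_last] at h3
        have hy0 : (y : ℕ) = 0 := by grind
        refine h4 x (Or.inr (Or.inr a.1)) ?_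
        simp only [Fin.lt_def, Fin.val_last]; omega
      · omega
      · have := h1.nat_cases
        rw [Fin.lt_def] at h3
        simp only [Fin.val_last] at h3
        have hy0 : (y : ℕ) = 0 := by grind
        omega
    · exact absurd h3 (not_lt.2 (Fin.le_last y))
  obtain ⟨h1, h2⟩ := Q.posL_of_clockwiseNext hc hne
  refine ⟨?_, h1⟩
  by_contra hlt
  exact absurd (h2 x (by omega)) (by omega)

theorem posR_R {x y : Fin (n + 3)} (h : Q.posR x < Q.posR y) :
    Q.posR x ≤ Q.posR (Q.R y) ∧ Q.posR (Q.R y) < Q.posR y := by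
  have hc := Q.clockwiseNext_R y
  have hne : (Q.R y : ℕ) ≠ 0 := by
    intro e
    have e' : Q.R y = 0 := Fin.ext e
    rw [e'] at hc
    have hxl := x.isLt
    have hyl := y.isLt
    rcases hc with ⟨h1, h2, h3, h4⟩ | ⟨h1, h2, h3, h4⟩
    · exact absurd h3 (Fin.not_lt_zero y)
    · have a1 := h1.not_isUpper
      rw [Fin.lt_def] at h3
      simp only [Fin.val_zero] at h3
      have b := (Q.posR_cases y).resolve_left fun h => by grind
      have a := (Q.posR_cases x).resolve_left fun h => by omega
      refine h4 x (Q.onLower_of_not_isUpper a.1) ?_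
      simp only [Fin.lt_def, Fin.val_zero]; omega
  obtain ⟨h1, h2⟩ := Q.posR_of_clockwiseNext hc hne
  refine ⟨?_, h1⟩
  by_contra hlt
  exact absurd (h2 x (by omega)) (by omega)

theorem pivot_i {γ δ : Q.Segment} (h1 : δ.i = Q.R.symm γ.i) (h2 : δ.j = γ.j) :
    Nonempty (γ ⟶ δ) := ⟨PLift.up (Or.inl ⟨h1, h2⟩)⟩

theorem pivot_j {γ δ : Q.Segment} (h1 : δ.i = γ.i) (h2 : δ.j = Q.R.symm γ.j) :
    Nonempty (γ ⟶ δ) := ⟨PLift.up (Or.inr ⟨h1, h2⟩)⟩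

theorem pivot_posL {γ δ : Q.Segment} (p : γ ⟶ δ) : Q.posL γ.i ≤ Q.posL δ.i := by
  rcases p.down with ⟨h, _⟩ | ⟨h, _⟩
  · rw [h]; exact (posL_R_symm_i γ).1.le
  · rw [h]

theorem pivot_posR {γ δ : Q.Segment} (p : γ ⟶ δ) : Q.posR γ.j ≤ Q.posR δ.j := by
  rcases p.down with ⟨_, h⟩ | ⟨_, h⟩
  · rw [h]
  · rw [h]; exact (posR_R_symm_j γ).1.le

/-- The sum of the two positions is the measure for the inductions over pivots and paths; it also
excludes oriented cycles. -/
theorem pivot_rank {γ δ : Q.Segment} (p : γ ⟶ δ) :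
    Q.posL γ.i + Q.posR γ.j < Q.posL δ.i + Q.posR δ.j := by
  rcases p.down with ⟨h, h'⟩ | ⟨h, h'⟩
  · rw [h, h']; have := (posL_R_symm_i γ).1; omega
  · rw [h, h']; have := (posR_R_symm_j γ).1; omega

theorem pivot_ne {γ δ : Q.Segment} (p : γ ⟶ δ) : γ ≠ δ := by
  rintro rfl
  exact lt_irrefl _ (pivot_rank p)

theorem pivot_homLE {γ δ : Q.Segment} (p : γ ⟶ δ) : Q.HomLE γ δ := by
  refine ⟨pivot_posL p, pivot_posR p, ?_, ?_⟩
  · rcases p.down with ⟨_, h⟩ | ⟨h, _⟩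
    · rw [h]; exact γ.i_lt_j
    · rw [← h]; exact δ.i_lt_j
  · rcases p.down with ⟨_, h⟩ | ⟨h, _⟩
    · rw [← h]; exact δ.i_lt_j
    · rw [h]; exact γ.i_lt_j

/-- A segment between the ends of a pivot is one of the ends. -/
theorem pivot_minimal {γ δ ε : Q.Segment} (p : γ ⟶ δ) (h : Q.HomLE γ ε) (h' : Q.HomLE ε δ) :
    ε = γ ∨ ε = δ := by
  obtain ⟨a1, a2, -, -⟩ := h
  obtain ⟨b1, b2, -, -⟩ := h'
  rcases p.down with ⟨h1, h2⟩ | ⟨h1, h2⟩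
  · have hj : ε.j = γ.j := Q.posR_injective (le_antisymm (h2 ▸ b2) a2)
    rcases a1.eq_or_lt with e | e
    · exact Or.inl (Segment.ext (Q.posL_injective e).symm hj)
    · refine Or.inr (Segment.ext (Q.posL_injective (le_antisymm b1 ?_)) (hj.trans h2.symm))
      rw [h1]; exact (posL_R_symm_i γ).2 _ e
  · have hi : ε.i = γ.i := Q.posL_injective (le_antisymm (h1 ▸ b1) a1)
    rcases a2.eq_or_lt with e | e
    · exact Or.inl (Segment.ext hi (Q.posR_injective e).symm)
    · refine Or.inr (Segment.ext (hi.trans h1.symm) (Q.posR_injective (le_antisymm b2 ?_)))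
      rw [h2]; exact (posR_R_symm_j γ).2 _ e

/-- Some coordinate of `δ` is strictly larger than that of `γ`. Raising this coordinate of `γ` to
its successor stays in the rectangle, so the result is a line segment. -/
theorem HomLE.exists_pivot_from {γ δ : Q.Segment} (h : Q.HomLE γ δ) (hne : γ ≠ δ) :
    ∃ ε : Q.Segment, Nonempty (γ ⟶ ε) ∧ Q.HomLE γ ε ∧ Q.HomLE ε δ := by
  rcases h.left.eq_or_lt with e | e
  · have e' : Q.posR γ.j < Q.posR δ.j := lt_of_le_of_ne h.right fun e' =>
      hne (Segment.ext (Q.posL_injective e) (Q.posR_injective e'))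
    obtain ⟨h1, h2⟩ := posR_R_symm_j γ
    obtain ⟨ε, hi, hj, h3, h4⟩ := h.rectangle (x := γ.i) le_rfl h.left h1.le (h2 _ e')
    exact ⟨ε, pivot_j hi hj, h3, h4⟩
  · obtain ⟨h1, h2⟩ := posL_R_symm_i γ
    obtain ⟨ε, hi, hj, h3, h4⟩ := h.rectangle (y := γ.j) h1.le (h2 _ e) le_rfl h.right
    exact ⟨ε, pivot_i hi hj, h3, h4⟩

theorem HomLE.exists_pivot_to {γ δ : Q.Segment} (h : Q.HomLE γ δ) (hne : γ ≠ δ) :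
    ∃ ε : Q.Segment, Nonempty (ε ⟶ δ) ∧ Q.HomLE γ ε ∧ Q.HomLE ε δ := by
  rcases h.left.eq_or_lt with e | e
  · have e' : Q.posR γ.j < Q.posR δ.j := lt_of_le_of_ne h.right fun e' =>
      hne (Segment.ext (Q.posL_injective e) (Q.posR_injective e'))
    obtain ⟨h1, h2⟩ := posR_R e'
    obtain ⟨ε, hi, hj, h3, h4⟩ := h.rectangle (x := δ.i) h.left le_rfl h1 h2.le
    exact ⟨ε, pivot_j hi.symm (by rw [hj, Equiv.symm_apply_apply]), h3, h4⟩
  · obtain ⟨h1, h2⟩ := posL_R e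
    obtain ⟨ε, hi, hj, h3, h4⟩ := h.rectangle (y := δ.j) h1 h2.le h.right le_rfl
    exact ⟨ε, pivot_i (by rw [hi, Equiv.symm_apply_apply]) hj.symm, h3, h4⟩

theorem rotation_of_eq {γ δ : Q.Segment} (hi : δ.i = Q.R γ.i) (hj : δ.j = Q.R γ.j) :
    Q.rotation γ = some δ := by
  have h : Q.R γ.i < Q.R γ.j := by rw [← hi, ← hj]; exact δ.i_lt_j
  rw [rotation, dif_pos h]
  exact congrArg some (Segment.ext hi.symm hj.symm)

/-- Both sides say that `ε` shares one end point with `γ` and the other with the rotation of `γ`. -/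
theorem pivot_of_rotation {γ δ ε : Q.Segment} (h : Q.rotation γ = some δ) :
    Nonempty (ε ⟶ γ) ↔ Nonempty (δ ⟶ ε) := by
  obtain ⟨hi, hj⟩ := Q.rotation_eq_some h
  constructor
  · rintro ⟨⟨⟨h1, h2⟩ | ⟨h1, h2⟩⟩⟩
    · exact pivot_j (by rw [hi, h1, Equiv.apply_symm_apply])
        (by rw [hj, Equiv.symm_apply_apply, h2])
    · exact pivot_i (by rw [hi, Equiv.symm_apply_apply, h1])
        (by rw [hj, h2, Equiv.apply_symm_apply])
  · rintro ⟨⟨⟨h1, h2⟩ | ⟨h1, h2⟩⟩⟩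
    · exact pivot_j (by rw [h1, hi, Equiv.symm_apply_apply])
        (by rw [h2, hj, Equiv.symm_apply_apply])
    · exact pivot_i (by rw [h1, hi, Equiv.symm_apply_apply])
        (by rw [h2, hj, Equiv.symm_apply_apply])

theorem rotation_injective (x y z : Q.Segment) (hx : Q.rotation x = some z)
    (hy : Q.rotation y = some z) : x = y := by
  obtain ⟨a, b⟩ := Q.rotation_eq_some hx
  obtain ⟨c, d⟩ := Q.rotation_eq_some hy
  exact Segment.ext (Q.R.injective (a.symm.trans c)) (Q.R.injective (b.symm.trans d))

theorem isTranslationQuiver_rotation : TransQuiver.IsTranslationQuiver Q.rotation where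
  no_loops _ := ⟨fun p => pivot_ne p rfl⟩
  injective := rotation_injective
  card_arrows x z h y := by
    have := pivot_of_rotation (ε := y) h
    by_cases hp : Nonempty (y ⟶ x)
    · obtain ⟨q⟩ := this.1 hp
      obtain ⟨p⟩ := hp
      rw [Nat.card_eq_one_iff_unique.2 ⟨inferInstance, ⟨p⟩⟩,
        Nat.card_eq_one_iff_unique.2 ⟨inferInstance, ⟨q⟩⟩]
    · have hq : ¬ Nonempty (z ⟶ y) := fun h => hp (this.2 h)
      rw [not_nonempty_iff] at hp hq
      rw [Nat.card_of_isEmpty, Nat.card_of_isEmpty]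

/-- Two different pivots to `δ` from above `γ` are the second halves of a mesh above `γ`. -/
theorem HomLE.exists_mesh {γ δ δ₁ δ₂ : Q.Segment} (h : Q.HomLE γ δ) (α : δ₁ ⟶ δ) (β : δ₂ ⟶ δ)
    (hne : δ₁ ≠ δ₂) (h₁ : Q.posL γ.i ≤ Q.posL δ₁.i ∧ Q.posR γ.j ≤ Q.posR δ₁.j)
    (h₂ : Q.posL γ.i ≤ Q.posL δ₂.i ∧ Q.posR γ.j ≤ Q.posR δ₂.j) :
    ∃ ε : Q.Segment, Q.rotation δ = some ε ∧ Q.HomLE γ ε := by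
  -- Two different pivots into `δ` move different end points, so each coordinate of `δ` has been
  -- raised strictly above that of `γ`; the rectangle then contains the rotation of `δ`.
  have key : Q.posL γ.i < Q.posL δ.i ∧ Q.posR γ.j < Q.posR δ.j := by
    have a := (posL_R_symm_i δ₁).1
    have b := (posR_R_symm_j δ₁).1
    have c := (posL_R_symm_i δ₂).1
    have d := (posR_R_symm_j δ₂).1
    rcases α.down with ⟨e1, e2⟩ | ⟨e1, e2⟩ <;> rcases β.down with ⟨f1, f2⟩ | ⟨f1, f2⟩
    · exact (hne (Segment.ext (Q.R.symm.injective (e1.symm.trans f1)) (e2.symm.trans f2))).elim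
    · rw [← e1] at a; rw [← f2] at d; omega
    · rw [← e2] at b; rw [← f1] at c; omega
    · exact (hne (Segment.ext (e1.symm.trans f1) (Q.R.symm.injective (e2.symm.trans f2)))).elim
  obtain ⟨a1, a2⟩ := posL_R key.1
  obtain ⟨b1, b2⟩ := posR_R key.2
  obtain ⟨ε, hi, hj, hε, -⟩ := h.rectangle a1 a2.le b1 b2.le
  exact ⟨ε, rotation_of_eq hi hj, hε⟩

/-- A pivot that leaves the set of segments above `γ` is the second half of a mesh that starts
above `γ`. -/
theorem HomLE.exists_mesh_of_not {γ δ δ₁ : Q.Segment} (h : Q.HomLE γ δ₁) (α : δ₁ ⟶ δ)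
    (hn : ¬ Q.HomLE γ δ) : ∃ ε : Q.Segment, Q.rotation δ = some ε ∧ Q.HomLE γ ε := by
  have hi := h.left.trans (pivot_posL α)
  have hj := h.right.trans (pivot_posR α)
  have hδ := δ.i_lt_j
  have hγ := γ.i_lt_j
  have a := (posL_R_symm_i δ₁).1
  have b := (posR_R_symm_j δ₁).1
  rcases α.down with ⟨e1, e2⟩ | ⟨e1, e2⟩
  -- Equality would give `γ.j = δ.j`, and then `HomLE γ δ` would hold because `δ` is a line segment.
  · have hlt : Q.posR γ.j < Q.posR δ₁.j := lt_of_le_of_ne h.right fun e => by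
      refine hn ⟨hi, hj, e2 ▸ h.lt, ?_⟩
      rw [Q.posR_injective e, ← e2]
      exact hδ
    obtain ⟨c1, c2⟩ := posR_R hlt
    obtain ⟨ε, h1, h2, hε, -⟩ := h.rectangle h.left le_rfl c1 c2.le
    exact ⟨ε, rotation_of_eq (by rw [h1, e1, Equiv.apply_symm_apply]) (by rw [h2, e2]), hε⟩
  · have hlt : Q.posL γ.i < Q.posL δ₁.i := lt_of_le_of_ne h.left fun e => by
      refine hn ⟨hi, hj, ?_, e1 ▸ h.lt'⟩
      rw [Q.posL_injective e, ← e1]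
      exact hδ
    obtain ⟨c1, c2⟩ := posL_R hlt
    obtain ⟨ε, h1, h2, hε, -⟩ := h.rectangle c1 c2.le h.right le_rfl
    exact ⟨ε, rotation_of_eq (by rw [h1, e1]) (by rw [h2, e2, Equiv.apply_symm_apply]), hε⟩

/-- The two pivots move different end points, so `δ` has one end in common with `δ₁` and the other
with `δ₂`; each strict inequality is inherited from one of them. -/
theorem HomLE.of_pivots {γ δ δ₁ δ₂ : Q.Segment} (h₁ : Q.HomLE γ δ₁) (h₂ : Q.HomLE γ δ₂)
    (α : δ₁ ⟶ δ) (β : δ₂ ⟶ δ) (hne : δ₁ ≠ δ₂) : Q.HomLE γ δ := by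
  refine ⟨h₁.left.trans (pivot_posL α), h₁.right.trans (pivot_posR α), ?_, ?_⟩
  all_goals
    rcases α.down with ⟨e1, e2⟩ | ⟨e1, e2⟩ <;> rcases β.down with ⟨f1, f2⟩ | ⟨f1, f2⟩
  · rw [e2]; exact h₁.lt
  · rw [e2]; exact h₁.lt
  · rw [f2]; exact h₂.lt
  · exact (hne (Segment.ext (e1.symm.trans f1) (Q.R.symm.injective (e2.symm.trans f2)))).elim
  · exact (hne (Segment.ext (Q.R.symm.injective (e1.symm.trans f1)) (e2.symm.trans f2))).elim
  · rw [f1]; exact h₂.lt'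
  · rw [e1]; exact h₁.lt'
  · rw [e1]; exact h₁.lt'

/-- If the rotation of `γ` is undefined, then some vertex in the support of `M_γ` is not in the
support of any predecessor of `M_γ`. -/
theorem exists_top_of_rotation_eq_none {γ : Q.Segment} (h : Q.rotation γ = none) :
    ∃ v : ℕ, (γ.i : ℕ) < v ∧ v ≤ γ.j ∧ ∀ ε : Q.Segment, Nonempty (ε ⟶ γ) →
      ¬ ((ε.i : ℕ) < v ∧ v ≤ ε.j) := by
  have hlt : Q.R γ.j < Q.R γ.i := by
    by_contra hle
    rcases (not_lt.1 hle).eq_or_lt with e | e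
    · exact γ.i_lt_j.ne (Q.R.injective e)
    · rw [rotation, dif_pos e] at h
      exact Option.some_ne_none _ h
  have hij := γ.i_lt_j
  have hbound := (Q.R γ.i).isLt
  have hbound' := γ.j.isLt
  -- The rotation can reverse the order of the ends only by moving the left end to the right along
  -- the upper boundary and the right end to the left along the lower one.
  have key : (γ.i : ℕ) < Q.R γ.i ∧ (Q.R γ.j : ℕ) < γ.j := by
    rcases Q.clockwiseNext_R γ.i with ⟨a1, a2, a3, a4⟩ | ⟨a1, a2, a3, a4⟩ <;>
      rcases Q.clockwiseNext_R γ.j with ⟨b1, b2, b3, b4⟩ | ⟨b1, b2, b3, b4⟩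
    · exact (a4 γ.j b1 ⟨hij, b3.trans hlt⟩).elim
    · exact ⟨a3, b3⟩
    · exact absurd (b3.trans (hlt.trans a3)) (not_lt.2 hij.le)
    · exact (b4 (Q.R γ.i) a2 ⟨hlt, a3.trans hij⟩).elim
  rw [Fin.lt_def] at hlt hij
  -- An immediate predecessor of `γ` has left end `R γ.i` or right end `R γ.j`. The vertex has to be
  -- at most `R γ.i` and larger than `R γ.j` to escape both, and it must lie in the support of
  -- `M_γ`.
  refine ⟨max (γ.i : ℕ) (Q.R γ.j : ℕ) + 1, by omega, by omega, ?_⟩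
  rintro ε ⟨⟨⟨h1, h2⟩ | ⟨h1, h2⟩⟩⟩
  · rw [h1, Equiv.apply_symm_apply] at hlt key
    omega
  · rw [h2, Equiv.apply_symm_apply] at hlt key
    rw [h2, Equiv.apply_symm_apply]
    omega

open Classical in
/-- The number of points that precede `l` in the order `posL`. -/
def rankL (Q : TypeA n) (l : Fin (n + 3)) : ℕ :=
  (Finset.univ.filter fun x => Q.posL x < Q.posL l).card

theorem rankL_R_symm (γ : Q.Segment) : Q.rankL (Q.R.symm γ.i) = Q.rankL γ.i + 1 := by
  classical
  obtain ⟨h1, h2⟩ := posL_R_symm_i γ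
  have : (Finset.univ.filter fun x => Q.posL x < Q.posL (Q.R.symm γ.i)) =
      insert γ.i (Finset.univ.filter fun x => Q.posL x < Q.posL γ.i) := by
    ext x
    simp only [Finset.mem_filter, Finset.mem_univ, true_and, Finset.mem_insert]
    constructor
    · intro hx
      rcases lt_trichotomy (Q.posL x) (Q.posL γ.i) with h | h | h
      · exact Or.inr h
      · exact Or.inl (Q.posL_injective h)
      · exact absurd (h2 x h) (by omega)
    · rintro (rfl | h)
      · exact h1
      · exact h.trans h1
  unfold rankL
  rw [this, Finset.card_insert_of_notMem (by simp)]

open Classical in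
/-- Signs for the pivots: the pivots that move the left end point get the sign `1`, and
the signs of the others alternate. -/
theorem exists_pivotScalars (Q : TypeA n) (k : Type u) [Field k] :
    ∃ c : Q.PivotScalars k, ∀ {γ δ : Q.Segment} (p : γ ⟶ δ),
      (c.coeff p : k) = 1 ∨ (c.coeff p : k) = -1 := by
  refine ⟨⟨fun {γ δ} _ => if δ.i = γ.i then (-1) ^ Q.rankL γ.i else 1, ?_⟩, ?_⟩
  · intro γ δ δ' ε p q p' q' hr hne
    obtain ⟨hi, hj⟩ := Q.rotation_eq_some hr
    have hε := rankL_R_symm γ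
    have hR : ∀ x : Fin (n + 3), Q.R.symm x ≠ x := fun x e => Q.R_ne x (by
      conv_lhs => rw [← e]
      simp)
    have e0 : ε.i = Q.R.symm γ.i := by rw [hi, Equiv.symm_apply_apply]
    have e0' : ε.j = Q.R.symm γ.j := by rw [hj, Equiv.symm_apply_apply]
    have mid : ∀ {y : Q.Segment} (_ : γ ⟶ y) (_ : y ⟶ ε),
        (y.i = ε.i ∧ y.j = γ.j) ∨ (y.i = γ.i ∧ y.j = ε.j) := by
      intro y β _
      rcases β.down with ⟨h1, h2⟩ | ⟨h1, h2⟩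
      · left; exact ⟨h1.trans e0.symm, h2⟩
      · right; exact ⟨h1, h2.trans e0'.symm⟩
    have hne0 : ε.i ≠ γ.i := by rw [e0]; exact hR _
    -- The two ways around a mesh move the right end once each, with the left end at `γ.i` and at
    -- its successor `ε.i` respectively; the ranks differ by one, so the signs are opposite.
    have sq : ((-1 : k) ^ Q.rankL γ.i) + (-1) ^ Q.rankL ε.i = 0 := by
      rw [e0, hε, pow_succ]; ring
    rcases mid p q with ⟨a1, a2⟩ | ⟨a1, a2⟩ <;> rcases mid p' q' with ⟨b1, b2⟩ | ⟨b1, b2⟩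
    · exact (hne (Segment.ext (a1.trans b1.symm) (a2.trans b2.symm))).elim
    · simp only [a1, b1, if_neg hne0, if_pos]
      simpa [add_comm] using sq
    · simp only [a1, b1, if_neg hne0, if_pos]
      simpa using sq
    · exact (hne (Segment.ext (a1.trans b1.symm) (a2.trans b2.symm))).elim
  · intro γ δ p
    dsimp only
    split_ifs
    · rcases neg_one_pow_eq_or kˣ (Q.rankL γ.i) with h | h <;> rw [h] <;> simp
    · simp

end Combinatorics

end TypeA

namespace TypeA

/-! ### Morphisms between interval representations -/

section Homs

variable {n : ℕ} {Q : TypeA n}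

/-- The vertex with label `m + 1`. -/
def vtx (Q : TypeA n) (m : ℕ) (hm : m < n + 2) : Q.Vertex := (⟨m, hm⟩ : Fin (n + 2))

theorem label_vtx (m : ℕ) (hm : m < n + 2) : label (Q.vtx m hm) = m + 1 := rfl

theorem label_injective : Function.Injective (label (Q := Q)) := fun _ _ h =>
  Fin.ext (Nat.succ_injective h)

theorem label_pos (s : Q.Vertex) : 0 < label s := Nat.succ_pos _

theorem label_le (s : Q.Vertex) : label s ≤ n + 2 := Fin.isLt s

theorem exists_label {m : ℕ} (h : 0 < m) (h' : m ≤ n + 2) : ∃ s : Q.Vertex, label s = m :=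
  ⟨Q.vtx (m - 1) (by omega), by rw [label_vtx]; omega⟩

theorem IsArrow.label_cases {s t : Q.Vertex} (h : Q.IsArrow s t) :
    (label t = label s + 1 ∧ ∀ l : Fin (n + 3), (l : ℕ) = label s → Q.IsUpper l) ∨
      (label s = label t + 1 ∧ ∀ l : Fin (n + 3), (l : ℕ) = label t → ¬ Q.IsUpper l) := by
  rcases h with ⟨a, ha, h1, h2⟩ | ⟨a, ha, h1, h2⟩
  · exact Or.inl ⟨by omega, fun l hl => ⟨a, ha, by omega⟩⟩
  · refine Or.inr ⟨by omega, fun l hl h => Q.not_isUpper_and_isLower h ⟨a, ha, by omega⟩⟩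

theorem isArrow_of_isUpper {s t : Q.Vertex} {l : Fin (n + 3)} (hs : label s = l)
    (ht : label t = l + 1) (h : Q.IsUpper l) : Q.IsArrow s t := by
  obtain ⟨a, ha, hl⟩ := h
  exact Or.inl ⟨a, ha, by omega, by omega⟩

theorem isArrow_of_not_isUpper {s t : Q.Vertex} {l : Fin (n + 3)} (hs : label s = l)
    (ht : label t = l + 1) (h : ¬ Q.IsUpper l) : Q.IsArrow t s := by
  have h1 := label_pos s
  have h2 := label_le t
  rcases Q.onLower_of_not_isUpper h with rfl | rfl | ⟨a, ha, hl⟩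
  · simp at hs; omega
  · rw [Fin.val_last] at ht; omega
  · exact Or.inr ⟨a, ha, by omega, by omega⟩

theorem isArrow_or {s t : Q.Vertex} (h : label t = label s + 1) : Q.IsArrow s t ∨ Q.IsArrow t s := by
  have h2 := label_le t
  let l : Fin (n + 3) := ⟨label s, by omega⟩
  by_cases hl : Q.IsUpper l
  · exact Or.inl (isArrow_of_isUpper (l := l) rfl h hl)
  · exact Or.inr (isArrow_of_not_isUpper (l := l) rfl h hl)

/-- Compatibility could fail only on an edge at one of the four end points, pointing in a particular
direction; the direction is that of the bars, and the order of positions excludes it. The pairs need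
not satisfy `i < j`, so degenerate middle terms of meshes are covered. -/
theorem compatible_of_pos {i j i' j' : Fin (n + 3)} (hL : Q.posL i ≤ Q.posL i')
    (hR : Q.posR j ≤ Q.posR j') : Q.Compatible (i + 1) j (i' + 1) j' := by
  intro s t hst h1 h2
  unfold Between at *
  have b1 := i.isLt
  have b2 := i'.isLt
  have b3 := j.isLt
  have b4 := j'.isLt
  rcases hst.label_cases with ⟨h, hu⟩ | ⟨h, hu⟩
  · have c1 : (i' : ℕ) ≠ label s := fun e => by
      have := hu _ e
      rcases Q.posL_cases i' with a | a <;> rcases Q.posL_cases i with b | b <;> grind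
    have c2 : (j : ℕ) ≠ label s := fun e => by
      have := hu _ e
      rcases Q.posR_cases j with a | a <;> rcases Q.posR_cases j' with b | b <;> grind
    omega
  · have c1 : (i : ℕ) ≠ label t := fun e => by
      have := hu _ e
      rcases Q.posL_cases i' with a | a <;> rcases Q.posL_cases i with b | b <;> grind
    have c2 : (j' : ℕ) ≠ label t := fun e => by
      have := hu _ e
      rcases Q.posR_cases j with a | a <;> rcases Q.posR_cases j' with b | b <;> grind
    omega

variable (k : Type u) [Field k]

/-- The canonical map between the interval representations given by two pairs of points. -/
def arcMap {i j i' j' : Fin (n + 3)} (hL : Q.posL i ≤ Q.posL i') (hR : Q.posR j ≤ Q.posR j') :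
    Q.intervalRep k (i + 1) j ⟶ Q.intervalRep k (i' + 1) j' :=
  Q.canonicalMap k (compatible_of_pos hL hR)

theorem one_mem_line {p : Prop} (hp : p) : (1 : k) ∈ line k p := by simp [line, hp]

section Coeff

variable {k} {a b c d : ℕ}

/-- The value at a vertex of a morphism between interval representations. -/
def component (f : Q.intervalRep k a b ⟶ Q.intervalRep k c d) (l : Q.Vertex) :
    line k (Between a b l) →ₗ[k] line k (Between c d l) := (f.app l).hom.hom

open Classical in
/-- The scalar by which a morphism between interval representations acts at a vertex. -/
def homCoeff (f : Q.intervalRep k a b ⟶ Q.intervalRep k c d) (l : Q.Vertex) : k :=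
  if h : Between a b l then (component f l ⟨1, one_mem_line k h⟩ : k) else 0

theorem component_apply (f : Q.intervalRep k a b ⟶ Q.intervalRep k c d) (l : Q.Vertex)
    (x : line k (Between a b l)) : (component f l x : k) = homCoeff f l * x := by
  unfold homCoeff
  split_ifs with h
  · have hx : x = (x : k) • (⟨1, one_mem_line k h⟩ : line k (Between a b l)) :=
      Subtype.ext (by simp)
    conv_lhs => rw [hx]
    rw [map_smul]
    simp [mul_comm]
  · rw [line_eq_zero k h x]
    simp

theorem homCoeff_eq_zero_left (f : Q.intervalRep k a b ⟶ Q.intervalRep k c d) {l : Q.Vertex}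
    (h : ¬ Between a b l) : homCoeff f l = 0 := dif_neg h

theorem homCoeff_eq_zero_right (f : Q.intervalRep k a b ⟶ Q.intervalRep k c d) {l : Q.Vertex}
    (h : ¬ Between c d l) : homCoeff f l = 0 := by
  unfold homCoeff
  split_ifs with h'
  · rw [line_eq_zero k h (component f l _)]; rfl
  · rfl

theorem homCoeff_ext {f g : Q.intervalRep k a b ⟶ Q.intervalRep k c d}
    (h : ∀ l, homCoeff f l = homCoeff g l) : f = g := by
  have key : ∀ l (x : line k (Between a b l)), component f l x = component g l x :=
    fun l x => Subtype.ext (by rw [component_apply, component_apply, h])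
  exact Q.rep_hom_ext k key

theorem homCoeff_smul (r : k) (f : Q.intervalRep k a b ⟶ Q.intervalRep k c d) (l : Q.Vertex) :
    homCoeff (r • f) l = r * homCoeff f l := by
  unfold homCoeff
  split_ifs with h
  · rfl
  · simp

theorem homCoeff_zero (l : Q.Vertex) :
    homCoeff (0 : Q.intervalRep k a b ⟶ Q.intervalRep k c d) l = 0 := by
  unfold homCoeff
  split_ifs with h
  · rfl
  · rfl

theorem homCoeff_canonicalMap (h : Q.Compatible a b c d) {l : Q.Vertex} (h1 : Between a b l)
    (h2 : Between c d l) : homCoeff (Q.canonicalMap k h) l = 1 := by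
  unfold homCoeff
  rw [dif_pos h1]
  exact lineMap_of k h2 _

/-- This is naturality evaluated at `1`. Nothing is assumed about `t` in the source or `s` in the
target: when one of these fails, one of the coefficients is zero by definition and the equality
makes the other vanish too. -/
theorem homCoeff_arrow (f : Q.intervalRep k a b ⟶ Q.intervalRep k c d) {s t : Q.Vertex}
    (hst : Q.IsArrow s t) (hs : Between a b s) (ht : Between c d t) :
    homCoeff f s = homCoeff f t := by
  have nat : ∀ x, component f t (lineMap k (Between a b s) (Between a b t) x) =
      lineMap k (Between c d s) (Between c d t) (component f s x) := by
    intro x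
    have h := f.naturality ((Paths.of Q.Vertex).map (PLift.up hst : s ⟶ t))
    have h1 : (Q.intervalRep k a b).map ((Paths.of Q.Vertex).map (PLift.up hst : s ⟶ t)) =
      FGModuleCat.ofHom (lineMap k (Between a b s) (Between a b t)) := Paths.lift_toPath _ _
    have h2 : (Q.intervalRep k c d).map ((Paths.of Q.Vertex).map (PLift.up hst : s ⟶ t)) =
      FGModuleCat.ofHom (lineMap k (Between c d s) (Between c d t)) := Paths.lift_toPath _ _
    rw [h1, h2] at h
    exact congrArg (fun g => g.hom.hom x) h
  have h := congrArg Subtype.val (nat ⟨1, one_mem_line k hs⟩)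
  rw [lineMap_of k ht, component_apply, component_apply, mul_one] at h
  rw [← h]
  by_cases hta : Between a b t
  · rw [lineMap_of k hta, mul_one]
  · rw [homCoeff_eq_zero_left f hta, zero_mul]

/-- The common support of two intervals is an interval, hence connected; the proof walks along it
one edge at a time. -/
theorem homCoeff_const (f : Q.intervalRep k a b ⟶ Q.intervalRep k c d) {s t : Q.Vertex}
    (h1 : Between a b s) (h2 : Between c d s) (h3 : Between a b t) (h4 : Between c d t) :
    homCoeff f s = homCoeff f t := by
  wlog hst : label s ≤ label t generalizing s t
  · exact (this h3 h4 h1 h2 (by omega)).symm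
  obtain ⟨m, hm⟩ := Nat.exists_eq_add_of_le hst
  induction m generalizing t with
  | zero => rw [label_injective (by omega : label s = label t)]
  | succ m ih =>
    unfold Between at *
    obtain ⟨t', ht'⟩ := exists_label (Q := Q) (m := label s + m)
      (by have := label_pos s; omega) (by have := label_le t; omega)
    rw [ih (t := t') (by omega) (by omega) (by omega) (by omega)]
    rcases isArrow_or (Q := Q) (s := t') (t := t) (by omega) with h | h
    · exact homCoeff_arrow f h (by unfold Between; omega) (by unfold Between; omega)
    · exact (homCoeff_arrow f h (by unfold Between; omega) (by unfold Between; omega)).symm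

/-- Since the coefficient is constant on the common support, it can be read off at any vertex there;
if the supports are disjoint, both morphisms vanish. -/
theorem eq_smul_canonicalMap (h : Q.Compatible a b c d)
    (f : Q.intervalRep k a b ⟶ Q.intervalRep k c d) :
    ∃ r : k, f = r • Q.canonicalMap k h := by
  by_cases hex : ∃ s : Q.Vertex, Between a b s ∧ Between c d s
  · obtain ⟨s, h1, h2⟩ := hex
    refine ⟨homCoeff f s, homCoeff_ext fun l => ?_⟩
    rw [homCoeff_smul]
    by_cases h3 : Between a b l
    · by_cases h4 : Between c d l
      · rw [homCoeff_canonicalMap h h3 h4, mul_one, homCoeff_const f h1 h2 h3 h4]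
      · rw [homCoeff_eq_zero_right _ h4, homCoeff_eq_zero_right _ h4, mul_zero]
    · rw [homCoeff_eq_zero_left _ h3, homCoeff_eq_zero_left _ h3, mul_zero]
  · refine ⟨0, homCoeff_ext fun l => ?_⟩
    rw [homCoeff_smul, zero_mul]
    by_cases h3 : Between a b l
    · exact homCoeff_eq_zero_right _ fun h4 => hex ⟨l, h3, h4⟩
    · exact homCoeff_eq_zero_left _ h3

end Coeff

variable {i j i' j' i'' j'' : Fin (n + 3)}

theorem arcMap_refl :
    arcMap k (Q := Q) (i := i) (j := j) le_rfl le_rfl = 𝟙 (Q.intervalRep k (i + 1) j) := by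
  refine Q.rep_hom_ext k fun l x => ?_
  change lineMap k (Between (i + 1) j l) (Between (i + 1) j l) x = x
  by_cases h : Between (i + 1) j l
  · exact Subtype.ext (lineMap_of k h x)
  · rw [line_eq_zero k h x, map_zero]

/-- A vertex in the first and the third support also lies in the middle one, by the shape of the
labels along `posL` and `posR`; so no scalar is lost on the way. -/
theorem arcMap_comp (hL : Q.posL i ≤ Q.posL i') (hR : Q.posR j ≤ Q.posR j')
    (hL' : Q.posL i' ≤ Q.posL i'') (hR' : Q.posR j' ≤ Q.posR j'') :
    arcMap k hL hR ≫ arcMap k hL' hR' = arcMap k (hL.trans hL') (hR.trans hR') := by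
  refine Q.rep_hom_ext k fun l v => ?_
  refine (Q.canonicalMap_comp_apply k _ _ l v).trans (lineMap_comp k _ ?_)
  rintro ⟨h1, h2⟩ ⟨h3, h4⟩
  have a := Q.le_or_le_of_posL hL hL'
  have b := Q.le_or_le_of_posR hR hR'
  exact ⟨by omega, by omega⟩

variable {γ δ ε : Q.Segment}

/-- The canonical map `M_γ ⟶ M_δ`, which may be zero. -/
def posMap (h : Q.posL γ.i ≤ Q.posL δ.i ∧ Q.posR γ.j ≤ Q.posR δ.j) :
    Q.segmentRep k γ ⟶ Q.segmentRep k δ := arcMap k h.1 h.2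

theorem posMap_comp (h : Q.posL γ.i ≤ Q.posL δ.i ∧ Q.posR γ.j ≤ Q.posR δ.j)
    (h' : Q.posL δ.i ≤ Q.posL ε.i ∧ Q.posR δ.j ≤ Q.posR ε.j) :
    posMap k h ≫ posMap k h' = posMap k ⟨h.1.trans h'.1, h.2.trans h'.2⟩ := arcMap_comp k _ _ _ _

/-- The canonical map `M_γ ⟶ M_δ`, if it is nonzero. -/
abbrev segMap (h : Q.HomLE γ δ) : Q.segmentRep k γ ⟶ Q.segmentRep k δ :=
  posMap k ⟨h.left, h.right⟩

theorem segMap_refl : segMap k (HomLE.refl γ) = 𝟙 (Q.segmentRep k γ) := arcMap_refl k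

theorem segMap_comp (h : Q.HomLE γ δ) (h' : Q.HomLE δ ε) (h'' : Q.HomLE γ ε) :
    segMap k h ≫ segMap k h' = segMap k h'' := arcMap_comp k _ _ _ _

theorem segMap_ne_zero (h : Q.HomLE γ δ) : segMap k h ≠ 0 := by
  have c1 := h.lt
  have c2 := h.lt'
  have c3 := γ.i_lt_j
  have c4 := δ.i_lt_j
  rw [Fin.lt_def] at c1 c2 c3 c4
  have := γ.j.isLt
  -- This is the leftmost vertex of the common support.
  obtain ⟨s, hs⟩ := exists_label (Q := Q) (m := max (γ.i : ℕ) δ.i + 1) (by omega) (by omega)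
  intro h0
  have h1 : homCoeff (segMap k h) s = 1 :=
    homCoeff_canonicalMap (compatible_of_pos h.left h.right) (by unfold Between; omega)
      (by unfold Between; omega)
  rw [h0] at h1
  exact zero_ne_one ((homCoeff_zero s).symm.trans h1)

variable {k}

theorem eq_smul_segMap (h : Q.HomLE γ δ) (f : Q.segmentRep k γ ⟶ Q.segmentRep k δ) :
    ∃ r : k, f = r • segMap k h :=
  eq_smul_canonicalMap (compatible_of_pos h.left h.right) f

/-- A nonzero morphism is nonzero on all of the common support, so every edge leading out of this
support must have the direction that naturality permits. At the four ends this yields the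
inequalities between positions. -/
theorem homLE_of_ne_zero {f : Q.segmentRep k γ ⟶ Q.segmentRep k δ} (hf : f ≠ 0) :
    Q.HomLE γ δ := by
  obtain ⟨l, hl⟩ : ∃ l : Q.Vertex, homCoeff f l ≠ 0 := by
    by_contra hall
    push Not at hall
    exact hf (homCoeff_ext fun l => (hall l).trans (homCoeff_zero l).symm)
  have l1 : Between (γ.i + 1) γ.j l := by
    by_contra h; exact hl (homCoeff_eq_zero_left f h)
  have l2 : Between (δ.i + 1) δ.j l := by
    by_contra h; exact hl (homCoeff_eq_zero_right f h)
  have hc : ∀ s, Between (γ.i + 1) γ.j s → Between (δ.i + 1) δ.j s → homCoeff f s ≠ 0 :=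
    fun s h1 h2 => by rwa [homCoeff_const f h1 h2 l1 l2]
  have z1 : ∀ s t, Q.IsArrow s t → Between (γ.i + 1) γ.j s → Between (δ.i + 1) δ.j t →
      (Between (γ.i + 1) γ.j t ↔ Between (δ.i + 1) δ.j s) := by
    intro s t hst hs ht
    have e := homCoeff_arrow f hst hs ht
    by_cases a : Between (γ.i + 1) γ.j t <;> by_cases b : Between (δ.i + 1) δ.j s
    · exact iff_of_true a b
    · exact (hc t a ht (e.symm.trans (homCoeff_eq_zero_right f b))).elim
    · exact (hc s hs b (e.trans (homCoeff_eq_zero_left f a))).elim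
    · exact iff_of_false a b
  clear hc
  unfold Between at l1 l2 z1
  have b1 := γ.i.isLt
  have b2 := δ.i.isLt
  have b3 := γ.j.isLt
  have b4 := δ.j.isLt
  have up : ∀ x : Fin (n + 3), 0 < (x : ℕ) → (x : ℕ) < n + 2 → Q.IsUpper x →
      ((γ.i : ℕ) + 1 ≤ x ∧ (x : ℕ) ≤ γ.j) → ((δ.i : ℕ) + 1 ≤ x + 1 ∧ (x : ℕ) + 1 ≤ δ.j) →
      ((γ.i : ℕ) + 1 ≤ x + 1 ∧ (x : ℕ) + 1 ≤ γ.j ↔ (δ.i : ℕ) + 1 ≤ x ∧ (x : ℕ) ≤ δ.j) := by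
    intro x h0 h1 hx
    obtain ⟨s, hs⟩ := exists_label (Q := Q) (m := (x : ℕ)) h0 (by omega)
    obtain ⟨t, ht⟩ := exists_label (Q := Q) (m := (x : ℕ) + 1) (by omega) (by omega)
    have := z1 s t (isArrow_of_isUpper hs ht hx)
    rwa [hs, ht] at this
  have low : ∀ x : Fin (n + 3), 0 < (x : ℕ) → (x : ℕ) < n + 2 → ¬ Q.IsUpper x →
      ((γ.i : ℕ) + 1 ≤ x + 1 ∧ (x : ℕ) + 1 ≤ γ.j) → ((δ.i : ℕ) + 1 ≤ x ∧ (x : ℕ) ≤ δ.j) →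
      ((γ.i : ℕ) + 1 ≤ x ∧ (x : ℕ) ≤ γ.j ↔ (δ.i : ℕ) + 1 ≤ x + 1 ∧ (x : ℕ) + 1 ≤ δ.j) := by
    intro x h0 h1 hx
    obtain ⟨s, hs⟩ := exists_label (Q := Q) (m := (x : ℕ)) h0 (by omega)
    obtain ⟨t, ht⟩ := exists_label (Q := Q) (m := (x : ℕ) + 1) (by omega) (by omega)
    have := z1 t s (isArrow_of_not_isUpper hs ht hx)
    rwa [hs, ht] at this
  clear z1
  refine ⟨?_, ?_, by rw [Fin.lt_def]; omega, by rw [Fin.lt_def]; omega⟩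
  -- If `γ.i < δ.i`, the edge at `δ.i` must run from the common support into the rest of the source,
  -- so `δ.i` is not upper. If `δ.i < γ.i`, the edge at `γ.i` must run from the rest of the target
  -- into the common support, so `γ.i` is upper.
  · rcases lt_trichotomy (γ.i : ℕ) δ.i with h | h | h
    · have hu : ¬ Q.IsUpper δ.i := fun hu => by
        have := up δ.i (by omega) (by omega) hu (by omega) (by omega); omega
      rcases Q.posL_cases δ.i with a | a
      · exact (hu a.1).elim
      · rcases Q.posL_cases γ.i with b | b <;> omega
    · rw [Fin.ext h]
    · have hu : Q.IsUpper γ.i := by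
        by_contra hu
        have := low γ.i (by omega) (by omega) hu (by omega) (by omega); omega
      rcases Q.posL_cases γ.i with a | a
      · rcases Q.posL_cases δ.i with b | b <;> omega
      · exact (a.1 hu).elim
  · rcases lt_trichotomy (γ.j : ℕ) δ.j with h | h | h
    · have hu : ¬ Q.IsUpper γ.j := fun hu => by
        have := up γ.j (by omega) (by omega) hu (by omega) (by omega); omega
      rcases Q.posR_cases γ.j with a | a
      · rcases a.1 with a | a
        · exact (hu a).elim
        · omega
      · rcases Q.posR_cases δ.j with b | b <;> omega
    · rw [Fin.ext h]
    · have hu : Q.IsUpper δ.j := by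
        by_contra hu
        have := low δ.j (by omega) (by omega) hu (by omega) (by omega); omega
      rcases Q.posR_cases δ.j with a | a
      · rcases Q.posR_cases γ.j with b | b <;> omega
      · exact (a.1 hu).elim

theorem segmentRep_end (f : Q.segmentRep k γ ⟶ Q.segmentRep k γ) : ∃ r : k, f = r • 𝟙 _ := by
  obtain ⟨r, h⟩ := eq_smul_segMap (HomLE.refl γ) f
  exact ⟨r, h.trans (by rw [segMap_refl])⟩

theorem segmentRep_id_ne_zero : 𝟙 (Q.segmentRep k γ) ≠ 0 := by
  rw [← segMap_refl]
  exact segMap_ne_zero k _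

/-- A composition `M_γ ⟶ M_δ ⟶ M_γ` is zero if `γ ≠ δ`. -/
theorem comp_eq_zero_of_ne (hne : γ ≠ δ) (f : Q.segmentRep k γ ⟶ Q.segmentRep k δ)
    (g : Q.segmentRep k δ ⟶ Q.segmentRep k γ) : f ≫ g = 0 := by
  by_cases hf : f = 0
  · rw [hf, zero_comp]
  by_cases hg : g = 0
  · rw [hg, comp_zero]
  exact (hne ((homLE_of_ne_zero hf).antisymm (homLE_of_ne_zero hg))).elim

theorem eq_of_retract {f : Q.segmentRep k γ ⟶ Q.segmentRep k δ}
    {g : Q.segmentRep k δ ⟶ Q.segmentRep k γ} (h : f ≫ g ≠ 0) : γ = δ := by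
  by_contra hne
  exact h (comp_eq_zero_of_ne hne f g)

theorem eq_of_iso (e : Q.segmentRep k γ ≅ Q.segmentRep k δ) : γ = δ :=
  eq_of_retract (f := e.hom) (g := e.inv) (by rw [e.hom_inv_id]; exact segmentRep_id_ne_zero)

end Homs

end TypeA

namespace TypeA

/-! ### Decomposition of representations into interval representations -/

section Decomposition

variable {n : ℕ} {Q : TypeA n} {k : Type u} [Field k]

/-- The vector space of a representation at a vertex. -/
abbrev fiber (M : Q.Rep k) (l : Q.Vertex) : Type u := M.obj l

/-- The linear map of a representation at an arrow. -/
def arrowMap (M : Q.Rep k) {s t : Q.Vertex} (h : Q.IsArrow s t) : fiber M s →ₗ[k] fiber M t :=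
  (M.map ((Paths.of Q.Vertex).map (PLift.up h : s ⟶ t))).hom.hom

/-- A family of vectors that is compatible with the arrows between the vertices `a, …, b`. -/
def IsCompatibleFamily (M : Q.Rep k) (a b : ℕ) (x : ∀ l, fiber M l) : Prop :=
  ∀ s t (h : Q.IsArrow s t), Between a b s → Between a b t → arrowMap M h (x s) = x t

theorem IsArrow.asymm {s t : Q.Vertex} (h : Q.IsArrow s t) (h' : Q.IsArrow t s) : False := by
  have b := label_le s
  have b' := label_le t
  rcases h.label_cases with ⟨h1, h2⟩ | ⟨h1, h2⟩ <;> rcases h'.label_cases with ⟨h3, h4⟩ | ⟨h3, h4⟩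
  · omega
  · exact h4 ⟨label s, by omega⟩ rfl (h2 ⟨label s, by omega⟩ rfl)
  · exact h2 ⟨label t, by omega⟩ rfl (h4 ⟨label t, by omega⟩ rfl)
  · omega

/-- The morphism from an interval representation given by a compatible family. -/
def ofFamily (M : Q.Rep k) (a b : ℕ) (x : ∀ l, fiber M l) (hx : IsCompatibleFamily M a b x)
    (h0 : ∀ s t (h : Q.IsArrow s t), Between a b s → ¬ Between a b t → arrowMap M h (x s) = 0) :
    Q.intervalRep k a b ⟶ M :=
  Paths.liftNatTrans (fun l => FGModuleCat.ofHom
      ((LinearMap.toSpanSingleton k (fiber M l) (x l)).comp (line k (Between a b l)).subtype))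
    (by
      intro s t α
      have h1 : (Q.intervalRep k a b).map α.toPath =
        FGModuleCat.ofHom (lineMap k (Between a b s) (Between a b t)) := Paths.lift_toPath _ _
      rw [h1]
      apply FGModuleCat.hom_ext
      apply LinearMap.ext
      intro (c : line k (Between a b s))
      change (lineMap k (Between a b s) (Between a b t) c : k) • x t =
        arrowMap M α.down ((c : k) • x s)
      rw [map_smul]
      by_cases hs : Between a b s
      · by_cases ht : Between a b t
        · rw [hx s t α.down hs ht, lineMap_of k ht]
        · rw [h0 s t α.down hs ht, line_eq_zero k ht (lineMap k _ _ c), smul_zero]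
          exact zero_smul k _
      · rw [line_eq_zero k hs c, map_zero]
        exact (zero_smul k _).trans (zero_smul k _).symm)

open Classical in
/-- The projection of `k` onto `k` or `0`. -/
def toLine (k : Type u) [Field k] (p : Prop) : k →ₗ[k] line k p :=
  if h : p then LinearMap.codRestrict (line k p) LinearMap.id (fun _ => by simp [line, h]) else 0

theorem toLine_of {p : Prop} (h : p) (x : k) : (toLine k p x : k) = x := by
  simp only [toLine, dif_pos h]
  rfl

/-- The morphism to an interval representation given by a compatible family of functionals. -/
def ofFunctionals (M : Q.Rep k) (a b : ℕ) (φ : ∀ l, fiber M l →ₗ[k] k)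
    (hφ : ∀ s t (h : Q.IsArrow s t), Between a b s → Between a b t → ∀ y,
      φ t (arrowMap M h y) = φ s y)
    (h0 : ∀ s t (h : Q.IsArrow s t), ¬ Between a b s → Between a b t → ∀ y,
      φ t (arrowMap M h y) = 0) : M ⟶ Q.intervalRep k a b :=
  Paths.liftNatTrans (fun l => FGModuleCat.ofHom ((toLine k (Between a b l)).comp (φ l)))
    (by
      intro s t α
      have h1 : (Q.intervalRep k a b).map α.toPath =
        FGModuleCat.ofHom (lineMap k (Between a b s) (Between a b t)) := Paths.lift_toPath _ _
      rw [h1]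
      apply FGModuleCat.hom_ext
      apply LinearMap.ext
      intro (y : fiber M s)
      change toLine k (Between a b t) (φ t (arrowMap M α.down y)) =
        lineMap k (Between a b s) (Between a b t) (toLine k (Between a b s) (φ s y))
      by_cases ht : Between a b t
      · apply Subtype.ext
        rw [toLine_of ht, lineMap_of k ht]
        by_cases hs : Between a b s
        · rw [hφ s t α.down hs ht, toLine_of hs]
        · rw [h0 s t α.down hs ht, line_eq_zero k hs (toLine k _ _)]
          rfl
      · exact (line_eq_zero k ht _).trans (line_eq_zero k ht _).symm)

/-- The relations that hold for all compatible families of functionals on the vertices `a, …, b`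
which vanish on the subspace `U` at the vertex `b`. -/
def relations (M : Q.Rep k) (a b : ℕ) (va vb : Q.Vertex) (U : Submodule k (fiber M vb)) :
    Submodule k (∀ l, fiber M l) where
  -- An edge between `l` and `l+1` contributes the relation `φ (p l) = φ (q (l+1))`, where one of
  -- the two vectors is the image of the other. So `p` collects the terms from the edges to the
  -- right, `q` those from the edges to the left, and at `b` the entry of `p` is an element of `U`.
  carrier := {w | ∃ p q : ∀ l, fiber M l, (∀ l, Between a b l → w l = p l - q l) ∧ q va = 0 ∧
    p vb ∈ U ∧ ∀ s t, Between a b s → Between a b t → label t = label s + 1 →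
      (∀ h : Q.IsArrow s t, arrowMap M h (p s) = q t) ∧
      (∀ h : Q.IsArrow t s, arrowMap M h (q t) = p s)}
  zero_mem' := ⟨0, 0, by simp, rfl, U.zero_mem, by simp⟩
  add_mem' := by
    rintro w w' ⟨p, q, h1, h2, h3, h4⟩ ⟨p', q', h1', h2', h3', h4'⟩
    refine ⟨p + p', q + q', fun l hl => ?_, ?_, U.add_mem h3 h3', fun s t hs ht h => ⟨?_, ?_⟩⟩
    · rw [Pi.add_apply, Pi.add_apply, Pi.add_apply, h1 l hl, h1' l hl]; abel
    · rw [Pi.add_apply, h2, h2', add_zero]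
    · intro hst
      rw [Pi.add_apply, Pi.add_apply, map_add, (h4 s t hs ht h).1, (h4' s t hs ht h).1]
    · intro hst
      rw [Pi.add_apply, Pi.add_apply, map_add, (h4 s t hs ht h).2, (h4' s t hs ht h).2]
  smul_mem' := by
    rintro r w ⟨p, q, h1, h2, h3, h4⟩
    refine ⟨r • p, r • q, fun l hl => ?_, ?_, U.smul_mem r h3, fun s t hs ht h => ⟨?_, ?_⟩⟩
    · rw [Pi.smul_apply, Pi.smul_apply, Pi.smul_apply, h1 l hl, smul_sub]
    · rw [Pi.smul_apply, h2, smul_zero]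
    · intro hst
      rw [Pi.smul_apply, Pi.smul_apply, map_smul, (h4 s t hs ht h).1]
    · intro hst
      rw [Pi.smul_apply, Pi.smul_apply, map_smul, (h4 s t hs ht h).2]

theorem between_ends {a b : ℕ} (hab : a ≤ b) {va vb : Q.Vertex} (ha : label va = a)
    (hb : label vb = b) : Between a b va ∧ Between a b vb := by
  unfold Between; omega

open Classical in
/-- Linear duality for zigzags: a vector at `a` that does not extend to a compatible
family with value in `U` at `b` is detected by a compatible family of functionals that vanishes
on `U`. -/
theorem exists_functionals (M : Q.Rep k) {a b : ℕ} (hab : a ≤ b) {va vb : Q.Vertex}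
    (ha : label va = a) (hb : label vb = b) (U : Submodule k (fiber M vb)) (x : fiber M va)
    (hx : ∀ y, IsCompatibleFamily M a b y → y va = x → y vb ∉ U) :
    ∃ φ : ∀ l, fiber M l →ₗ[k] k, φ va x ≠ 0 ∧ (∀ z ∈ U, φ vb z = 0) ∧
      ∀ s t (h : Q.IsArrow s t), Between a b s → Between a b t → ∀ y,
        φ t (arrowMap M h y) = φ s y := by
  obtain ⟨hva, hvb⟩ := between_ends hab ha hb
  -- If this vector were a relation, then `p` and `q` would agree away from `a`, so `p` would be a
  -- compatible family that starts with `x` and ends in `U`.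
  have hnot : (Pi.single va x : ∀ l, fiber M l) ∉ relations M a b va vb U := by
    rintro ⟨p, q, h1, h2, h3, h4⟩
    have hp : p va = x := by
      have := h1 va hva
      rw [h2, sub_zero, Pi.single_eq_same] at this
      exact this.symm
    have hpq : ∀ l, Between a b l → l ≠ va → p l = q l := by
      intro l hl hne
      have := h1 l hl
      rw [Pi.single_eq_of_ne hne] at this
      exact (sub_eq_zero.1 this.symm)
    refine hx p (fun s t h hs ht => ?_) hp h3
    have hs' := hs
    have ht' := ht
    unfold Between at hs' ht'
    rcases h.label_cases with ⟨e, -⟩ | ⟨e, -⟩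
    · rw [(h4 s t hs ht e).1 h, hpq t ht]
      rintro rfl
      omega
    · rw [← (h4 t s ht hs e).2 h, hpq s hs]
      rintro rfl
      omega
  -- A functional on the product that kills all relations but not `x` at `a`; its restrictions to
  -- the factors are the required functionals.
  obtain ⟨f, hf, hker⟩ := Submodule.exists_le_ker_of_notMem hnot
  refine ⟨fun l => f.comp (LinearMap.single k (fiber M) l), hf, fun z hz => ?_,
    fun s t h hs ht y => ?_⟩
  · refine hker (x := Pi.single vb z) ⟨Pi.single vb z, 0, by simp, rfl, by simpa, ?_⟩
    intro s t hs ht e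
    unfold Between at hs ht
    have hne : s ≠ vb := by rintro rfl; omega
    simp [Pi.single_eq_of_ne hne]
  · have hst : s ≠ t := by
      rintro rfl
      exact h.asymm h
    have hs' := hs
    have ht' := ht
    unfold Between at hs' ht'
    have key : (Pi.single t (arrowMap M h y) - Pi.single s y : ∀ l, fiber M l) ∈
        relations M a b va vb U := by
      rcases h.label_cases with ⟨e, -⟩ | ⟨e, -⟩
      · refine ⟨- Pi.single s y, - Pi.single t (arrowMap M h y), fun l _ => ?_, ?_, ?_, ?_⟩
        · simp only [Pi.sub_apply, Pi.neg_apply]; abel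
        · have : va ≠ t := by rintro rfl; omega
          simp [Pi.single_eq_of_ne this]
        · have : vb ≠ s := by rintro rfl; omega
          simp [Pi.single_eq_of_ne this]
        · intro s' t' _ _ e'
          by_cases hs : s' = s
          · subst hs
            obtain rfl : t' = t := label_injective (by omega)
            exact ⟨fun _ => by simp, fun h' => (h.asymm h').elim⟩
          · have ht : t' ≠ t := fun e2 => hs (label_injective (by rw [e2] at e'; omega))
            simp [Pi.single_eq_of_ne hs, Pi.single_eq_of_ne ht]
      · refine ⟨Pi.single t (arrowMap M h y), Pi.single s y, fun l _ => ?_, ?_, ?_, ?_⟩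
        · simp only [Pi.sub_apply]
        · have : va ≠ s := by rintro rfl; omega
          simp [Pi.single_eq_of_ne this]
        · have : vb ≠ t := by rintro rfl; omega
          simp [Pi.single_eq_of_ne this]
        · intro s' t' _ _ e'
          by_cases hs : t' = s
          · subst hs
            obtain rfl : s' = t := label_injective (by omega)
            exact ⟨fun h' => (h.asymm h').elim, fun _ => by simp⟩
          · have ht : s' ≠ t := fun e2 => hs (label_injective (by rw [e2] at e'; omega))
            simp [Pi.single_eq_of_ne hs, Pi.single_eq_of_ne ht]
    have := hker key
    rw [LinearMap.mem_ker, map_sub, sub_eq_zero] at this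
    exact this

open Classical in
/-- A compatible family can be extended along one more edge. -/
theorem IsCompatibleFamily.update {M : Q.Rep k} {a b : ℕ} {x : ∀ l, fiber M l}
    (hx : IsCompatibleFamily M a b x) {vb v : Q.Vertex} (hb : label vb = b)
    (hv : label v = b + 1) (z : fiber M v) (h1 : ∀ h : Q.IsArrow vb v, arrowMap M h (x vb) = z)
    (h2 : ∀ h : Q.IsArrow v vb, arrowMap M h z = x vb) :
    IsCompatibleFamily M a (b + 1) (Function.update x v z) := by
  intro s t h hs ht
  have hb' : ∀ {r : Q.Vertex}, label r = b → r = vb := fun e => label_injective (e.trans hb.symm)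
  have hv' : ∀ {r : Q.Vertex}, label r = b + 1 → r = v := fun e => label_injective (e.trans hv.symm)
  unfold Between at hs ht
  by_cases es : s = v
  · subst es
    have et : label t = b := by rcases h.label_cases with ⟨e, -⟩ | ⟨e, -⟩ <;> omega
    obtain rfl := hb' et
    have hne : t ≠ s := by rintro rfl; omega
    rw [Function.update_self, Function.update_of_ne hne, h2]
  · by_cases et : t = v
    · subst et
      have es' : label s = b := by rcases h.label_cases with ⟨e, -⟩ | ⟨e, -⟩ <;> omega
      obtain rfl := hb' es'
      rw [Function.update_self, Function.update_of_ne es, h1]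
    · rw [Function.update_of_ne es, Function.update_of_ne et]
      refine hx s t h ⟨hs.1, ?_⟩ ⟨ht.1, ?_⟩
      · by_contra; exact es (hv' (by omega))
      · by_contra; exact et (hv' (by omega))

theorem IsCompatibleFamily.mono {M : Q.Rep k} {a b : ℕ} {x : ∀ l, fiber M l}
    (hx : IsCompatibleFamily M a (b + 1) x) : IsCompatibleFamily M a b x :=
  fun s t h hs ht => hx s t h ⟨hs.1, hs.2.trans (Nat.le_succ b)⟩ ⟨ht.1, ht.2.trans (Nat.le_succ b)⟩

open Classical in
/-- Every nonzero representation has a direct summand `M_γ`. -/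
theorem exists_retract (M : Q.Rep k) (hM : ¬ IsZero M) :
    ∃ (γ : Q.Segment) (f : Q.segmentRep k γ ⟶ M) (g : M ⟶ Q.segmentRep k γ), f ≫ g = 𝟙 _ := by
  -- the first vertex in the support of `M`
  obtain ⟨va, hva, hmin⟩ : ∃ va : Q.Vertex, Nontrivial (fiber M va) ∧
      ∀ s : Q.Vertex, label s < label va → Subsingleton (fiber M s) := by
    have hex : ∃ m : ℕ, ∃ s : Q.Vertex, label s = m ∧ Nontrivial (fiber M s) := by
      by_contra hall
      push Not at hall
      refine hM ((Functor.isZero_iff M).2 fun s => ?_)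
      have hs : Subsingleton (fiber M s) := hall _ s rfl
      rw [IsZero.iff_id_eq_zero]
      apply FGModuleCat.hom_ext
      exact LinearMap.ext fun y => @Subsingleton.elim (fiber M s) hs _ _
    obtain ⟨s, hs, hn⟩ := Nat.find_spec hex
    refine ⟨s, hn, fun t ht => not_nontrivial_iff_subsingleton.1 fun hn' => ?_⟩
    exact Nat.find_min hex (hs ▸ ht) ⟨t, rfl, hn'⟩
  obtain ⟨a, ha⟩ : ∃ a, label va = a := ⟨_, rfl⟩
  have ha0 := label_pos va
  have ha1 := label_le va
  -- the last `b` for which some family on `a, …, b` cannot be modified to end with zero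
  let P : ℕ → Prop := fun b => a ≤ b ∧ ∃ x, IsCompatibleFamily M a b x ∧
    ∀ y, IsCompatibleFamily M a b y → y va = x va → ∀ v, label v = b → y v ≠ 0
  have hPa : P a := by
    obtain ⟨x, hx⟩ := exists_ne (0 : fiber M va)
    refine ⟨le_rfl, Pi.single va x, ?_, ?_⟩
    · intro s t h hs ht
      unfold Between at hs ht
      rcases h.label_cases with ⟨e, -⟩ | ⟨e, -⟩ <;> omega
    · intro y _ hy v hv
      obtain rfl : v = va := label_injective (hv.trans ha.symm)
      rw [hy, Pi.single_eq_same]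
      exact hx
  obtain ⟨b, hab, hbn, ⟨x, hx, hxK⟩, hmax⟩ : ∃ b, a ≤ b ∧ b ≤ n + 2 ∧
      (∃ x, IsCompatibleFamily M a b x ∧
        ∀ y, IsCompatibleFamily M a b y → y va = x va → ∀ v, label v = b → y v ≠ 0) ∧
      (b + 1 ≤ n + 2 → ¬ P (b + 1)) := by
    have h := Nat.findGreatest_spec (P := P) (n := n + 2) (ha ▸ ha1) hPa
    refine ⟨_, h.1, Nat.findGreatest_le _, h.2, fun hle => ?_⟩
    exact Nat.findGreatest_is_greatest (Nat.lt_succ_self _) hle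
  -- Maximality of `b`, restated: each family on `a, …, b+1` can be replaced by one with the same
  -- start that ends with zero.
  have hmax' : b + 1 ≤ n + 2 → ∀ y, IsCompatibleFamily M a (b + 1) y →
      ∃ z, IsCompatibleFamily M a (b + 1) z ∧ z va = y va ∧ ∀ v, label v = b + 1 → z v = 0 := by
    intro hle y hy
    by_contra hno
    push Not at hno
    refine hmax hle ⟨by omega, y, hy, fun z hz e v hv hzero => ?_⟩
    obtain ⟨v', hv', hne⟩ := hno z hz e
    obtain rfl : v' = v := label_injective (hv'.trans hv.symm)
    exact hne hzero
  obtain ⟨vb, hb⟩ := exists_label (Q := Q) (m := b) (by omega) hbn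
  obtain ⟨hba, hbb⟩ := between_ends hab ha hb
  -- a vector at `a` that extends to a family which maps to zero beyond `b`, and
  -- which is not congruent to zero
  obtain ⟨x, U, hx, hout, hU, hxU⟩ : ∃ (x : ∀ l, fiber M l) (U : Submodule k (fiber M vb)),
      IsCompatibleFamily M a b x ∧
      (∀ v (h : Q.IsArrow vb v), label v = b + 1 → arrowMap M h (x vb) = 0) ∧
      (∀ v (h : Q.IsArrow v vb), label v = b + 1 → ∀ z, arrowMap M h z ∈ U) ∧
      ∀ y, IsCompatibleFamily M a b y → y va = x va → y vb ∉ U := by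
    by_cases hle : b + 1 ≤ n + 2
    · obtain ⟨v, hv⟩ := exists_label (Q := Q) (m := b + 1) (by omega) hle
      have hv' : ∀ {r : Q.Vertex}, label r = b + 1 → r = v :=
        fun e => label_injective (e.trans hv.symm)
      have hva' : va ≠ v := by rintro rfl; omega
      -- If the edge leaves `b`, extend the family by its image and replace it by one that dies at
      -- `b+1`. If the edge enters `b`, take for `U` its image: a family ending in `U` would extend
      -- to `b+1`, could be modified to be zero there, and would then be zero at `b`, contrary to
      -- the choice of the family.
      rcases isArrow_or (Q := Q) (s := vb) (t := v) (by omega) with h | h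
      · obtain ⟨z, hz, hza, hz0⟩ := hmax' hle _ (hx.update hb hv (arrowMap M h (x vb))
          (fun _ => rfl) (fun h' => (h.asymm h').elim))
        rw [Function.update_of_ne hva'] at hza
        refine ⟨z, ⊥, hz.mono, ?_, ?_, ?_⟩
        · intro v₁ h₁ e
          obtain rfl := hv' e
          rw [hz vb v₁ h₁ ⟨by omega, by omega⟩ ⟨by omega, by omega⟩, hz0 _ hv]
        · intro v₁ h₁ e
          obtain rfl := hv' e
          exact (h.asymm h₁).elim
        · intro y hy e h0
          exact hxK y hy (e.trans hza) vb hb ((Submodule.mem_bot k).1 h0)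
      · refine ⟨x, LinearMap.range (arrowMap M h), hx, ?_, ?_, ?_⟩
        · intro v₁ h₁ e
          obtain rfl := hv' e
          exact (h.asymm h₁).elim
        · intro v₁ h₁ e z
          obtain rfl := hv' e
          exact ⟨z, rfl⟩
        · rintro y hy e ⟨z, hz⟩
          obtain ⟨z', hz', hza, hz0⟩ := hmax' hle _ (hy.update hb hv z
            (fun h' => (h.asymm h').elim) (fun _ => hz))
          rw [Function.update_of_ne hva'] at hza
          refine hxK z' hz'.mono (hza.trans e) vb hb ?_
          rw [← hz' v vb h ⟨by omega, by omega⟩ ⟨by omega, by omega⟩, hz0 v hv, map_zero]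
    · refine ⟨x, ⊥, hx, ?_, ?_, ?_⟩
      · intro v _ e
        have := label_le v
        omega
      · intro v _ e
        have := label_le v
        omega
      · intro y hy e h0
        exact hxK y hy e vb hb ((Submodule.mem_bot k).1 h0)
  obtain ⟨φ, hφ, hφU, hφc⟩ := exists_functionals M hab ha hb U (x va) hxU
  -- The left end is `a - 1` because `γ(i, j)` corresponds to `M(i+1, j)`.
  let γ : Q.Segment := ⟨(⟨a - 1, by omega⟩, ⟨b, by omega⟩), by rw [Fin.lt_def]; simp; omega⟩
  have hγi : (γ.i : ℕ) + 1 = a := by change a - 1 + 1 = a; omega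
  have hγj : (γ.j : ℕ) = b := rfl
  have hγ : Q.segmentRep k γ = Q.intervalRep k a b := by
    unfold segmentRep; rw [hγi, hγj]
  -- Arrows out of the interval cause no trouble: to the left of `a` the representation is zero, and
  -- beyond `b` the family maps to zero.
  let f : Q.intervalRep k a b ⟶ M := ofFamily M a b x hx (by
    intro s t h hs ht
    unfold Between at hs ht
    rcases h.label_cases with ⟨e, -⟩ | ⟨e, -⟩
    · obtain rfl : s = vb := label_injective (by omega)
      exact hout t h (by omega)
    · exact @Subsingleton.elim _ (hmin t (by omega)) _ _)
  let g : M ⟶ Q.intervalRep k a b := ofFunctionals M a b φ hφc (by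
    intro s t h hs ht y
    unfold Between at hs ht
    rcases h.label_cases with ⟨e, -⟩ | ⟨e, -⟩
    · rw [@Subsingleton.elim _ (hmin s (by omega)) y 0, map_zero, map_zero]
    · obtain rfl : t = vb := label_injective (by omega)
      exact hφU _ (hU s h (by omega) y))
  -- At `a` the composition is multiplication by `φ va (x va)`, which is nonzero. Since
  -- endomorphisms are scalars, `g` can be rescaled to a retraction.
  have hfg : f ≫ g ≠ 0 := by
    intro h0
    have h1 : homCoeff (f ≫ g) va = φ va (x va) := by
      unfold homCoeff
      rw [dif_pos hba]
      refine (toLine_of hba _).trans ?_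
      exact congrArg (φ va) (one_smul k (x va))
    rw [h0] at h1
    exact hφ (h1.symm.trans (homCoeff_zero va))
  obtain ⟨r, hr⟩ := Q.intervalRep_end k (a := a) (b := b) (by omega) hab hbn (f ≫ g)
  have hr0 : r ≠ 0 := by
    rintro rfl
    exact hfg (hr.trans (zero_smul k _))
  refine ⟨γ, eqToHom hγ ≫ f, (r⁻¹ • g) ≫ eqToHom hγ.symm, ?_⟩
  have : f ≫ (r⁻¹ • g) = 𝟙 _ := by
    rw [Linear.comp_smul, hr, smul_smul, inv_mul_cancel₀ hr0, one_smul]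
  rw [Category.assoc, ← Category.assoc f, this, Category.id_comp, eqToHom_trans, eqToHom_refl]

/-- The total dimension of a representation. -/
def totalDim (M : Q.Rep k) : ℕ := ∑ m : Fin (n + 2), Module.finrank k (fiber M (Q.vtx m m.isLt))

/-- At every vertex `N` embeds into `M`. At the first vertex of the support of `M_γ` this is not
onto, as `g` vanishes on `N` but not on `M`. -/
theorem totalDim_lt {M N : Q.Rep k} {γ : Q.Segment} (f : Q.segmentRep k γ ⟶ M)
    (g : M ⟶ Q.segmentRep k γ) (hfg : f ≫ g = 𝟙 _) (f' : N ⟶ M) (g' : M ⟶ N)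
    (hfg' : f' ≫ g' = 𝟙 _) (h0 : f' ≫ g = 0) : totalDim N < totalDim M := by
  have hinj : ∀ l : Q.Vertex, Function.Injective (f'.app l).hom.hom := by
    intro l
    refine Function.LeftInverse.injective (g := (g'.app l).hom.hom) fun x => ?_
    exact congrArg (fun h : N ⟶ N => (h.app l).hom.hom x) hfg'
  have hγ := γ.i_lt_j
  rw [Fin.lt_def] at hγ
  have hb := γ.j.isLt
  have hle : ∀ l : Q.Vertex, Module.finrank k (fiber N l) ≤ Module.finrank k (fiber M l) :=
    fun l => LinearMap.finrank_le_finrank_of_injective (hinj l)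
  refine Finset.sum_lt_sum (fun m _ => hle _)
    ⟨⟨γ.i, by omega⟩, Finset.mem_univ _, lt_of_le_of_ne (hle _) fun e => ?_⟩
  let v : Q.Vertex := Q.vtx γ.i (by omega)
  have hsurj : Function.Surjective (f'.app v).hom.hom :=
    (LinearMap.injective_iff_surjective_of_finrank_eq_finrank e).1 (hinj v)
  have hv : Between (γ.i + 1) γ.j v := by
    unfold Between; rw [label_vtx]; omega
  have hg : ∀ y : fiber M v, (g.app v).hom.hom y = 0 := by
    intro y
    obtain ⟨z, rfl⟩ := hsurj y
    exact congrArg (fun h : N ⟶ Q.segmentRep k γ => (h.app v).hom.hom z) h0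
  let one : line k (Between (γ.i + 1) γ.j v) := ⟨1, one_mem_line k hv⟩
  have h1 : one = 0 :=
    (congrArg (fun h : Q.segmentRep k γ ⟶ Q.segmentRep k γ => (h.app v).hom.hom one)
      hfg).symm.trans (hg _)
  exact one_ne_zero (congrArg Subtype.val h1)

/-- A representation with a retract `M_γ` is the direct sum of `M_γ` and a complement. -/
theorem exists_complement {M : Q.Rep k} {γ : Q.Segment} (f : Q.segmentRep k γ ⟶ M)
    (g : M ⟶ Q.segmentRep k γ) (hfg : f ≫ g = 𝟙 _) :
    ∃ N : Q.Rep k, Nonempty (M ≅ Q.segmentRep k γ ⊞ N) := by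
  have : IsSplitMono f := ⟨⟨⟨g, hfg⟩⟩⟩
  exact ⟨_, ⟨(biprod.uniqueUpToIso _ _
    (isBilimitBinaryBiconeOfIsSplitMonoOfCokernel (cokernelIsCokernel f)))⟩⟩

/-- Every representation is a direct sum of representations `M_γ`. -/
theorem rep_induction {P : Q.Rep k → Prop} (iso : ∀ {M N : Q.Rep k}, (M ≅ N) → P M → P N)
    (zero : ∀ M : Q.Rep k, IsZero M → P M)
    (summand : ∀ (γ : Q.Segment) (M : Q.Rep k), P M → P (Q.segmentRep k γ ⊞ M))
    (M : Q.Rep k) : P M := by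
  induction hd : totalDim M using Nat.strong_induction_on generalizing M with
  | _ d ih =>
    by_cases hM : IsZero M
    · exact zero M hM
    obtain ⟨γ, f, g, hfg⟩ := exists_retract M hM
    obtain ⟨N, ⟨e⟩⟩ := exists_complement f g hfg
    refine iso e.symm (summand γ N (ih _ ?_ N rfl))
    rw [← hd]
    exact totalDim_lt (biprod.inl ≫ e.inv) (e.hom ≫ biprod.fst) (by simp) (biprod.inr ≫ e.inv)
      (e.hom ≫ biprod.snd) (by simp) (by simp)

/-- Every indecomposable representation is isomorphic to some `M_γ`. -/
theorem exists_iso_segmentRep {M : Q.Rep k} (hM : Indecomposable M) :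
    ∃ γ : Q.Segment, Nonempty (M ≅ Q.segmentRep k γ) := by
  obtain ⟨γ, f, g, hfg⟩ := exists_retract M hM.1
  obtain ⟨N, ⟨e⟩⟩ := exists_complement f g hfg
  rcases hM.2 _ _ e with h | h
  · exact ((Q.segmentRep_indecomposable k γ).1 h).elim
  · exact ⟨γ, ⟨e ≪≫ (isoBiprodZero h).symm⟩⟩

/-- The identity of a representation is a finite sum of morphisms that factor through
representations `M_γ`. -/
theorem exists_sum_id (M : Q.Rep k) : ∃ (m : ℕ) (γ : Fin m → Q.Segment)
    (p : ∀ i, M ⟶ Q.segmentRep k (γ i)) (q : ∀ i, Q.segmentRep k (γ i) ⟶ M),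
    ∑ i, p i ≫ q i = 𝟙 M := by
  refine rep_induction (P := fun M => ∃ (m : ℕ) (γ : Fin m → Q.Segment)
    (p : ∀ i, M ⟶ Q.segmentRep k (γ i)) (q : ∀ i, Q.segmentRep k (γ i) ⟶ M),
    ∑ i, p i ≫ q i = 𝟙 M) ?_ ?_ ?_ M
  · rintro M N e ⟨m, γ, p, q, h⟩
    refine ⟨m, γ, fun i => e.inv ≫ p i, fun i => q i ≫ e.hom, ?_⟩
    have := congrArg (fun t => e.inv ≫ t ≫ e.hom) h
    simpa [Preadditive.sum_comp, Preadditive.comp_sum] using this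
  · intro M hM
    exact ⟨0, Fin.elim0, fun i => i.elim0, fun i => i.elim0, hM.eq_of_src _ _⟩
  · rintro γ M ⟨m, γ', p, q, h⟩
    refine ⟨m + 1, Fin.cons γ γ', Fin.cons biprod.fst fun i => biprod.snd ≫ p i,
      Fin.cons biprod.inl fun i => q i ≫ biprod.inr, ?_⟩
    rw [Fin.sum_univ_succ]
    have : ∑ i, (biprod.snd ≫ p i) ≫ q i ≫ biprod.inr =
        (biprod.snd ≫ biprod.inr : Q.segmentRep k γ ⊞ M ⟶ Q.segmentRep k γ ⊞ M) := by
      have := congrArg (fun t => (biprod.snd : Q.segmentRep k γ ⊞ M ⟶ M) ≫ t ≫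
        (biprod.inr : M ⟶ Q.segmentRep k γ ⊞ M)) h
      simpa [Preadditive.sum_comp, Preadditive.comp_sum] using this
    exact (congrArg (fun t => biprod.fst ≫ biprod.inl + t) this).trans biprod.total

end Decomposition

end TypeA

namespace TransQuiver

/-! ### Paths and relations in a mesh category -/

section

variable (k : Type u) [Field k] {V : Type w} [Quiver.{v} V] [Fintype V]
  [∀ x y : V, Fintype (x ⟶ y)] (τ : V → Option V)

/-- A path, as a morphism of the mesh category. -/
def meshPath {x y : V} (p : Quiver.Path x y) : meshObj k τ x ⟶ meshObj k τ y :=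
  (CategoryTheory.Quotient.functor (meshRel k τ)).map
    (ofPath k (X := pathObj k x) (Y := pathObj k y) p)

theorem meshPath_nil (x : V) : meshPath k τ (Quiver.Path.nil : Quiver.Path x x) = 𝟙 _ :=
  (CategoryTheory.Quotient.functor (meshRel k τ)).map_id (pathObj k x)

theorem meshPath_cons {x y z : V} (p : Quiver.Path x y) (α : y ⟶ z) :
    meshPath k τ (p.cons α) = meshPath k τ p ≫ meshArrow k τ α := by
  refine Eq.trans ?_ ((CategoryTheory.Quotient.functor (meshRel k τ)).map_comp _ _)
  exact congrArg (CategoryTheory.Quotient.functor (meshRel k τ)).map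
    (ofPath_comp k (X := pathObj k x) (Y := pathObj k y) (Z := pathObj k z) p α.toPath).symm

theorem mesh_induction {x y : V} {P : (meshObj k τ x ⟶ meshObj k τ y) → Prop}
    (f : meshObj k τ x ⟶ meshObj k τ y) (h0 : P 0) (hadd : ∀ f g, P f → P g → P (f + g))
    (hsmul : ∀ (r : k) (p : Quiver.Path x y), P (r • meshPath k τ p)) : P f := by
  obtain ⟨f, rfl⟩ := (CategoryTheory.Quotient.functor (meshRel k τ)).map_surjective f
  refine pathCategory_induction k
    (P := fun f => P ((CategoryTheory.Quotient.functor (meshRel k τ)).map f)) f ?_ ?_ ?_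
  · rw [Functor.map_zero]; exact h0
  · intro f g hf hg
    rw [Functor.map_add]; exact hadd _ _ hf hg
  · intro r p
    rw [Functor.map_smul]; exact hsmul r p

theorem mesh_relation {x z : V} (h : τ x = some z) :
    ∑ y : V, ∑ β : z ⟶ y, ∑ α : y ⟶ x, meshArrow k τ β ≫ meshArrow k τ α = 0 := by
  have h1 : (CategoryTheory.Quotient.functor (meshRel k τ)).map (meshRelator k z x) = 0 := by
    rw [← (CategoryTheory.Quotient.functor (meshRel k τ)).map_zero]
    apply CategoryTheory.Quotient.sound
    refine Submodule.subset_span ⟨x, z, h, 𝟙 _, 𝟙 _, ?_⟩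
    rw [Category.id_comp, Category.comp_id, sub_zero]
  refine Eq.trans ?_ h1
  simp only [meshRelator, Functor.map_sum, Functor.map_comp]
  rfl

end

end TransQuiver

namespace TypeA

open TransQuiver

/-! ### The category of line segments and the equivalence -/

section SegmentCategory

variable {n : ℕ} {Q : TypeA n} {k : Type u} [Field k] {γ δ ε : Q.Segment}

theorem mesh_middle {y : Q.Segment} (h : Q.rotation δ = some ε) (β : ε ⟶ y) :
    (y.i = δ.i ∧ y.j = ε.j) ∨ (y.i = ε.i ∧ y.j = δ.j) := by
  obtain ⟨hi, hj⟩ := Q.rotation_eq_some h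
  rcases β.down with ⟨h1, h2⟩ | ⟨h1, h2⟩
  · left; rw [h1, hi, Equiv.symm_apply_apply]; exact ⟨rfl, h2⟩
  · right; rw [h2, hj, Equiv.symm_apply_apply]; exact ⟨h1, rfl⟩

/-- The composition of two pivots in a mesh is zero or the negative of the other composition. -/
theorem mesh_swap (h : Q.rotation δ = some ε) {y : Q.Segment} (β : ε ⟶ y) (α : y ⟶ δ) :
    Q.pivot k β ≫ Q.pivot k α = 0 ∨ ∃ (y' : Q.Segment) (β' : ε ⟶ y') (α' : y' ⟶ δ), y ≠ y' ∧
      Q.pivot k β ≫ Q.pivot k α = - (Q.pivot k β' ≫ Q.pivot k α') := by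
  have hm := mesh_relation k Q.rotation h
  -- A mesh has one or two middle terms: with a second one the relation has two summands, otherwise
  -- it says that the composition is zero.
  by_cases hex : ∃ (y' : Q.Segment), Nonempty (ε ⟶ y') ∧ y ≠ y'
  · obtain ⟨y', ⟨β'⟩, hne⟩ := hex
    obtain ⟨α'⟩ := (pivot_of_rotation h).2 ⟨β'⟩
    refine Or.inr ⟨y', β', α', hne, ?_⟩
    rw [Fintype.sum_eq_add y y' hne, Fintype.sum_subsingleton _ β, Fintype.sum_subsingleton _ α,
      Fintype.sum_subsingleton _ β', Fintype.sum_subsingleton _ α'] at hm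
    · exact eq_neg_of_add_eq_zero_left hm
    · rintro z ⟨h1, h2⟩
      refine Finset.sum_eq_zero fun β'' _ => ?_
      rcases mesh_middle h β with a | a <;> rcases mesh_middle h β' with b | b <;>
        rcases mesh_middle h β'' with c | c
      · exact (h1 (Segment.ext (c.1.trans a.1.symm) (c.2.trans a.2.symm))).elim
      · exact (hne (Segment.ext (a.1.trans b.1.symm) (a.2.trans b.2.symm))).elim
      · exact (h1 (Segment.ext (c.1.trans a.1.symm) (c.2.trans a.2.symm))).elim
      · exact (h2 (Segment.ext (c.1.trans b.1.symm) (c.2.trans b.2.symm))).elim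
      · exact (h2 (Segment.ext (c.1.trans b.1.symm) (c.2.trans b.2.symm))).elim
      · exact (h1 (Segment.ext (c.1.trans a.1.symm) (c.2.trans a.2.symm))).elim
      · exact (hne (Segment.ext (a.1.trans b.1.symm) (a.2.trans b.2.symm))).elim
      · exact (h1 (Segment.ext (c.1.trans a.1.symm) (c.2.trans a.2.symm))).elim
  · left
    rw [Fintype.sum_eq_single y, Fintype.sum_subsingleton _ β, Fintype.sum_subsingleton _ α] at hm
    · exact hm
    · intro y' hne
      exact Finset.sum_eq_zero fun β' _ => (hex ⟨y', ⟨β'⟩, hne.symm⟩).elim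

theorem path_pos (p : Quiver.Path γ δ) :
    Q.posL γ.i ≤ Q.posL δ.i ∧ Q.posR γ.j ≤ Q.posR δ.j := by
  induction p with
  | nil => exact ⟨le_rfl, le_rfl⟩
  | cons p α ih => exact ⟨ih.1.trans (pivot_posL α), ih.2.trans (pivot_posR α)⟩

theorem HomLE.nonempty_path (h : Q.HomLE γ δ) : Nonempty (Quiver.Path γ δ) := by
  induction hr : Q.posL δ.i + Q.posR δ.j using Nat.strong_induction_on generalizing δ with
  | _ r ih =>
    by_cases hne : γ = δ
    · subst hne; exact ⟨Quiver.Path.nil⟩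
    · obtain ⟨ε, ⟨α⟩, h1, -⟩ := h.exists_pivot_to hne
      obtain ⟨p⟩ := ih _ (hr ▸ pivot_rank α) h1 rfl
      exact ⟨p.cons α⟩

/-- In the mesh category, all paths from `γ` to `δ` are proportional, and they vanish unless
there is a nonzero morphism `M_γ ⟶ M_δ`. -/
theorem meshPath_unique (γ δ : Q.Segment) :
    (¬ Q.HomLE γ δ → ∀ p : Quiver.Path γ δ, meshPath k Q.rotation p = 0) ∧
    ∀ p q : Quiver.Path γ δ, ∃ r : k,
      meshPath k Q.rotation p = r • meshPath k Q.rotation q := by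
  induction hr : Q.posL δ.i + Q.posR δ.j using Nat.strong_induction_on generalizing δ with
  | _ r ih =>
    subst hr
    have hvanish : ¬ Q.HomLE γ δ → ∀ p : Quiver.Path γ δ, meshPath k Q.rotation p = 0 := by
      intro hn p
      cases p with
      | nil => exact (hn (HomLE.refl _)).elim
      | @cons δ₁ _ p α =>
        rw [meshPath_cons]
        -- If `HomLE γ δ₁` holds but `HomLE γ δ` fails, the last arrow is the second half of a mesh
        -- that starts at some `ε` with `HomLE γ ε`. Rerouting the path through `ε`, the mesh
        -- relation gives zero or passes through the other middle term; that term is not reached by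
        -- `HomLE` from `γ`, so induction applies.
        by_cases h1 : Q.HomLE γ δ₁
        · obtain ⟨ε, hε, hγε⟩ := h1.exists_mesh_of_not α hn
          obtain ⟨β⟩ := (pivot_of_rotation hε).1 ⟨α⟩
          obtain ⟨q⟩ := hγε.nonempty_path
          obtain ⟨r, hp⟩ := (ih _ (pivot_rank α) δ₁ rfl).2 p (q.cons β)
          rw [hp, meshPath_cons, Linear.smul_comp, Category.assoc]
          rcases mesh_swap (k := k) hε β α with h0 | ⟨δ₂, β', α', hne, hs⟩
          · rw [h0, comp_zero, smul_zero]
          · rw [hs, Preadditive.comp_neg, ← Category.assoc, ← meshPath_cons,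
              (ih _ (pivot_rank α') δ₂ rfl).1 fun h2 => hn (h1.of_pivots h2 α α' hne)]
            rw [zero_comp, neg_zero, smul_zero]
        · rw [(ih _ (pivot_rank α) δ₁ rfl).1 h1, zero_comp]
    refine ⟨hvanish, fun p q => ?_⟩
    by_cases h : Q.HomLE γ δ
    · cases p with
      | nil =>
        cases q with
        | nil => exact ⟨1, (one_smul k _).symm⟩
        | cons q β =>
          -- A nontrivial path increases the sum of positions, so it cannot return to its start.
          have h1 := path_pos q
          have h2 := pivot_rank β
          omega
      | @cons δ₁ _ p α =>
        cases q with
        | nil =>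
          have h1 := path_pos p
          have h2 := pivot_rank α
          omega
        | @cons δ₂ _ q β =>
          by_cases hne : δ₁ = δ₂
          · subst hne
            obtain ⟨r, hr⟩ := (ih _ (pivot_rank α) δ₁ rfl).2 p q
            refine ⟨r, ?_⟩
            rw [meshPath_cons, meshPath_cons, hr, Subsingleton.elim α β, Linear.smul_comp]
          -- Different last pivots belong to one mesh. By induction `p` is proportional to a path
          -- through its start `ε`; the mesh relation turns this into a path through `δ₂`, which is
          -- compared with `q` by induction.
          · obtain ⟨ε, hε, hγε⟩ := h.exists_mesh α β hne (path_pos p) (path_pos q)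
            obtain ⟨α'⟩ := (pivot_of_rotation hε).1 ⟨α⟩
            obtain ⟨s⟩ := hγε.nonempty_path
            obtain ⟨r, hp⟩ := (ih _ (pivot_rank α) δ₁ rfl).2 p (s.cons α')
            rw [meshPath_cons, hp, meshPath_cons, Linear.smul_comp, Category.assoc]
            rcases mesh_swap (k := k) hε α' α with h0 | ⟨y, β', β'', hne', hs⟩
            · exact ⟨0, by rw [h0, comp_zero, smul_zero, zero_smul]⟩
            · have hy : y = δ₂ := by
                obtain ⟨b⟩ := (pivot_of_rotation hε).1 ⟨β⟩
                rcases mesh_middle hε α' with a | a <;> rcases mesh_middle hε β' with c | c <;>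
                  rcases mesh_middle hε b with d | d
                all_goals first
                  | exact Segment.ext (c.1.trans d.1.symm) (c.2.trans d.2.symm)
                  | exact (hne (Segment.ext (a.1.trans d.1.symm) (a.2.trans d.2.symm))).elim
                  | exact (hne' (Segment.ext (a.1.trans c.1.symm) (a.2.trans c.2.symm))).elim
              subst hy
              obtain ⟨r', hq⟩ := (ih _ (pivot_rank β) y rfl).2 (s.cons β') q
              refine ⟨- (r * r'), ?_⟩
              rw [hs, Preadditive.comp_neg, ← Category.assoc, ← meshPath_cons, hq,
                meshPath_cons, Subsingleton.elim β'' β, Linear.smul_comp, smul_neg, smul_smul,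
                neg_smul]
    · exact ⟨0, by rw [hvanish h p, zero_smul]⟩

/-- A morphism of the category of line segments is a multiple of any given path. -/
theorem eq_smul_meshPath (q : Quiver.Path γ δ) (f : Q.seg k γ ⟶ Q.seg k δ) :
    ∃ r : k, f = r • meshPath k Q.rotation q := by
  refine mesh_induction k Q.rotation (P := fun f => ∃ r : k, f = r • meshPath k Q.rotation q) f
    ⟨0, (zero_smul k _).symm⟩ ?_ ?_
  · rintro f g ⟨r, rfl⟩ ⟨s, rfl⟩
    exact ⟨r + s, (add_smul r s _).symm⟩
  · intro r p
    obtain ⟨s, hs⟩ := (meshPath_unique (k := k) γ δ).2 p q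
    exact ⟨r * s, by rw [hs, smul_smul]⟩

theorem eq_zero_of_not_homLE (h : ¬ Q.HomLE γ δ) (f : Q.seg k γ ⟶ Q.seg k δ) : f = 0 := by
  refine mesh_induction k Q.rotation (P := fun f => f = 0) f rfl ?_ ?_
  · rintro f g rfl rfl
    exact add_zero 0
  · intro r p
    rw [(meshPath_unique (k := k) γ δ).1 h p, smul_zero]

/-- The morphism of representations given by a morphism of line segments. -/
def segHom (c : Q.PivotScalars k) (f : Q.seg k γ ⟶ Q.seg k δ) :
    Q.segmentRep k γ ⟶ Q.segmentRep k δ := ((segmentFunctor c).map f).hom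

theorem segHom_id (c : Q.PivotScalars k) : segHom c (𝟙 (Q.seg k γ)) = 𝟙 _ :=
  congrArg InducedCategory.Hom.hom ((segmentFunctor c).map_id (Q.seg k γ))

theorem segHom_comp (c : Q.PivotScalars k) (f : Q.seg k γ ⟶ Q.seg k δ)
    (g : Q.seg k δ ⟶ Q.seg k ε) : segHom c (f ≫ g) = segHom c f ≫ segHom c g :=
  congrArg InducedCategory.Hom.hom ((segmentFunctor c).map_comp f g)

theorem segHom_smul (c : Q.PivotScalars k) (r : k) (f : Q.seg k γ ⟶ Q.seg k δ) :
    segHom c (r • f) = r • segHom c f :=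
  congrArg InducedCategory.Hom.hom ((segmentFunctor c).map_smul r f)

theorem segHom_zero (c : Q.PivotScalars k) : segHom c (0 : Q.seg k γ ⟶ Q.seg k δ) = 0 :=
  congrArg InducedCategory.Hom.hom ((segmentFunctor c).map_zero (Q.seg k γ) (Q.seg k δ))

theorem segHom_pivot (c : Q.PivotScalars k) (p : γ ⟶ δ) :
    segHom c (Q.pivot k p) = (c.coeff p : k) • segMap k (pivot_homLE p) :=
  segmentFunctor_map c p

/-- Pivots go to nonzero multiples of canonical maps, and canonical maps compose to canonical maps.
Only the scalar is claimed to be nonzero; the canonical map itself may vanish. -/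
theorem segHom_meshPath (c : Q.PivotScalars k) (p : Quiver.Path γ δ) :
    ∃ r : k, r ≠ 0 ∧ segHom c (meshPath k Q.rotation p) =
      r • posMap k (path_pos p) := by
  induction p with
  | nil =>
    refine ⟨1, one_ne_zero, ?_⟩
    rw [meshPath_nil, segHom_id, one_smul]
    exact (segMap_refl k).symm
  | cons p α ih =>
    obtain ⟨r, hr, h⟩ := ih
    refine ⟨r * c.coeff α, mul_ne_zero hr (c.coeff α).ne_zero, ?_⟩
    rw [meshPath_cons, segHom_comp, h, segHom_pivot, Linear.smul_comp, Linear.comp_smul,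
      smul_smul, posMap_comp]

/-- If `HomLE γ δ` holds, the source is spanned by a path whose image is nonzero; otherwise the
source is zero. -/
theorem segHom_injective (c : Q.PivotScalars k) (f : Q.seg k γ ⟶ Q.seg k δ)
    (hf : segHom c f = 0) : f = 0 := by
  by_cases h : Q.HomLE γ δ
  · obtain ⟨q⟩ := h.nonempty_path
    obtain ⟨r, rfl⟩ := eq_smul_meshPath q f
    obtain ⟨s, hs, hq⟩ := segHom_meshPath c q
    rw [segHom_smul, hq, smul_smul, smul_eq_zero, or_iff_left (segMap_ne_zero k h), mul_eq_zero,
      or_iff_left hs] at hf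
    rw [hf, zero_smul]
  · exact eq_zero_of_not_homLE h f

theorem segHom_surjective (c : Q.PivotScalars k) (f : Q.segmentRep k γ ⟶ Q.segmentRep k δ) :
    ∃ g : Q.seg k γ ⟶ Q.seg k δ, segHom c g = f := by
  by_cases hf : f = 0
  · exact ⟨0, by rw [segHom_zero, hf]⟩
  · have h := homLE_of_ne_zero hf
    obtain ⟨q⟩ := h.nonempty_path
    obtain ⟨s, hs, hq⟩ := segHom_meshPath c q
    obtain ⟨r, rfl⟩ := eq_smul_segMap h f
    refine ⟨(r * s⁻¹) • meshPath k Q.rotation q, ?_⟩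
    rw [segHom_smul, hq, smul_smul, mul_assoc, inv_mul_cancel₀ hs, mul_one]

instance segmentFunctor_faithful (c : Q.PivotScalars k) : (segmentFunctor c).Faithful where
  map_injective {X Y} f g h := by
    refine sub_eq_zero.1 (segHom_injective (γ := pathVertex k X.as)
      (δ := pathVertex k Y.as) c (f - g) ?_)
    exact congrArg InducedCategory.Hom.hom (((segmentFunctor c).map_sub).trans (sub_eq_zero.2 h))

instance segmentFunctor_full (c : Q.PivotScalars k) : (segmentFunctor c).Full where
  map_surjective {X Y} f := by
    obtain ⟨g, hg⟩ := segHom_surjective (γ := pathVertex k X.as)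
      (δ := pathVertex k Y.as) c f.hom
    exact ⟨g, ObjectProperty.hom_ext _ hg⟩

instance segmentFunctor_essSurj (c : Q.PivotScalars k) : (segmentFunctor c).EssSurj where
  mem_essImage M := by
    obtain ⟨γ, ⟨e⟩⟩ := exists_iso_segmentRep M.property
    exact ⟨Q.seg k γ, ⟨ObjectProperty.isoMk _ e.symm⟩⟩

instance segmentFunctor_isEquivalence (c : Q.PivotScalars k) :
    (segmentFunctor c).IsEquivalence where

end SegmentCategory

end TypeA

namespace AuslanderReiten

/-! ### Irreducible morphisms and the radical in general -/

section

variable {C : Type w} [Category.{v} C]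

theorem IsIrreducible.conj {X Y X' Y' : C} {f : X ⟶ Y} (hf : IsIrreducible f) (e : X' ≅ X)
    (e' : Y ≅ Y') : IsIrreducible (e.hom ≫ f ≫ e'.hom) where
  not_section := by
    rintro ⟨⟨r, hr⟩⟩
    refine hf.not_section ⟨⟨⟨e'.hom ≫ r ≫ e.hom, ?_⟩⟩⟩
    simpa using congrArg (fun t => e.inv ≫ t ≫ e.hom) hr
  not_retraction := by
    rintro ⟨⟨r, hr⟩⟩
    refine hf.not_retraction ⟨⟨⟨e'.hom ≫ r ≫ e.hom, ?_⟩⟩⟩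
    simpa using congrArg (fun t => e'.hom ≫ t ≫ e'.inv) hr
  factor Z g h hgh := by
    have : (e.inv ≫ g) ≫ (h ≫ e'.inv) = f := by
      simpa using congrArg (fun t => e.inv ≫ t ≫ e'.inv) hgh
    rcases hf.factor Z _ _ this with ⟨⟨r, hr⟩⟩ | ⟨⟨r, hr⟩⟩
    · left
      refine ⟨⟨⟨r ≫ e.inv, ?_⟩⟩⟩
      simpa using congrArg (fun t => e.hom ≫ t ≫ e.inv) hr
    · right
      refine ⟨⟨⟨e'.inv ≫ r, ?_⟩⟩⟩
      simpa using congrArg (fun t => e'.inv ≫ t ≫ e'.hom) hr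

variable [Preadditive C]

/-- The familiar identity `(1 - gf)⁻¹ = 1 + g (1 - fg)⁻¹ f`. It shows that the definition of the
radical is symmetric in source and target. -/
theorem isIso_one_sub_comp_comm {X Y : C} (f : X ⟶ Y) (g : Y ⟶ X) (h : IsIso (𝟙 X - f ≫ g)) :
    IsIso (𝟙 Y - g ≫ f) := by
  obtain ⟨r, h1, h2⟩ := h
  have e1 : f ≫ g ≫ r = r - 𝟙 X := by
    rw [Preadditive.sub_comp, Category.id_comp, Category.assoc, sub_eq_iff_eq_add] at h1
    rw [eq_sub_iff_add_eq, add_comm, ← h1]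
  have e2 : r ≫ f ≫ g = r - 𝟙 X := by
    rw [Preadditive.comp_sub, Category.comp_id, sub_eq_iff_eq_add] at h2
    rw [eq_sub_iff_add_eq, add_comm, ← h2]
  refine ⟨𝟙 Y + g ≫ r ≫ f, ?_, ?_⟩
  · have : g ≫ f ≫ g ≫ r ≫ f = g ≫ (f ≫ g ≫ r) ≫ f := by simp only [Category.assoc]
    simp only [Preadditive.sub_comp, Preadditive.comp_add, Category.id_comp, Category.comp_id,
      Category.assoc]
    rw [this, e1]
    simp only [Preadditive.sub_comp, Preadditive.comp_sub, Category.id_comp]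
    abel
  · have : g ≫ r ≫ f ≫ g ≫ f = g ≫ (r ≫ f ≫ g) ≫ f := by simp only [Category.assoc]
    simp only [Preadditive.add_comp, Preadditive.comp_sub, Category.id_comp, Category.comp_id,
      Category.assoc]
    rw [this, e2]
    simp only [Preadditive.sub_comp, Preadditive.comp_sub, Category.id_comp]
    abel

variable (k : Type u) [Field k] [Linear k C]

theorem comp_mem_radical {X Y Z : C} {f : X ⟶ Y} (hf : f ∈ radical k X Y) (h : Y ⟶ Z) :
    f ≫ h ∈ radical k X Z := by
  have : radical k X Y ≤ (radical k X Z).comap (Linear.rightComp k X h) := by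
    refine Submodule.span_le.2 fun f hf => Submodule.subset_span fun g => ?_
    have := hf (h ≫ g)
    rwa [← Category.assoc] at this
  exact this hf

theorem comp_mem_radical' {X Y Z : C} (h : Z ⟶ X) {f : X ⟶ Y} (hf : f ∈ radical k X Y) :
    h ≫ f ∈ radical k Z Y := by
  have : radical k X Y ≤ (radical k Z Y).comap (Linear.leftComp k Y h) := by
    refine Submodule.span_le.2 fun f hf => Submodule.subset_span fun g => ?_
    have := hf (g ≫ h)
    rw [← Category.assoc] at this
    have := isIso_one_sub_comp_comm _ _ this
    rwa [← Category.assoc] at this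
  exact this hf

theorem conj_mem_radicalSq {X Y X' Y' : C} (a : X' ⟶ X) (b : Y ⟶ Y') {f : X ⟶ Y}
    (hf : f ∈ radicalSq k X Y) : a ≫ f ≫ b ∈ radicalSq k X' Y' := by
  have : radicalSq k X Y ≤
      (radicalSq k X' Y').comap ((Linear.leftComp k Y' a).comp (Linear.rightComp k X b)) := by
    refine Submodule.span_le.2 ?_
    rintro _ ⟨Z, f, g, hf, hg, rfl⟩
    refine Submodule.subset_span ⟨Z, a ≫ f, g ≫ b, comp_mem_radical' k a hf,
      comp_mem_radical k hg b, ?_⟩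
    change a ≫ (f ≫ g) ≫ b = _
    simp only [Category.assoc]
  exact this hf

/-- The space of irreducible morphisms depends only on the isomorphism classes. -/
def irrCongr {X Y X' Y' : C} (e : X ≅ X') (e' : Y ≅ Y') : Irr k X Y ≃ₗ[k] Irr k X' Y' :=
  Submodule.Quotient.equiv _ _ ((Linear.homCongr k e e').ofSubmodules (radical k X Y)
      (radical k X' Y') (by
    refine le_antisymm ?_ fun f hf => ⟨e.hom ≫ f ≫ e'.inv,
      comp_mem_radical' k _ (comp_mem_radical k hf _), ?_⟩
    · rintro _ ⟨f, hf, rfl⟩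
      exact comp_mem_radical k (comp_mem_radical' k _ hf) _
    · simp [Linear.homCongr_apply])) (by
    refine le_antisymm ?_ fun f hf => ?_
    · rintro _ ⟨f, hf, rfl⟩
      have := conj_mem_radicalSq k e.inv e'.hom hf
      rw [← Category.assoc] at this
      exact this
    · refine ⟨⟨e.hom ≫ f.1 ≫ e'.inv, comp_mem_radical' k _ (comp_mem_radical k f.2 _)⟩,
        conj_mem_radicalSq k e.hom e'.inv hf, Subtype.ext ?_⟩
      change (Linear.homCongr k e e') (e.hom ≫ f.1 ≫ e'.inv) = f.1
      simp [Linear.homCongr_apply])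

/-- Multiplication by a nonzero scalar. -/
def smulIso (X : C) {r : k} (hr : r ≠ 0) : X ≅ X where
  hom := r • 𝟙 X
  inv := r⁻¹ • 𝟙 X
  hom_inv_id := by simp [smul_smul, hr]
  inv_hom_id := by simp [smul_smul, hr]

end

end AuslanderReiten

namespace TypeA

open AuslanderReiten TransQuiver

/-! ### The radical of `rep Q` and irreducible morphisms -/

section Radical

variable {n : ℕ} {Q : TypeA n} {k : Type u} [Field k] {γ δ ε : Q.Segment}

/-- The composition is a scalar, and an invertible scalar would yield a retraction of `f`. -/
theorem comp_eq_zero_of_not_isSplitMono {Z : Q.Rep k} (f : Q.segmentRep k γ ⟶ Z)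
    (hf : ¬ IsSplitMono f) (g : Z ⟶ Q.segmentRep k γ) : f ≫ g = 0 := by
  obtain ⟨r, hr⟩ := segmentRep_end (f ≫ g)
  by_cases h : r = 0
  · rw [hr, h, zero_smul]
  · refine (hf ⟨⟨⟨r⁻¹ • g, ?_⟩⟩⟩).elim
    rw [Linear.comp_smul, hr, smul_smul, inv_mul_cancel₀ h, one_smul]

theorem comp_eq_zero_of_not_isSplitEpi {Z : Q.Rep k} (f : Z ⟶ Q.segmentRep k γ)
    (hf : ¬ IsSplitEpi f) (g : Q.segmentRep k γ ⟶ Z) : g ≫ f = 0 := by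
  obtain ⟨r, hr⟩ := segmentRep_end (g ≫ f)
  by_cases h : r = 0
  · rw [hr, h, zero_smul]
  · refine (hf ⟨⟨⟨r⁻¹ • g, ?_⟩⟩⟩).elim
    rw [Linear.smul_comp, hr, smul_smul, inv_mul_cancel₀ h, one_smul]

theorem mem_radical_left {Z : Q.Rep k} {f : Q.segmentRep k γ ⟶ Z} (hf : ¬ IsSplitMono f) :
    f ∈ radical k (Q.segmentRep k γ) Z := by
  refine Submodule.subset_span fun g => ?_
  rw [comp_eq_zero_of_not_isSplitMono f hf g, sub_zero]
  infer_instance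

theorem mem_radical_right {Z : Q.Rep k} {f : Z ⟶ Q.segmentRep k γ} (hf : ¬ IsSplitEpi f) :
    f ∈ radical k Z (Q.segmentRep k γ) := by
  refine Submodule.subset_span fun g => isIso_one_sub_comp_comm _ _ ?_
  rw [comp_eq_zero_of_not_isSplitEpi f hf g, sub_zero]
  infer_instance

theorem not_isSplitMono_of_ne (hne : γ ≠ δ) (f : Q.segmentRep k γ ⟶ Q.segmentRep k δ) :
    ¬ IsSplitMono f := fun _ =>
  hne (eq_of_retract (f := f) (g := retraction f) (by
    rw [IsSplitMono.id]; exact segmentRep_id_ne_zero))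

theorem not_isSplitEpi_of_ne (hne : γ ≠ δ) (f : Q.segmentRep k γ ⟶ Q.segmentRep k δ) :
    ¬ IsSplitEpi f := fun _ =>
  hne (eq_of_retract (f := section_ f) (g := f) (by
    rw [IsSplitEpi.id]; exact segmentRep_id_ne_zero)).symm

theorem mem_radical_of_ne (hne : γ ≠ δ) (f : Q.segmentRep k γ ⟶ Q.segmentRep k δ) :
    f ∈ radical k (Q.segmentRep k γ) (Q.segmentRep k δ) :=
  mem_radical_left (not_isSplitMono_of_ne hne f)

/-- A nonzero scalar in the generating set would make `1 - 1 = 0` an isomorphism of a nonzero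
object. -/
theorem radical_self : radical k (Q.segmentRep k γ) (Q.segmentRep k γ) = ⊥ := by
  refine le_bot_iff.1 (Submodule.span_le.2 fun f hf => ?_)
  obtain ⟨r, rfl⟩ := segmentRep_end f
  by_cases h : r = 0
  · rw [h, zero_smul]; exact Submodule.zero_mem _
  · have := hf (r⁻¹ • 𝟙 _)
    rw [Linear.comp_smul, Category.comp_id, smul_smul, inv_mul_cancel₀ h, one_smul, sub_self]
      at this
    have h0 := IsIso.hom_inv_id (0 : Q.segmentRep k γ ⟶ Q.segmentRep k γ)
    rw [zero_comp] at h0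
    exact (segmentRep_id_ne_zero h0.symm).elim

theorem ne_of_mem_radical {f : Q.segmentRep k γ ⟶ Q.segmentRep k δ}
    (hf : f ∈ radical k (Q.segmentRep k γ) (Q.segmentRep k δ)) (h0 : f ≠ 0) : γ ≠ δ := by
  rintro rfl
  rw [radical_self] at hf
  exact h0 ((Submodule.mem_bot k).1 hf)

/-- Decompose the identity of `Z` through interval modules `M_ε`. A nonzero summand would put `ε`
between the ends of a pivot, hence equal to one of them, but radical endomorphisms of interval
modules are zero. -/
theorem comp_eq_zero_of_pivot (p : γ ⟶ δ) {Z : Q.Rep k} {f : Q.segmentRep k γ ⟶ Z}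
    {g : Z ⟶ Q.segmentRep k δ} (hf : f ∈ radical k _ _) (hg : g ∈ radical k _ _) :
    f ≫ g = 0 := by
  obtain ⟨m, ε, a, b, hab⟩ := exists_sum_id Z
  have h : f ≫ g = ∑ i, (f ≫ a i) ≫ b i ≫ g := by
    have := congrArg (fun t => f ≫ t ≫ g) hab
    simp only [Category.id_comp, Preadditive.comp_sum, Preadditive.sum_comp] at this
    rw [← this]
    simp only [Category.assoc]
  rw [h]
  refine Finset.sum_eq_zero fun i _ => ?_
  by_contra hne
  have h1 : f ≫ a i ≠ 0 := fun e => hne (by rw [e, zero_comp])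
  have h2 : b i ≫ g ≠ 0 := fun e => hne (by rw [e, comp_zero])
  rcases pivot_minimal p (homLE_of_ne_zero h1) (homLE_of_ne_zero h2) with e | e
  · exact ne_of_mem_radical (comp_mem_radical k hf (a i)) h1 e.symm
  · exact ne_of_mem_radical (comp_mem_radical' k (b i) hg) h2 e

theorem radicalSq_eq_bot (p : γ ⟶ δ) :
    radicalSq k (Q.segmentRep k γ) (Q.segmentRep k δ) = ⊥ := by
  refine le_bot_iff.1 (Submodule.span_le.2 ?_)
  rintro _ ⟨Z, f, g, hf, hg, rfl⟩
  rw [comp_eq_zero_of_pivot p hf hg]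
  exact Submodule.zero_mem _

/-- A radical morphism that is not a multiple of a pivot factors properly. -/
theorem exists_factor (h : IsEmpty (γ ⟶ δ)) (hne : γ ≠ δ)
    (f : Q.segmentRep k γ ⟶ Q.segmentRep k δ) : f = 0 ∨
    ∃ (ε : Q.Segment) (g : Q.segmentRep k γ ⟶ Q.segmentRep k ε)
      (g' : Q.segmentRep k ε ⟶ Q.segmentRep k δ), γ ≠ ε ∧ ε ≠ δ ∧ g ≫ g' = f := by
  by_cases hf : f = 0
  · exact Or.inl hf
  have hle := homLE_of_ne_zero hf
  obtain ⟨r, rfl⟩ := eq_smul_segMap hle f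
  obtain ⟨ε, ⟨p⟩, h1, h2⟩ := hle.exists_pivot_from hne
  refine Or.inr ⟨ε, segMap k h1, r • segMap k h2, pivot_ne p, ?_, ?_⟩
  · rintro rfl
    exact h.false p
  · rw [Linear.comp_smul, segMap_comp k h1 h2 hle]

theorem radical_le_radicalSq (h : IsEmpty (γ ⟶ δ)) :
    radical k (Q.segmentRep k γ) (Q.segmentRep k δ) ≤ radicalSq k _ _ := by
  intro f hf
  by_cases h0 : f = 0
  · rw [h0]; exact Submodule.zero_mem _
  rcases exists_factor h (ne_of_mem_radical hf h0) f with h1 | ⟨ε, g, g', h1, h2, rfl⟩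
  · exact (h0 h1).elim
  · exact Submodule.subset_span ⟨_, g, g', mem_radical_of_ne h1 g, mem_radical_of_ne h2 g', rfl⟩

theorem segHom_pivot_ne_zero (c : Q.PivotScalars k) (p : γ ⟶ δ) :
    segHom c (Q.pivot k p) ≠ 0 := by
  rw [segHom_pivot]
  exact smul_ne_zero (c.coeff p).ne_zero (segMap_ne_zero k _)

/-- If there is a pivot, the radical is the line spanned by its image and the square of the radical
is zero. If there is none, the radical equals its square and the quotient is zero. -/
theorem exists_irr_basis (c : Q.PivotScalars k) (γ δ : Q.Segment) :
    ∃ b : Module.Basis (γ ⟶ δ) k (Irr k (Q.segmentRep k γ) (Q.segmentRep k δ)),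
      ∀ p : γ ⟶ δ, ∃ hp : segHom c (Q.pivot k p) ∈ radical k _ _,
        b p = Submodule.Quotient.mk ⟨segHom c (Q.pivot k p), hp⟩ := by
  let v : (γ ⟶ δ) → Irr k (Q.segmentRep k γ) (Q.segmentRep k δ) := fun p =>
    Submodule.Quotient.mk ⟨segHom c (Q.pivot k p), mem_radical_of_ne (pivot_ne p) _⟩
  have hli : LinearIndependent k v := by
    by_cases h : Nonempty (γ ⟶ δ)
    · obtain ⟨p⟩ := h
      refine LinearIndependent.of_subsingleton p fun h0 => ?_
      have h1 := (Submodule.Quotient.mk_eq_zero _).1 h0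
      have h2 : segHom c (Q.pivot k p) ∈ radicalSq k (Q.segmentRep k γ) (Q.segmentRep k δ) := h1
      rw [radicalSq_eq_bot p] at h2
      exact segHom_pivot_ne_zero c p ((Submodule.mem_bot k).1 h2)
    · rw [not_nonempty_iff] at h
      exact linearIndependent_empty_type
  have hsp : ⊤ ≤ Submodule.span k (Set.range v) := by
    rintro x -
    obtain ⟨⟨f, hf⟩, rfl⟩ := Submodule.Quotient.mk_surjective _ x
    by_cases h : Nonempty (γ ⟶ δ)
    · obtain ⟨p⟩ := h
      obtain ⟨r, hr⟩ := eq_smul_segMap (pivot_homLE p) f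
      refine Submodule.mem_span.2 fun S hS => ?_
      have hv : v p ∈ S := hS ⟨p, rfl⟩
      have : (Submodule.Quotient.mk ⟨f, hf⟩ : Irr k (Q.segmentRep k γ) (Q.segmentRep k δ)) =
          (r * (c.coeff p : k)⁻¹) • v p := by
        refine congrArg Submodule.Quotient.mk (Subtype.ext ?_)
        change f = (r * (c.coeff p : k)⁻¹) • segHom c (Q.pivot k p)
        rw [segHom_pivot, smul_smul, mul_assoc, inv_mul_cancel₀ (c.coeff p).ne_zero, mul_one, hr]
      rw [this]
      exact S.smul_mem _ hv
    · rw [not_nonempty_iff] at h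
      have : (Submodule.Quotient.mk ⟨f, hf⟩ : Irr k (Q.segmentRep k γ) (Q.segmentRep k δ)) = 0 :=
        (Submodule.Quotient.mk_eq_zero _).2 (radical_le_radicalSq h hf)
      rw [this]
      exact Submodule.zero_mem _
  exact ⟨Module.Basis.mk hli hsp, fun p => ⟨mem_radical_of_ne (pivot_ne p) _,
    Module.Basis.mk_apply hli hsp p⟩⟩

theorem finrank_irr {M N : Q.Rep k} (e : M ≅ Q.segmentRep k γ) (e' : N ≅ Q.segmentRep k δ) :
    Module.finrank k (Irr k M N) = Fintype.card (γ ⟶ δ) := by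
  obtain ⟨c, -⟩ := exists_pivotScalars Q k
  obtain ⟨b, -⟩ := exists_irr_basis c γ δ
  rw [(irrCongr k e e').finrank_eq, Module.finrank_eq_card_basis b]

theorem isIrreducible_pivot (c : Q.PivotScalars k) (p : γ ⟶ δ) :
    IsIrreducible (segHom c (Q.pivot k p)) where
  not_section := not_isSplitMono_of_ne (pivot_ne p) _
  not_retraction := not_isSplitEpi_of_ne (pivot_ne p) _
  factor Z g h hgh := by
    by_contra hno
    push Not at hno
    refine segHom_pivot_ne_zero c p ?_
    rw [← hgh]
    exact comp_eq_zero_of_pivot p (mem_radical_left hno.1) (mem_radical_right hno.2)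

/-- Without a pivot, a nonzero morphism is either an invertible scalar or factors through a third
interval module, with neither factor split. -/
theorem exists_pivot_of_isIrreducible {f : Q.segmentRep k γ ⟶ Q.segmentRep k δ}
    (hf : IsIrreducible f) : f ≠ 0 ∧ Nonempty (γ ⟶ δ) := by
  have h0 : f ≠ 0 := by
    rintro rfl
    rcases hf.factor (Q.segmentRep k γ) 0 0 zero_comp with ⟨⟨r, hr⟩⟩ | ⟨⟨r, hr⟩⟩
    · rw [zero_comp] at hr
      exact segmentRep_id_ne_zero hr.symm
    · rw [comp_zero] at hr
      exact segmentRep_id_ne_zero hr.symm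
  refine ⟨h0, ?_⟩
  by_contra hno
  rw [not_nonempty_iff] at hno
  have hne : γ ≠ δ := by
    rintro rfl
    obtain ⟨r, rfl⟩ := segmentRep_end f
    have hr : r ≠ 0 := fun e => h0 (by rw [e, zero_smul])
    refine hf.not_section ⟨⟨⟨r⁻¹ • 𝟙 _, ?_⟩⟩⟩
    rw [Linear.comp_smul, Category.comp_id, smul_smul, inv_mul_cancel₀ hr, one_smul]
  rcases exists_factor hno hne f with h1 | ⟨ε, g, g', h1, h2, h3⟩
  · exact h0 h1
  · rcases hf.factor _ g g' h3 with h | h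
    · exact not_isSplitMono_of_ne h1 g h
    · exact not_isSplitEpi_of_ne h2 g' h

theorem existsUnique_pivot (c : Q.PivotScalars k) {M N : Q.Rep k} (f : M ⟶ N)
    (hM : Indecomposable M) (hN : Indecomposable N) (hf : IsIrreducible f) :
    ∃! p : (γ : Q.Segment) × (δ : Q.Segment) × (γ ⟶ δ),
      Nonempty (Arrow.mk f ≅ Arrow.mk (segHom c (Q.pivot k p.2.2))) := by
  obtain ⟨γ, ⟨e⟩⟩ := exists_iso_segmentRep hM
  obtain ⟨δ, ⟨e'⟩⟩ := exists_iso_segmentRep hN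
  obtain ⟨h0, ⟨p⟩⟩ := exists_pivot_of_isIrreducible (hf.conj e.symm e')
  obtain ⟨r, hr⟩ := eq_smul_segMap (pivot_homLE p) (e.symm.hom ≫ f ≫ e'.hom)
  have hr0 : r ≠ 0 := fun e => h0 (by rw [hr, e, zero_smul])
  -- Transported to interval modules, `f` is `r` times the canonical map, while `F` of the pivot is
  -- `c.coeff p` times it; the quotient of the scalars is absorbed in the isomorphism of the
  -- targets.
  have hu : (c.coeff p : k) * r⁻¹ ≠ 0 := mul_ne_zero (c.coeff p).ne_zero (inv_ne_zero hr0)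
  refine ⟨⟨γ, δ, p⟩, ⟨Arrow.isoMk e (e' ≪≫ smulIso k _ hu) ?_⟩, ?_⟩
  · change e.hom ≫ segHom c (Q.pivot k p) = f ≫ e'.hom ≫ (((c.coeff p : k) * r⁻¹) • 𝟙 _)
    have h1 : segHom c (Q.pivot k p) = ((c.coeff p : k) * r⁻¹) • (e.inv ≫ f ≫ e'.hom) := by
      rw [segHom_pivot, ← Iso.symm_hom, hr, smul_smul, mul_assoc, inv_mul_cancel₀ hr0, mul_one]
    rw [h1, Linear.comp_smul, Linear.comp_smul, Linear.comp_smul, Category.comp_id,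
      Iso.hom_inv_id_assoc]
  · rintro ⟨γ', δ', p'⟩ ⟨i⟩
    obtain rfl : γ = γ' := eq_of_iso (e.symm ≪≫ Arrow.leftFunc.mapIso i)
    obtain rfl : δ = δ' := eq_of_iso (e'.symm ≪≫ Arrow.rightFunc.mapIso i)
    rw [Subsingleton.elim p' p]

end Radical

end TypeA

/-! ### Almost split sequences in general -/

namespace AuslanderReiten

/-- Almost split sequences with isomorphic right end terms: up to isomorphism, the composition of
the induced morphisms between the left end terms is nonzero. -/
theorem IsAlmostSplit.exists_comp_ne_zero {C : Type w} [Category.{v} C] [Abelian C]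
    {S S' : ShortComplex C} (hS : IsAlmostSplit S) (hS' : IsAlmostSplit S') (e : S.X₃ ≅ S'.X₃) :
    ∃ (α : S.X₁ ⟶ S'.X₁) (β : S'.X₁ ⟶ S.X₁), β ≫ α ≠ 0 := by
  have := hS.shortExact.mono_f
  have := hS'.shortExact.mono_f
  have := hS'.shortExact.epi_g
  obtain ⟨φ, hφ⟩ := hS'.right S.X₂ (S.g ≫ e.hom) (by
    rintro ⟨⟨r, hr⟩⟩
    refine hS.not_retraction ⟨⟨⟨e.hom ≫ r, ?_⟩⟩⟩
    simpa using congrArg (fun t => e.hom ≫ t ≫ e.inv) hr)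
  obtain ⟨ψ, hψ⟩ := hS.right S'.X₂ (S'.g ≫ e.inv) (by
    rintro ⟨⟨r, hr⟩⟩
    refine hS'.not_retraction ⟨⟨⟨e.inv ≫ r, ?_⟩⟩⟩
    simpa using congrArg (fun t => e.inv ≫ t ≫ e.hom) hr)
  have h1 : (S.f ≫ φ) ≫ S'.g = 0 := by rw [Category.assoc, hφ, S.zero_assoc, zero_comp]
  have h2 : (S'.f ≫ ψ) ≫ S.g = 0 := by rw [Category.assoc, hψ, S'.zero_assoc, zero_comp]
  refine ⟨hS'.shortExact.exact.lift _ h1, hS.shortExact.exact.lift _ h2, fun h0 => ?_⟩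
  have h3 : S'.f ≫ ψ ≫ φ = 0 := by
    have := congrArg (fun t => t ≫ S'.f) h0
    simp only [Category.assoc, ShortComplex.Exact.lift_f, zero_comp] at this
    rwa [← Category.assoc, ShortComplex.Exact.lift_f, Category.assoc] at this
  -- If the composition on the left terms were zero, the endomorphism `ψ ≫ φ` of the middle term
  -- would factor through `S'.g`, and the factor would be a section of `S'.g`.
  refine hS'.not_retraction ⟨⟨⟨hS'.shortExact.exact.desc _ h3, ?_⟩⟩⟩
  rw [← cancel_epi S'.g, ← Category.assoc, ShortComplex.Exact.g_desc, Category.assoc, hφ,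
    ← Category.assoc, hψ, Category.assoc, e.inv_hom_id]

theorem IsAlmostSplit.not_projective {C : Type w} [Category.{v} C] [Abelian C]
    {S : ShortComplex C} (hS : IsAlmostSplit S) : ¬ Projective S.X₃ := fun _ => by
  have := hS.shortExact.epi_g
  exact hS.not_retraction ⟨⟨⟨Projective.factorThru (𝟙 _) S.g, Projective.factorThru_comp _ _⟩⟩⟩

/-- Pull the epimorphism back along the given morphism; a section of the pullback gives the lift. -/
theorem projective_of_isSplitEpi {C : Type w} [Category.{v} C] [Abelian C] {P : C}
    (h : ∀ (U : C) (g : U ⟶ P), Epi g → IsSplitEpi g) : Projective P where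
  factors {E X} f e _ := by
    obtain ⟨⟨s, hs⟩⟩ := h _ (pullback.fst f e) inferInstance
    refine ⟨s ≫ pullback.snd f e, ?_⟩
    rw [Category.assoc, ← pullback.condition, ← Category.assoc, hs, Category.id_comp]

theorem IsTranslate.of_iso {C : Type w} [Category.{v} C] [Abelian C] {M N M' N' : C}
    (h : IsTranslate M N) (e : M ≅ M') (e' : N ≅ N') : IsTranslate M' N' := by
  obtain ⟨S, hS, ⟨i⟩, ⟨j⟩⟩ := h
  exact ⟨S, hS, ⟨i ≪≫ e⟩, ⟨j ≪≫ e'⟩⟩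

end AuslanderReiten

namespace TypeA

open AuslanderReiten TransQuiver

/-! ### Meshes as almost split sequences, and the projectives -/

section AlmostSplit

variable {n : ℕ} {Q : TypeA n} {k : Type u} [Field k] {γ δ ε : Q.Segment}

/-- Over a field the lifts exist at each vertex, and injectivity of `f` forces them to be natural.
-/
theorem exists_pointwise_lift {X Y A : Q.Rep k} (f : X ⟶ Y) (u : A ⟶ Y)
    (hf : ∀ l : Q.Vertex, Function.Injective (f.app l).hom.hom)
    (hu : ∀ (l : Q.Vertex) (y : fiber A l), ∃ x : fiber X l,
      (f.app l).hom.hom x = (u.app l).hom.hom y) : ∃ v : A ⟶ X, v ≫ f = u := by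
  have hex : ∀ l : Q.Vertex, ∃ v : fiber A l →ₗ[k] fiber X l, ∀ y,
      (f.app l).hom.hom (v y) = (u.app l).hom.hom y := by
    intro l
    obtain ⟨g, hg⟩ := (f.app l).hom.hom.exists_leftInverse_of_injective
      (LinearMap.ker_eq_bot.2 (hf l))
    refine ⟨g.comp (u.app l).hom.hom, fun y => ?_⟩
    obtain ⟨x, hx⟩ := hu l y
    change (f.app l).hom.hom (g ((u.app l).hom.hom y)) = _
    rw [← hx]
    exact congrArg _ (LinearMap.congr_fun hg x)
  choose v hv using hex
  refine ⟨⟨fun l => FGModuleCat.ofHom (v l), ?_⟩, Q.rep_hom_ext k hv⟩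
  intro l m p
  apply FGModuleCat.hom_ext
  apply LinearMap.ext
  intro (y : fiber A l)
  apply hf m
  have h1 : (u.app m).hom.hom ((A.map p).hom.hom y) = (Y.map p).hom.hom ((u.app l).hom.hom y) :=
    congrArg (fun t => t.hom.hom y) (u.naturality p)
  have h2 : (f.app m).hom.hom ((X.map p).hom.hom (v l y)) =
      (Y.map p).hom.hom ((f.app l).hom.hom (v l y)) :=
    congrArg (fun t => t.hom.hom (v l y)) (f.naturality p)
  change (f.app m).hom.hom (v m ((A.map p).hom.hom y)) =
    (f.app m).hom.hom ((X.map p).hom.hom (v l y))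
  exact ((hv m _).trans h1).trans ((h2.trans (congrArg _ (hv l y))).symm)

/-- The intermediate module is allowed to come from a pair with `j ≤ i`, in which case it is zero.
-/
theorem arc_comp_eq_zero {i j : Fin (n + 3)} (hne : ¬ (γ.i = i ∧ γ.j = j))
    (f : Q.segmentRep k γ ⟶ Q.intervalRep k (i + 1) j)
    (g : Q.intervalRep k (i + 1) j ⟶ Q.segmentRep k γ) : f ≫ g = 0 := by
  by_cases h : i < j
  · let ε : Q.Segment := ⟨(i, j), h⟩
    refine comp_eq_zero_of_ne (δ := ε) ?_ f g
    rintro rfl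
    exact hne ⟨rfl, rfl⟩
  · have : f = 0 := homCoeff_ext fun l => by
      refine (homCoeff_eq_zero_right f ?_).trans (homCoeff_zero l).symm
      rintro ⟨h1, h2⟩
      rw [Fin.lt_def] at h
      omega
    rw [this, zero_comp]

theorem rotation_posL (h : Q.rotation γ = some δ) : Q.posL δ.i < Q.posL γ.i := by
  have := (posL_R_symm_i δ).1
  rwa [(Q.rotation_eq_some h).1, Equiv.symm_apply_apply, ← (Q.rotation_eq_some h).1] at this

theorem rotation_posR (h : Q.rotation γ = some δ) : Q.posR δ.j < Q.posR γ.j := by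
  have := (posR_R_symm_j δ).1
  rwa [(Q.rotation_eq_some h).2, Equiv.symm_apply_apply, ← (Q.rotation_eq_some h).2] at this

/-- No vertex lies both between `i` and `R i` and between `j` and `R j`. -/
theorem rotation_not_between (h : Q.rotation γ = some δ) (v : ℕ) :
    ((γ.i : ℕ) < v ↔ (δ.i : ℕ) < v) ∨ (v ≤ (γ.j : ℕ) ↔ v ≤ (δ.j : ℕ)) := by
  obtain ⟨hi, hj⟩ := Q.rotation_eq_some h
  have h1 := γ.i_lt_j
  have h2 := δ.i_lt_j
  rw [hi, hj] at h2 ⊢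
  by_contra hno
  rw [Fin.lt_def] at h1 h2
  rcases Q.clockwiseNext_R γ.i with ⟨a1, a2, a3, a4⟩ | ⟨a1, a2, a3, a4⟩ <;>
    rcases Q.clockwiseNext_R γ.j with ⟨b1, b2, b3, b4⟩ | ⟨b1, b2, b3, b4⟩ <;>
    rw [Fin.lt_def] at a3 b3
  · exact a4 γ.j b1 (by simp only [Fin.lt_def]; omega)
  · omega
  · omega
  · exact a4 (Q.R γ.j) b2 (by simp only [Fin.lt_def]; omega)

/-- The value of a morphism of representations at a vertex. -/
def ev {M N : Q.Rep k} (f : M ⟶ N) (l : Q.Vertex) : fiber M l →ₗ[k] fiber N l :=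
  (f.app l).hom.hom

theorem ev_comp {M N L : Q.Rep k} (f : M ⟶ N) (g : N ⟶ L) (l : Q.Vertex) (x : fiber M l) :
    ev (f ≫ g) l x = ev g l (ev f l x) := rfl

theorem ev_sum {M N : Q.Rep k} {m : ℕ} (f : Fin m → (M ⟶ N)) (l : Q.Vertex) (x : fiber M l) :
    ev (∑ i, f i) l x = ∑ i, ev (f i) l x :=
  map_sum (⟨⟨fun f => ev f l x, rfl⟩, fun _ _ => rfl⟩ : (M ⟶ N) →+ fiber N l) _ _

theorem biprod_fiber_ext {M N : Q.Rep k} {l : Q.Vertex} {z z' : fiber (M ⊞ N) l}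
    (h1 : ev biprod.fst l z = ev biprod.fst l z') (h2 : ev biprod.snd l z = ev biprod.snd l z') :
    z = z' := by
  have key : ∀ z : fiber (M ⊞ N) l,
      z = ev biprod.inl l (ev biprod.fst l z) + ev biprod.inr l (ev biprod.snd l z) := fun z =>
    congrArg (fun t : M ⊞ N ⟶ M ⊞ N => ev t l z) biprod.total.symm
  rw [key z, key z', h1, h2]

/-- Exactness of the mesh sequence at one vertex: there one middle line coincides with the left term
and the other with the right term, in either order. -/
theorem line_exact {p q r s : Prop} (hc : ((q ↔ p) ∧ (r ↔ s)) ∨ ((q ↔ s) ∧ (r ↔ p)))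
    (z₁ : line k q) (z₂ : line k r) (h : lineMap k q s z₁ + lineMap k r s z₂ = 0) :
    ∃ x : line k p, lineMap k p q x = z₁ ∧ - lineMap k p r x = z₂ := by
  have hid : ∀ (p : Prop) (x : line k p), lineMap k p p x = x := by
    intro p x
    by_cases hp : p
    · exact Subtype.ext (lineMap_of k hp x)
    · rw [line_eq_zero k hp x, map_zero]
  rcases hc with ⟨h1, h2⟩ | ⟨h1, h2⟩
  · obtain rfl := propext h1
    obtain rfl := propext h2
    rw [hid] at h
    exact ⟨z₁, hid _ _, neg_eq_of_add_eq_zero_right h⟩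
  · obtain rfl := propext h1
    obtain rfl := propext h2
    rw [hid] at h
    refine ⟨- z₂, ?_, by rw [hid, neg_neg]⟩
    rw [map_neg]
    exact (eq_neg_of_add_eq_zero_left h).symm

/-- At a given vertex the rotation changes at most one of the two conditions that define the
support, by `rotation_not_between`. -/
theorem meshSequence_between (h : Q.rotation γ = some δ) (l : Q.Vertex) :
    (((Between (γ.i + 1) δ.j l ↔ Between (δ.i + 1) δ.j l) ∧
      (Between (δ.i + 1) γ.j l ↔ Between (γ.i + 1) γ.j l)) ∨
    ((Between (γ.i + 1) δ.j l ↔ Between (γ.i + 1) γ.j l) ∧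
      (Between (δ.i + 1) γ.j l ↔ Between (δ.i + 1) δ.j l))) := by
  have := rotation_not_between h (label l)
  unfold Between
  omega

section Sequence

variable (k) (h : Q.rotation γ = some δ)

/-- The sequence given by a mesh. -/
def meshSequence : ShortComplex (Q.Rep k) where
  X₁ := Q.intervalRep k (δ.i + 1) δ.j
  -- A summand whose end points are in the wrong order is the zero representation, so meshes with
  -- one and with two middle terms are treated alike.
  X₂ := Q.intervalRep k (γ.i + 1) δ.j ⊞ Q.intervalRep k (δ.i + 1) γ.j
  X₃ := Q.intervalRep k (γ.i + 1) γ.j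
  f := biprod.lift (arcMap k (rotation_posL h).le le_rfl) (- arcMap k le_rfl (rotation_posR h).le)
  g := biprod.desc (arcMap k le_rfl (rotation_posR h).le) (arcMap k (rotation_posL h).le le_rfl)
  zero := by
    rw [biprod.lift_desc, Preadditive.neg_comp, arcMap_comp, arcMap_comp]
    exact add_neg_cancel _

theorem meshSequence_f_injective (l : Q.Vertex) :
    Function.Injective (ev (meshSequence k h).f l) := by
  refine (injective_iff_map_eq_zero _).2 fun x hx => ?_
  have e1 : (meshSequence k h).f ≫ biprod.fst = arcMap k (rotation_posL h).le le_rfl :=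
    biprod.lift_fst _ _
  have e2 : (meshSequence k h).f ≫ biprod.snd = - arcMap k le_rfl (rotation_posR h).le :=
    biprod.lift_snd _ _
  have h1 : lineMap k (Between (δ.i + 1) δ.j l) (Between (γ.i + 1) δ.j l) x = 0 := by
    refine (congrArg (fun t => ev t l x) e1).symm.trans ?_
    exact (congrArg (ev biprod.fst l) hx).trans (map_zero _)
  have h2 : lineMap k (Between (δ.i + 1) δ.j l) (Between (δ.i + 1) γ.j l) x = 0 := by
    refine neg_eq_zero.1 ?_
    refine (congrArg (fun t => ev t l x) e2).symm.trans ?_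
    exact (congrArg (ev biprod.snd l) hx).trans (map_zero _)
  by_cases hl : Between (δ.i + 1) δ.j l
  · rcases meshSequence_between h l with ⟨h3, -⟩ | ⟨-, h3⟩
    · exact Subtype.ext ((lineMap_of k (h3.2 hl) x).symm.trans (congrArg Subtype.val h1))
    · exact Subtype.ext ((lineMap_of k (h3.2 hl) x).symm.trans (congrArg Subtype.val h2))
  · exact line_eq_zero k hl x

theorem meshSequence_g_surjective (l : Q.Vertex) :
    Function.Surjective (ev (meshSequence k h).g l) := by
  intro (y : line k (Between (γ.i + 1) γ.j l))
  have e1 : biprod.inl ≫ (meshSequence k h).g = arcMap k le_rfl (rotation_posR h).le :=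
    biprod.inl_desc _ _
  have e2 : biprod.inr ≫ (meshSequence k h).g = arcMap k (rotation_posL h).le le_rfl :=
    biprod.inr_desc _ _
  by_cases hl : Between (γ.i + 1) γ.j l
  · rcases meshSequence_between h l with ⟨-, h3⟩ | ⟨h3, -⟩
    · let y' : line k (Between (δ.i + 1) γ.j l) := lineMap k _ _ y
      refine ⟨ev biprod.inr l y', (congrArg (fun t => ev t l y') e2).trans ?_⟩
      change lineMap k _ _ (lineMap k _ _ y) = y
      exact Subtype.ext (by rw [lineMap_of k hl, lineMap_of k (h3.2 hl)])
    · let y' : line k (Between (γ.i + 1) δ.j l) := lineMap k _ _ y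
      refine ⟨ev biprod.inl l y', (congrArg (fun t => ev t l y') e1).trans ?_⟩
      change lineMap k _ _ (lineMap k _ _ y) = y
      exact Subtype.ext (by rw [lineMap_of k hl, lineMap_of k (h3.2 hl)])
  · exact ⟨0, (map_zero _).trans (line_eq_zero k hl y).symm⟩

theorem meshSequence_exists_lift {A : Q.Rep k} (u : A ⟶ (meshSequence k h).X₂)
    (hu : u ≫ (meshSequence k h).g = 0) :
    ∃ v : A ⟶ (meshSequence k h).X₁, v ≫ (meshSequence k h).f = u := by
  refine exists_pointwise_lift _ u (meshSequence_f_injective k h) fun l y => ?_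
  let z : fiber (meshSequence k h).X₂ l := ev u l y
  let z₁ : line k (Between (γ.i + 1) δ.j l) := ev biprod.fst l z
  let z₂ : line k (Between (δ.i + 1) γ.j l) := ev biprod.snd l z
  have hg : (meshSequence k h).g =
      biprod.fst ≫ arcMap k le_rfl (rotation_posR h).le +
        biprod.snd ≫ arcMap k (rotation_posL h).le le_rfl := by
    exact biprod.desc_eq
  have hz : lineMap k _ (Between (γ.i + 1) γ.j l) z₁ + lineMap k _ _ z₂ = 0 :=
    (congrArg (fun t => ev t l z) hg).symm.trans
      (congrArg (fun t : A ⟶ (meshSequence k h).X₃ => ev t l y) hu)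
  obtain ⟨x, hx1, hx2⟩ := line_exact (meshSequence_between h l) z₁ z₂ hz
  refine ⟨x, biprod_fiber_ext ?_ ?_⟩
  · have e1 : (meshSequence k h).f ≫ biprod.fst = arcMap k (rotation_posL h).le le_rfl :=
      biprod.lift_fst _ _
    exact (congrArg (fun t => ev t l x) e1).trans hx1
  · have e2 : (meshSequence k h).f ≫ biprod.snd = - arcMap k le_rfl (rotation_posR h).le :=
      biprod.lift_snd _ _
    exact (congrArg (fun t => ev t l x) e2).trans hx2

theorem meshSequence_shortExact : (meshSequence k h).ShortExact := by
  have hm : Mono (meshSequence k h).f := Preadditive.mono_of_cancel_zero _ fun {A} u hu => by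
    refine Q.rep_hom_ext k fun l x => meshSequence_f_injective k h l ?_
    refine (congrArg (fun t : A ⟶ (meshSequence k h).X₂ => ev t l x) hu).trans ?_
    exact (map_zero (ev (meshSequence k h).f l)).symm
  have he : Epi (meshSequence k h).g := Preadditive.epi_of_cancel_zero _ fun {A} u hu => by
    refine Q.rep_hom_ext k fun l y => ?_
    obtain ⟨x, rfl⟩ := meshSequence_g_surjective k h l y
    exact congrArg (fun t : (meshSequence k h).X₂ ⟶ A => ev t l x) hu
  refine ⟨?_⟩
  rw [ShortComplex.exact_iff_exact_up_to_refinements]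
  intro A u hu
  obtain ⟨v, hv⟩ := meshSequence_exists_lift k h u hu
  exact ⟨A, 𝟙 A, inferInstance, v, by rw [Category.id_comp, hv]⟩

/-- The morphism is a multiple of a canonical map, which factors through the last pivot into `γ`;
the source of that pivot is one of the middle terms. -/
theorem meshSequence_lift (u : Q.segmentRep k ε ⟶ Q.segmentRep k γ) (hu : ¬ IsSplitEpi u) :
    ∃ v : Q.segmentRep k ε ⟶ (meshSequence k h).X₂, v ≫ (meshSequence k h).g = u := by
  by_cases h0 : u = 0
  · exact ⟨0, by rw [h0]; exact zero_comp⟩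
  have hle := homLE_of_ne_zero h0
  obtain ⟨r, rfl⟩ := eq_smul_segMap hle u
  have hne : ε ≠ γ := by
    rintro rfl
    have hr : r ≠ 0 := fun e => h0 (by rw [e, zero_smul])
    refine hu ⟨⟨⟨r⁻¹ • 𝟙 _, ?_⟩⟩⟩
    rw [Linear.smul_comp, Category.id_comp, smul_smul, inv_mul_cancel₀ hr, one_smul, segMap_refl]
  obtain ⟨y, hp, h1, -⟩ := hle.exists_pivot_to hne
  obtain ⟨q⟩ := (pivot_of_rotation h).1 hp
  have a := h1.left
  have b := h1.right
  rcases mesh_middle h q with ⟨hi, hj⟩ | ⟨hi, hj⟩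
  · rw [hi] at a
    rw [hj] at b
    refine ⟨r • (arcMap k a b ≫ biprod.inl), ?_⟩
    refine (Linear.smul_comp ..).trans (congrArg (r • ·) ?_)
    refine (Category.assoc ..).trans ((congrArg (arcMap k a b ≫ ·) (biprod.inl_desc _ _)).trans ?_)
    exact arcMap_comp k _ _ _ _
  · rw [hi] at a
    rw [hj] at b
    refine ⟨r • (arcMap k a b ≫ biprod.inr), ?_⟩
    refine (Linear.smul_comp ..).trans (congrArg (r • ·) ?_)
    refine (Category.assoc ..).trans ((congrArg (arcMap k a b ≫ ·) (biprod.inr_desc _ _)).trans ?_)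
    exact arcMap_comp k _ _ _ _

theorem meshSequence_extend (u : Q.segmentRep k δ ⟶ Q.segmentRep k ε) (hu : ¬ IsSplitMono u) :
    ∃ v : (meshSequence k h).X₂ ⟶ Q.segmentRep k ε, (meshSequence k h).f ≫ v = u := by
  by_cases h0 : u = 0
  · exact ⟨0, by rw [h0]; exact comp_zero⟩
  have hle := homLE_of_ne_zero h0
  obtain ⟨r, rfl⟩ := eq_smul_segMap hle u
  have hne : δ ≠ ε := by
    rintro rfl
    have hr : r ≠ 0 := fun e => h0 (by rw [e, zero_smul])
    refine hu ⟨⟨⟨r⁻¹ • 𝟙 _, ?_⟩⟩⟩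
    rw [Linear.comp_smul, Category.comp_id, smul_smul, inv_mul_cancel₀ hr, one_smul, segMap_refl]
  obtain ⟨y, ⟨q⟩, -, h1⟩ := hle.exists_pivot_from hne
  have a := h1.left
  have b := h1.right
  rcases mesh_middle h q with ⟨hi, hj⟩ | ⟨hi, hj⟩
  · rw [hi] at a
    rw [hj] at b
    refine ⟨r • (biprod.fst ≫ arcMap k a b), ?_⟩
    refine (Linear.comp_smul ..).trans (congrArg (r • ·) ?_)
    refine (Category.assoc ..).symm.trans
      ((congrArg (· ≫ arcMap k a b) (biprod.lift_fst _ _)).trans ?_)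
    exact arcMap_comp k _ _ _ _
  · rw [hi] at a
    rw [hj] at b
    refine ⟨r • (biprod.snd ≫ (- arcMap k a b)), ?_⟩
    refine (Linear.comp_smul ..).trans (congrArg (r • ·) ?_)
    refine (Category.assoc ..).symm.trans
      ((congrArg (· ≫ (- arcMap k a b)) (biprod.lift_snd _ _)).trans ?_)
    refine (Preadditive.neg_comp_neg ..).trans ?_
    exact arcMap_comp k _ _ _ _

theorem meshSequence_isAlmostSplit : IsAlmostSplit (meshSequence k h) where
  shortExact := meshSequence_shortExact k h
  indecomposable_left := Q.segmentRep_indecomposable k δ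
  indecomposable_right := Q.segmentRep_indecomposable k γ
  not_section := by
    rintro ⟨⟨r, hr⟩⟩
    have hL := rotation_posL h
    have hR := rotation_posR h
    have key : ∀ r : Q.intervalRep k (γ.i + 1) δ.j ⊞ Q.intervalRep k (δ.i + 1) γ.j ⟶
        Q.intervalRep k (δ.i + 1) δ.j, biprod.lift (arcMap k hL.le le_rfl)
          (- arcMap k le_rfl hR.le) ≫ r = arcMap k hL.le le_rfl ≫ biprod.inl ≫ r +
          (- arcMap k le_rfl hR.le) ≫ biprod.inr ≫ r := fun r => by
      rw [biprod.lift_eq, Preadditive.add_comp, Category.assoc, Category.assoc]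
    -- A retraction would write the identity of `M_δ` as a sum of two endomorphisms that pass
    -- through modules of other pairs of points, and such endomorphisms vanish.
    refine segmentRep_id_ne_zero (k := k) (γ := δ) (hr.symm.trans ((key r).trans ?_))
    refine (congrArg₂ (· + ·) (arc_comp_eq_zero (γ := δ) ?_ _ _)
      (arc_comp_eq_zero (γ := δ) ?_ _ _)).trans (add_zero _)
    · rintro ⟨e, -⟩
      rw [e] at hL
      exact lt_irrefl _ hL
    · rintro ⟨-, e⟩
      rw [e] at hR
      exact lt_irrefl _ hR
  left U u hu := by
    -- Splitting the identity of `U` reduces the extension problem to targets that are interval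
    -- modules.
    obtain ⟨m, ε, a, b, hab⟩ := exists_sum_id U
    have hi : ∀ i, ∃ v : (meshSequence k h).X₂ ⟶ Q.segmentRep k (ε i),
        (meshSequence k h).f ≫ v = u ≫ a i := fun i =>
      meshSequence_extend k h _ fun ⟨⟨r, hr⟩⟩ => hu ⟨⟨⟨a i ≫ r,
        (Category.assoc ..).symm.trans hr⟩⟩⟩
    choose v hv using hi
    refine ⟨∑ i, v i ≫ b i, ?_⟩
    rw [Preadditive.comp_sum]
    refine (Finset.sum_congr rfl fun i _ => ?_ : _ = ∑ i, u ≫ a i ≫ b i).trans ?_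
    · rw [← Category.assoc, hv, Category.assoc]
    · rw [← Preadditive.comp_sum, hab, Category.comp_id]
  not_retraction := by
    rintro ⟨⟨r, hr⟩⟩
    have hL := rotation_posL h
    have hR := rotation_posR h
    have key : ∀ r : Q.intervalRep k (γ.i + 1) γ.j ⟶
        Q.intervalRep k (γ.i + 1) δ.j ⊞ Q.intervalRep k (δ.i + 1) γ.j,
        r ≫ biprod.desc (arcMap k le_rfl hR.le) (arcMap k hL.le le_rfl) =
          (r ≫ biprod.fst) ≫ arcMap k le_rfl hR.le +
          (r ≫ biprod.snd) ≫ arcMap k hL.le le_rfl := fun r => by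
      rw [biprod.desc_eq, Preadditive.comp_add, Category.assoc, Category.assoc]
    refine segmentRep_id_ne_zero (k := k) (γ := γ) (hr.symm.trans ((key r).trans ?_))
    refine (congrArg₂ (· + ·) (arc_comp_eq_zero (γ := γ) ?_ _ _)
      (arc_comp_eq_zero (γ := γ) ?_ _ _)).trans (add_zero _)
    · rintro ⟨-, e⟩
      rw [e] at hR
      exact lt_irrefl _ hR
    · rintro ⟨e, -⟩
      rw [e] at hL
      exact lt_irrefl _ hL
  right U u hu := by
    obtain ⟨m, ε, a, b, hab⟩ := exists_sum_id U
    have hi : ∀ i, ∃ v : Q.segmentRep k (ε i) ⟶ (meshSequence k h).X₂,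
        v ≫ (meshSequence k h).g = b i ≫ u := fun i =>
      meshSequence_lift k h _ fun ⟨⟨r, hr⟩⟩ => hu ⟨⟨⟨r ≫ b i,
        (Category.assoc ..).trans hr⟩⟩⟩
    choose v hv using hi
    refine ⟨∑ i, a i ≫ v i, ?_⟩
    rw [Preadditive.sum_comp]
    refine (Finset.sum_congr rfl fun i _ => ?_ : _ = ∑ i, (a i ≫ b i) ≫ u).trans ?_
    · rw [Category.assoc, hv, Category.assoc]
    · rw [← Preadditive.sum_comp, hab, Category.id_comp]

end Sequence

theorem isTranslate_of_rotation (h : Q.rotation γ = some δ) :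
    IsTranslate (Q.segmentRep k γ) (Q.segmentRep k δ) :=
  ⟨meshSequence k h, meshSequence_isAlmostSplit k h, ⟨Iso.refl _⟩, ⟨Iso.refl _⟩⟩

/-- A morphism between interval modules that ends at `M_γ` and is not split factors through an
immediate predecessor. These all miss the vertex `v`, so any non-split morphism to `M_γ` vanishes at
`v` and is not epi. -/
theorem projective_of_rotation_eq_none (h : Q.rotation γ = none) :
    Projective (Q.segmentRep k γ) := by
  refine projective_of_isSplitEpi fun U u hu => ?_
  by_contra hns
  obtain ⟨v, hv1, hv2, hv3⟩ := exists_top_of_rotation_eq_none h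
  obtain ⟨l, hl⟩ := exists_label (Q := Q) (m := v) (by omega) (by have := γ.j.isLt; omega)
  have hlγ : Between (γ.i + 1) γ.j l := by unfold Between; omega
  obtain ⟨m, ε, a, b, hab⟩ := exists_sum_id U
  have hzero : ∀ (ε : Q.Segment) (w : Q.segmentRep k ε ⟶ Q.segmentRep k γ), ¬ IsSplitEpi w →
      ∀ x, ev w l x = 0 := by
    intro ε w hw x
    by_cases h0 : w = 0
    · rw [h0]; rfl
    have hle := homLE_of_ne_zero h0
    obtain ⟨r, rfl⟩ := eq_smul_segMap hle w
    have hne : ε ≠ γ := by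
      rintro rfl
      have hr : r ≠ 0 := fun e => h0 (by rw [e, zero_smul])
      refine hw ⟨⟨⟨r⁻¹ • 𝟙 _, ?_⟩⟩⟩
      rw [Linear.smul_comp, Category.id_comp, smul_smul, inv_mul_cancel₀ hr, one_smul,
        segMap_refl]
    obtain ⟨y, hp, h1, h2⟩ := hle.exists_pivot_to hne
    have hly : ¬ Between (y.i + 1) y.j l := by
      have := hv3 y hp
      unfold Between
      omega
    rw [← segMap_comp k h1 h2 hle]
    change r • ev (segMap k h2) l (ev (segMap k h1) l x) = 0
    have : ev (segMap k h1) l x = 0 := line_eq_zero k hly _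
    rw [this, map_zero, smul_zero]
  have hu0 : ∀ x, ev u l x = 0 := by
    intro x
    have h1 : u = ∑ i, a i ≫ b i ≫ u := by
      have := congrArg (fun t => t ≫ u) hab
      simp only [Category.id_comp, Preadditive.sum_comp, Category.assoc] at this
      exact this.symm
    rw [h1, ev_sum]
    refine Finset.sum_eq_zero fun i _ => ?_
    rw [ev_comp]
    refine hzero (ε i) (b i ≫ u) ?_ _
    rintro ⟨⟨r, hr⟩⟩
    exact hns ⟨⟨⟨r ≫ b i, (Category.assoc ..).trans hr⟩⟩⟩
  have hepi : Epi (u.app l) := (NatTrans.epi_iff_epi_app u).1 hu l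
  have h1 : 𝟙 ((Q.segmentRep k γ).obj l) = 0 := by
    refine hepi.left_cancellation _ _ ?_
    apply FGModuleCat.hom_ext
    exact LinearMap.ext hu0
  let one : line k (Between (γ.i + 1) γ.j l) := ⟨1, one_mem_line k hlγ⟩
  have h2 : one = 0 := congrArg (fun t => t.hom.hom one) h1
  exact one_ne_zero (congrArg Subtype.val h2)

theorem rotation_eq_none_iff : Q.rotation γ = none ↔ Projective (Q.segmentRep k γ) := by
  refine ⟨projective_of_rotation_eq_none, fun hp => ?_⟩
  by_contra hne
  obtain ⟨δ, hδ⟩ := Option.ne_none_iff_exists'.1 hne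
  exact (meshSequence_isAlmostSplit k hδ).not_projective hp

/-- For the converse, comparing the given sequence with the mesh sequence yields a nonzero
composition `M_δ' ⟶ M_δ ⟶ M_δ'`, which forces `δ' = δ`. -/
theorem rotation_eq_some_iff : Q.rotation γ = some δ ↔
    IsTranslate (Q.segmentRep k γ) (Q.segmentRep k δ) := by
  refine ⟨isTranslate_of_rotation, ?_⟩
  rintro ⟨S, hS, ⟨e⟩, ⟨e'⟩⟩
  obtain ⟨δ', hδ'⟩ : ∃ δ', Q.rotation γ = some δ' := by
    refine Option.ne_none_iff_exists'.1 fun h => hS.not_projective ?_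
    exact Projective.of_iso e.symm (projective_of_rotation_eq_none h)
  obtain ⟨α, β, hne⟩ := hS.exists_comp_ne_zero (meshSequence_isAlmostSplit k hδ') e
  have : δ' = δ := by
    refine eq_of_retract (k := k) (f := β ≫ e'.hom) (g := e'.inv ≫ α) ?_
    intro h0
    exact hne (((Category.assoc ..).trans (congrArg (β ≫ ·) (e'.hom_inv_id_assoc α))).symm.trans h0)
  rw [hδ', this]

end AlmostSplit

end TypeA

/-! ### Additive extensions of full and faithful functors -/

section AdditiveExtension

variable {C : Type w} [Category.{v} C] [Preadditive C] {D : Type w'} [Category.{v'} D]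
  [Preadditive D] [HasFiniteBiproducts D] (F : C ⥤ D) [F.Additive]

theorem additiveExtension_component {X Y : Mat_ C} (f : X ⟶ Y) (i : X.ι) (j : Y.ι) :
    biproduct.ι (fun i => F.obj (X.X i)) i ≫ (additiveExtension F).map f ≫
      biproduct.π (fun j => F.obj (Y.X j)) j = F.map (f i j) := by
  simp [additiveExtension]

theorem additiveExtension_hom_ext {X Y : Mat_ C}
    {f g : (additiveExtension F).obj X ⟶ (additiveExtension F).obj Y}
    (h : ∀ i j, biproduct.ι (fun i => F.obj (X.X i)) i ≫ f ≫
        biproduct.π (fun j => F.obj (Y.X j)) j =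
      biproduct.ι (fun i => F.obj (X.X i)) i ≫ g ≫ biproduct.π (fun j => F.obj (Y.X j)) j) :
    f = g :=
  biproduct.hom_ext' _ _ fun i => biproduct.hom_ext _ _ fun j =>
    (Category.assoc _ _ _).trans ((h i j).trans (Category.assoc _ _ _).symm)

instance additiveExtension_additive : (additiveExtension F).Additive where
  map_add {X Y f g} := by
    refine additiveExtension_hom_ext F fun i j => ?_
    refine (additiveExtension_component F (f + g) i j).trans ?_
    refine Eq.trans ?_ (congrArg (biproduct.ι (fun i => F.obj (X.X i)) i ≫ ·)
      (Preadditive.add_comp _ _ _ ((additiveExtension F).map f) ((additiveExtension F).map g)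
        (biproduct.π (fun j => F.obj (Y.X j)) j)).symm)
    refine Eq.trans ?_ (Preadditive.comp_add _ _ _ _ _ _).symm
    refine Eq.trans ?_ (congrArg₂ (· + ·) (additiveExtension_component F f i j).symm
      (additiveExtension_component F g i j).symm)
    exact F.map_add

instance additiveExtension_faithful [F.Faithful] : (additiveExtension F).Faithful where
  map_injective {X Y f g} h := by
    funext i j
    apply F.map_injective
    rw [← additiveExtension_component, ← additiveExtension_component, h]

instance additiveExtension_full [F.Full] : (additiveExtension F).Full where
  map_surjective {X Y} f := by
    refine ⟨fun i j => F.preimage (biproduct.ι (fun i => F.obj (X.X i)) i ≫ f ≫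
      biproduct.π (fun j => F.obj (Y.X j)) j), ?_⟩
    refine additiveExtension_hom_ext F fun i j => ?_
    exact (additiveExtension_component F _ i j).trans (F.map_preimage _)

/-- The additive extension of `F` restricts to `F`. -/
def additiveExtensionEmbedding (X : C) :
    (additiveExtension F).obj ((Mat_.embedding C).obj X) ≅ F.obj X :=
  biproductUniqueIso fun _ : PUnit => F.obj X

end AdditiveExtension

namespace TypeA

open AuslanderReiten TransQuiver

/-! ### Abelian structure and the isomorphism of translation quivers -/

section Main

variable {n : ℕ} {Q : TypeA n} {k : Type u} [Field k] {γ δ : Q.Segment}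

instance (c : Q.PivotScalars k) : (segmentFunctorAdd c).Full := by
  unfold segmentFunctorAdd; infer_instance

instance (c : Q.PivotScalars k) : (segmentFunctorAdd c).Faithful := by
  unfold segmentFunctorAdd; infer_instance

instance (c : Q.PivotScalars k) : (segmentFunctorAdd c).Additive := by
  unfold segmentFunctorAdd; infer_instance

instance (c : Q.PivotScalars k) : (segmentFunctorAdd c).EssSurj where
  mem_essImage M := by
    -- The essential image contains zero and is closed under adding an interval module.
    refine rep_induction (P := (segmentFunctorAdd c).essImage) ?_ ?_ ?_ M
    · intro M N e h
      exact h.ofIso e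
    · intro M hM
      have : HasZeroObject (Mat_ (Q.SegmentCategory k)) := hasZeroObject_of_hasFiniteBiproducts _
      exact ⟨_, ⟨((segmentFunctorAdd c).map_isZero (isZero_zero _)).iso hM⟩⟩
    · rintro γ M ⟨X, ⟨e⟩⟩
      have := hasBinaryBiproducts_of_finite_biproducts (Mat_ (Q.SegmentCategory k))
      have := preservesBinaryBiproducts_of_preservesBiproducts (segmentFunctorAdd c)
      exact ⟨(Mat_.embedding _).obj (Q.seg k γ) ⊞ X, ⟨(segmentFunctorAdd c).mapBiprod _ _ ≪≫
        biprod.mapIso (additiveExtensionEmbedding (segmentFunctor c ⋙ ObjectProperty.ι _)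
          (Q.seg k γ)) e⟩⟩

instance segmentFunctorAdd_isEquivalence (c : Q.PivotScalars k) :
    (segmentFunctorAdd c).IsEquivalence where

theorem isAbelianCategory_mat (c : Q.PivotScalars k) :
    IsAbelianCategory (Mat_ (Q.SegmentCategory k)) :=
  ⟨abelianOfEquivalence (segmentFunctorAdd c), rfl⟩

theorem indClass_eq_iff {M N : Q.Ind k} : indClass M = indClass N ↔ Nonempty (M ≅ N) :=
  _root_.Quotient.eq

theorem repIso (M : Q.Ind k) : Nonempty ((indClass M).rep ≅ M.obj) := by
  obtain ⟨e⟩ := indClass_eq_iff.1 (_root_.Quotient.out_eq (indClass M))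
  exact ⟨(ObjectProperty.ι _).mapIso e⟩

theorem indClass_bijective (c : Q.PivotScalars k) :
    Function.Bijective fun γ => indClass ((segmentFunctor c).obj (Q.seg k γ)) := by
  refine ⟨fun γ δ h => ?_, fun x => ?_⟩
  · obtain ⟨e⟩ := indClass_eq_iff.1 h
    exact eq_of_iso (k := k) ((ObjectProperty.ι _).mapIso e)
  · obtain ⟨M, rfl⟩ := _root_.Quotient.exists_rep x
    obtain ⟨γ, ⟨e⟩⟩ := exists_iso_segmentRep M.property
    exact ⟨γ, indClass_eq_iff.2 ⟨ObjectProperty.isoMk _ e.symm⟩⟩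

theorem rotation_arTranslation (c : Q.PivotScalars k) (γ : Q.Segment) :
    (Q.rotation γ).map (fun δ => indClass ((segmentFunctor c).obj (Q.seg k δ))) =
      Q.arTranslation k (indClass ((segmentFunctor c).obj (Q.seg k γ))) := by
  obtain ⟨e⟩ := repIso ((segmentFunctor c).obj (Q.seg k γ))
  cases h : Q.rotation γ with
  | none =>
    have hp := projective_of_rotation_eq_none (k := k) h
    rw [arTranslation, dif_neg]
    · rfl
    · exact fun h' => h'.1 (Projective.of_iso e.symm hp)
  | some δ =>
    have hp : ¬ Projective (indClass ((segmentFunctor c).obj (Q.seg k γ))).rep := fun hp => by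
      have := (rotation_eq_none_iff (k := k) (γ := γ)).2 (Projective.of_iso e hp)
      rw [this] at h
      exact Option.some_ne_none _ h.symm
    obtain ⟨e'⟩ := repIso ((segmentFunctor c).obj (Q.seg k δ))
    have hex : ∃ y : Q.IndClass k,
        IsTranslate (indClass ((segmentFunctor c).obj (Q.seg k γ))).rep y.rep :=
      ⟨_, (isTranslate_of_rotation (k := k) h).of_iso e.symm e'.symm⟩
    rw [arTranslation, dif_pos ⟨hp, hex⟩]
    refine congrArg some ?_
    have hs := hex.choose_spec
    -- The chosen translate is the class of some line segment, and `rotation_eq_some_iff` identifies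
    -- this segment as the rotation of `γ`, so the choice does not matter.
    obtain ⟨δ', hδ'⟩ := (indClass_bijective c).2 hex.choose
    rw [← hδ'] at hs ⊢
    obtain ⟨e''⟩ := repIso ((segmentFunctor c).obj (Q.seg k δ'))
    have := (rotation_eq_some_iff (k := k) (γ := γ) (δ := δ')).2 (hs.of_iso e e'')
    rw [h] at this
    cases this
    rfl

/-- The isomorphism between the quiver of line segments and the Auslander–Reiten quiver. -/
def translationQuiverIso (c : Q.PivotScalars k) :
    TransQuiver.Iso Q.rotation (Q.arTranslation k) where
  vertex := Equiv.ofBijective _ (indClass_bijective c)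
  arrow γ δ := (Fintype.equivFin (γ ⟶ δ)).trans (finCongr
    (finrank_irr (repIso ((segmentFunctor c).obj (Q.seg k γ))).some
      (repIso ((segmentFunctor c).obj (Q.seg k δ))).some).symm)
  translation γ := rotation_arTranslation c γ

end Main

end TypeA

/-- This transports the axioms from the line segments to the Auslander–Reiten quiver, where they
would be harder to check directly. -/
theorem TransQuiver.Iso.isTranslationQuiver {V : Type u} [Quiver.{v} V] {W : Type w}
    [Quiver.{v'} W] {τ : V → Option V} {σ : W → Option W} (Φ : TransQuiver.Iso τ σ)
    (h : TransQuiver.IsTranslationQuiver τ) : TransQuiver.IsTranslationQuiver σ where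
  no_loops x := by
    obtain ⟨y, rfl⟩ := Φ.vertex.surjective x
    exact ⟨fun a => (h.no_loops y).false ((Φ.arrow y y).symm a)⟩
  injective x y z hx hy := by
    obtain ⟨x, rfl⟩ := Φ.vertex.surjective x
    obtain ⟨y, rfl⟩ := Φ.vertex.surjective y
    rw [← Φ.translation, Option.map_eq_some_iff] at hx hy
    obtain ⟨a, ha, rfl⟩ := hx
    obtain ⟨b, hb, e⟩ := hy
    rw [Φ.vertex.injective e] at hb
    rw [h.injective _ _ _ ha hb]
  card_arrows x z hx y := by
    obtain ⟨x, rfl⟩ := Φ.vertex.surjective x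
    obtain ⟨y, rfl⟩ := Φ.vertex.surjective y
    rw [← Φ.translation, Option.map_eq_some_iff] at hx
    obtain ⟨a, ha, rfl⟩ := hx
    rw [← Nat.card_congr (Φ.arrow y x), ← Nat.card_congr (Φ.arrow a y), h.card_arrows x a ha y]

end

open CategoryTheory CategoryTheory.Limits TypeA AuslanderReiten in
theorem theorem1 (n : ℕ) (Q : TypeA n) (k : Type u) [Field k] [IsAlgClosed k] :
    -- scalars for the pivots exist, and signs will do
    (∃ c : Q.PivotScalars k, ∀ {γ δ : Q.Segment} (p : γ ⟶ δ),
      (c.coeff p : k) = 1 ∨ (c.coeff p : k) = -1) ∧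
    ∀ c : Q.PivotScalars k,
      (segmentFunctor c).IsEquivalence ∧
      -- the isomorphism of translation quivers
      TransQuiver.IsTranslationQuiver Q.rotation ∧
      TransQuiver.IsTranslationQuiver (Q.arTranslation k) ∧
      (∃ Φ : TransQuiver.Iso Q.rotation (Q.arTranslation k),
        ∀ γ, Φ.vertex γ = indClass ((segmentFunctor c).obj (Q.seg k γ))) ∧
      (∀ γ δ : Q.Segment, ∃ b : Module.Basis (γ ⟶ δ) k
          (Irr k ((segmentFunctor c).obj (Q.seg k γ)).obj ((segmentFunctor c).obj (Q.seg k δ)).obj),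
        ∀ p : γ ⟶ δ, ∃ hp : ((segmentFunctor c).map (Q.pivot k p)).hom ∈ radical k _ _,
          b p = Submodule.Quotient.mk ⟨((segmentFunctor c).map (Q.pivot k p)).hom, hp⟩) ∧
      -- the bijections
      Function.Bijective (fun γ => indClass ((segmentFunctor c).obj (Q.seg k γ))) ∧
      (∀ {γ δ : Q.Segment} (p : γ ⟶ δ),
        IsIrreducible ((segmentFunctor c).map (Q.pivot k p)).hom) ∧
      (∀ {M N : Q.Rep k} (f : M ⟶ N), Indecomposable M → Indecomposable N → IsIrreducible f →
        ∃! p : (γ : Q.Segment) × (δ : Q.Segment) × (γ ⟶ δ),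
          Nonempty (Arrow.mk f ≅ Arrow.mk ((segmentFunctor c).map (Q.pivot k p.2.2)).hom)) ∧
      -- the rotation and the Auslander–Reiten translation
      (∀ γ : Q.Segment,
        (Q.rotation γ).map (fun δ => indClass ((segmentFunctor c).obj (Q.seg k δ))) =
          Q.arTranslation k (indClass ((segmentFunctor c).obj (Q.seg k γ)))) ∧
      (∀ γ : Q.Segment,
        Q.rotation γ = none ↔ Projective ((segmentFunctor c).obj (Q.seg k γ)).obj) ∧
      (∀ γ δ : Q.Segment, Q.rotation γ = some δ ↔
        IsTranslate ((segmentFunctor c).obj (Q.seg k γ)).obj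
          ((segmentFunctor c).obj (Q.seg k δ)).obj) ∧
      -- exactness for the induced abelian structure
      IsAbelianCategory (Mat_ (Q.SegmentCategory k)) ∧
      (segmentFunctorAdd c).IsEquivalence ∧
      PreservesFiniteLimits (segmentFunctorAdd c) ∧
      PreservesFiniteColimits (segmentFunctorAdd c) := by
  -- The last two components hold because an equivalence preserves all limits and colimits.
  refine ⟨exists_pivotScalars Q k, fun c => ⟨inferInstance, isTranslationQuiver_rotation,
    (translationQuiverIso c).isTranslationQuiver isTranslationQuiver_rotation,
    ⟨translationQuiverIso c, fun _ => rfl⟩, exists_irr_basis c, indClass_bijective c,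
    isIrreducible_pivot c, existsUnique_pivot c, rotation_arTranslation c,
    fun _ => rotation_eq_none_iff, fun _ _ => rotation_eq_some_iff, isAbelianCategory_mat c,
    inferInstance, inferInstance, inferInstance⟩⟩
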